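/- **Setting (the PaRiS protocol).** A key-value store has $N$ partitions, each replicated in some of $M$ data centers (DCs); the replica of partition $n$ in DC $m$ is the server $p_n^m$. A version of a key carries its value, the identifier of the transaction that wrote it, and an update timestamp $ut$, the commit timestamp of that transaction. Versions of a key are ordered by $ut$, ties being broken by transaction identifier and then by source DC; "freshest" refers to this order. Communication is asynchronous and lossless, FIFO between the replicas of a partition, and physical clocks are strictly increasing. *Clients.* A client $c$ runs one transaction at a time and issues one operation at a time. It keeps the highest stable timestamp $ust_c$ it has seen, the commit timestamp $hwt_c$ of its last update transaction, and a private cache of its own writes. To start a transaction it sends $ust_c$ to a coordinator, which raises its own stable timestamp to at least $ust_c$ and returns it as the snapshot timestamp $st$ of the transaction; $c$ then sets $ust_c=st$ and drops from the cache all versions with timestamp $\le st$. A read looks a key up in the transaction's write set, then in its read set, then in the cache; the remaining keys are read in parallel, each at any one replica of its partition, which returns the freshest stored version with timestamp $\le st$. Writes are buffered in the write set. A transaction that has written something is committed by two-phase commit: with $ht=\max(st,hwt_c)$, one replica of each partition involved advances its hybrid logical clock above both its old value and $ht$, and to at least its physical clock, and proposes the maximum of that clock and its stable timestamp; the commit timestamp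 is the maximum of the proposals. The client then sets $hwt_c$ to it and moves its writes to the cache, over older entries for the same keys. *Servers.* Periodically a server sets its bound $ub$ to one less than the lowest proposal among its prepared transactions or, if there are none, to the maximum of its physical and hybrid clocks. It applies its committed transactions with timestamp $\le ub$ in increasing order, replicates them to the other replicas of the partition (it sends a heartbeat with $ub$ if it had no committed transaction), and sets its own version-vector entry to $ub$; the entry for another replica is the last timestamp received from it. By gossip within and across DCs, servers compute the universal stable time (UST), the aggregate minimum of the version-vector entries last received, over all servers of all DCs; the stable timestamp of a server is the largest UST or snapshot timestamp it has met. Old versions are garbage-collected: a server may drop a version if it stores a fresher one of the same key with timestamp at most the minimum over all servers of the oldest snapshot timestamps of their active transactions (the stable timestamp of a server that has none). *Causality.* For operations $a,b$, $a\leadsto b$ is the smallest transitive relation such that $a\leadsto b$ if one client performs $a$ before $b$, or if $b$ reads a version written by $a$. A version depends on another one if the write of the former causally depends on the write of the latter. **Proposition.** Snapshots in PaRiS are causal. Precisely, take any reachable state of the protocol and any transaction $T$, started by client $c$ with snapshot timestamp $st$. Let the snapshot $S_T$ consist of all versions, written by transactions that have been given their commit timestamp, (a) with timestamp $\le st$,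 or (b) with timestamp $>st$ and written by $c$ in a transaction that it committed before starting $T$. Then: 1. $S_T$ is a causally consistent snapshot. Every causal dependency of a version in $S_T$ is in $S_T$. Moreover, if $X$ is the freshest version of its key in $S_T$ and $Y\in S_T$, there is no other version $X'$ of the key of $X$ with $X\leadsto X'\leadsto Y$. 2. The cache of $c$ at the start of $T$, after the pruning, holds for each key exactly the freshest version of that key in part (b), and nothing if there is none. 3. Every read belongs to a started transaction, and all reads of $T$, at whichever replicas they are served, are from $S_T$: a read of a key $k$ returns the value that $T$ itself last wrote to $k$ if it has written $k$; otherwise it returns the freshest version of $k$ in $S_T$, and nothing if $S_T$ contains no version of $k$. -/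

import Mathlib

namespace PaRiS

universe u v w

set_option linter.checkUnivs false in
/-- A deployment: `N` partitions, `M` data centers, a map that assigns every key to a partition, and
for every partition the set of data centers that hold a replica of it. -/
structure Config where
  N : ℕ
  M : ℕ
  Key : Type u
  Val : Type v
  Client : Type w
  part : Key → Fin N
  replicas : Fin N → Finset (Fin M)

/-- Identifiers of transactions. -/
abbrev TxId := ℕ

/-- The server `p_n^m`: one server for each partition `n` and data center `m` that replicates `n`. -/
abbrev Server (C : Config.{u, v, w}) : Type :=
  {p : Fin C.N × Fin C.M // p.2 ∈ C.replicas p.1}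

abbrev Server.part {C : Config.{u, v, w}} (p : Server C) : Fin C.N := p.1.1

abbrev Server.dc {C : Config.{u, v, w}} (p : Server C) : Fin C.M := p.1.2

/-- A version of a key: its value, its update timestamp (the commit timestamp of the transaction that
wrote it), and the identifier of that transaction. -/
@[ext]
structure Version (C : Config.{u, v, w}) where
  key : C.Key
  val : C.Val
  ut : ℕ
  tx : TxId

/-- A version as stored by servers; `sr` is the data center where it was created. -/
@[ext]
structure Item (C : Config.{u, v, w}) extends Version C where
  sr : Fin C.M

/-- The last-writer-wins order on items: by timestamp, then transaction, then source. -/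
def Item.rank {C : Config.{u, v, w}} (d : Item C) : ℕ ×ₗ (ℕ ×ₗ Fin C.M) :=
  toLex (d.ut, toLex (d.tx, d.sr))

/-- The last-writer-wins order on versions. Two versions of one key never come from the same
transaction, so the source data center is not needed. -/
def Version.rank {C : Config.{u, v, w}} (X : Version C) : ℕ ×ₗ ℕ :=
  toLex (X.ut, X.tx)

/-- `o` is the element of `A` with the highest rank, or `none` when `A` is empty. -/
def IsFreshest {α β : Type*} [LE β] (rank : α → β) (A : Set α) : Option α → Prop
  | none => A = ∅
  | some d => d ∈ A ∧ ∀ d' ∈ A, rank d' ≤ rank d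

/-- Write sets: a partial map from keys to values. -/
abbrev WSet (C : Config.{u, v, w}) := C.Key → Option C.Val

/-- What a client obtains when it reads a key: a value from its own write set, or a version. -/
abbrev Result (C : Config.{u, v, w}) := C.Val ⊕ Version C

open Classical in
/-- The write set after the writes `kvs`, done from left to right. -/
noncomputable def writeAll {C : Config.{u, v, w}} (ws : WSet C) (kvs : List (C.Key × C.Val)) :
    WSet C :=
  kvs.foldl (fun f kv => Function.update f kv.1 (some kv.2)) ws

/-- The client operations, as recorded when they complete.
`start c id st cache`: transaction `id` of `c` got snapshot timestamp `st`, and `cache` is the private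
cache of `c` after the pruning. `read c id χ D`: a parallel read of the keys `χ` that returned `D`.
`write c id kvs`: a write of the pairs `kvs`. `commit c id ct`: `id` committed at timestamp `ct`. -/
inductive Op (C : Config.{u, v, w}) where
  | start (c : C.Client) (id : TxId) (st : ℕ) (cache : C.Key → Option (Version C))
  | read (c : C.Client) (id : TxId) (χ : Finset C.Key) (D : C.Key → Option (Result C))
  | write (c : C.Client) (id : TxId) (kvs : List (C.Key × C.Val))
  | commit (c : C.Client) (id : TxId) (ct : ℕ)

def Op.client {C : Config.{u, v, w}} : Op C → C.Client
  | .start c _ _ _ => c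
  | .read c _ _ _ => c
  | .write c _ _ => c
  | .commit c _ _ => c

/-! ### Local states and messages -/

/-- What a client is doing. `p` is the coordinator and `id` the running transaction. In `reading`,
`D` holds what was found locally. -/
inductive Phase (C : Config.{u, v, w}) where
  | idle
  | starting (p : Server C)
  | active (p : Server C) (id : TxId)
  | reading (p : Server C) (id : TxId) (χ : Finset C.Key) (D : C.Key → Option (Result C))
  | committing (p : Server C) (id : TxId)

structure ClientState (C : Config.{u, v, w}) where
  phase : Phase C
  /-- highest stable snapshot timestamp known -/
  ust : ℕ
  /-- commit timestamp of the last update transaction -/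
  hwt : ℕ
  /-- private cache -/
  WC : C.Key → Option (Version C)
  /-- write set -/
  WS : WSet C
  /-- read set -/
  RS : C.Key → Option (Result C)

/-- A prepared or committed transaction at a cohort: identifier, proposed or commit timestamp, and the
writes to the keys of the cohort's partition. -/
structure Entry (C : Config.{u, v, w}) where
  id : TxId
  ts : ℕ
  D : WSet C

/-- A read that a coordinator is serving: the partitions that have not answered yet, and the items
received so far. -/
structure ReadCtx (C : Config.{u, v, w}) where
  client : C.Client
  wait : Finset (Fin C.N)
  got : C.Key → Option (Item C)

/-- A two-phase commit that a coordinator is running: the write set, the partitions involved, the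
server contacted for each of them, and the timestamps proposed so far. -/
structure CommitCtx (C : Config.{u, v, w}) where
  client : C.Client
  WS : WSet C
  parts : Finset (Fin C.N)
  tgt : Fin C.N → Server C
  resp : Fin C.N → Option ℕ

structure ServerState (C : Config.{u, v, w}) where
  /-- last reading of the physical clock -/
  clk : ℕ
  /-- hybrid logical clock -/
  hlc : ℕ
  /-- universal stable time known to the server -/
  ust : ℕ
  /-- version vector; the entries that matter are those of the replicas of the partition -/
  VV : Fin C.M → ℕ
  /-- global stabilization vector; `⊤` for a data center that shares no partition with this one -/
  GSV : Fin C.M → WithTop ℕ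
  /-- version vectors last received from the servers of the data center -/
  kVV : Server C → Fin C.M → ℕ
  /-- global stabilization vectors last received -/
  kGSV : Server C → Fin C.M → WithTop ℕ
  /-- oldest active snapshots last received -/
  kOld : Server C → ℕ
  /-- version chains -/
  store : Set (Item C)
  prepared : Set (Entry C)
  committed : Set (Entry C)
  /-- snapshot timestamps of the transactions coordinated by the server -/
  TX : TxId → Option ℕ
  reads : TxId → Option (ReadCtx C)
  commits : TxId → Option (CommitCtx C)

/-- Messages other than replication messages. Between servers, the first server is the sender. -/
inductive Msg (C : Config.{u, v, w}) where
  | startReq (c : C.Client) (p : Server C) (ust : ℕ)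
  | startResp (c : C.Client) (id : TxId) (ust : ℕ)
  | readReq (c : C.Client) (p : Server C) (id : TxId) (χ : Finset C.Key)
  | readResp (c : C.Client) (D : C.Key → Option (Item C))
  | sliceReq (p q : Server C) (id : TxId) (χ : Finset C.Key) (ust : ℕ)
  | sliceResp (q p : Server C) (id : TxId) (D : C.Key → Option (Item C))
  | commitReq (c : C.Client) (p : Server C) (id : TxId) (hwt : ℕ) (WS : WSet C)
  | commitResp (c : C.Client) (ct : ℕ)
  | prepareReq (p q : Server C) (id : TxId) (ust ht : ℕ) (D : WSet C)
  | prepareResp (q p : Server C) (id : TxId) (pt : ℕ)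
  | cohortCommit (p q : Server C) (id : TxId) (ct : ℕ)
  | gossipVV (q p : Server C) (vec : Fin C.M → ℕ)
  | gossipGSV (q p : Server C) (vec : Fin C.M → WithTop ℕ)
  | gossipOld (q p : Server C) (t : ℕ)

/-- Messages between the replicas of one partition. -/
inductive ReplMsg (C : Config.{u, v, w}) where
  | replicate (T : Set (Entry C)) (ct : ℕ)
  | heartbeat (t : ℕ)

/-- Global states. `net` holds the messages in transit, which may be delivered in any order; the
replication channels `repl p q` are FIFO queues. `used` are the transaction identifiers generated so
far. `versions` and `hist` only record what happens, the protocol never inspects them: `versions` are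
the versions whose transaction has been given its commit timestamp, and `hist` are the completed
client operations, oldest first. -/
structure State (C : Config.{u, v, w}) where
  cl : C.Client → ClientState C
  srv : Server C → ServerState C
  net : Multiset (Msg C)
  repl : Server C → Server C → List (ReplMsg C)
  used : Set TxId
  versions : Set (Version C)
  hist : List (Op C)

def State.initial (C : Config.{u, v, w}) : State C where
  cl _ :=
    { phase := .idle, ust := 0, hwt := 0, WC := fun _ => none, WS := fun _ => none,
      RS := fun _ => none }
  srv _ :=
    { clk := 0, hlc := 0, ust := 0, VV := fun _ => 0, GSV := fun _ => 0, kVV := fun _ _ => 0,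
      kGSV := fun _ _ => 0, kOld := fun _ => 0, store := ∅, prepared := ∅, committed := ∅,
      TX := fun _ => none, reads := fun _ => none, commits := fun _ => none }
  net := 0
  repl _ _ := []
  used := ∅
  versions := ∅
  hist := []

/-! ### The computations inside the handlers -/

/-- Local lookup of a read: the write set, the read set and the cache, in this order. -/
def ClientState.lookup {C : Config.{u, v, w}} (κ : ClientState C) (k : C.Key) :
    Option (Result C) :=
  ((κ.WS k).map Sum.inl).or ((κ.RS k).or ((κ.WC k).map Sum.inr))

open Classical in
/-- The part of a write set that falls into partition `i`. -/
noncomputable def WSet.slice {C : Config.{u, v, w}} (ws : WSet C) (i : Fin C.N) : WSet C :=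
  fun k => if C.part k = i then ws k else none

open Classical in
/-- The partitions with at least one key in the write set. -/
noncomputable def WSet.parts {C : Config.{u, v, w}} (ws : WSet C) : Finset (Fin C.N) :=
  Finset.univ.filter (fun i => ∃ k, C.part k = i ∧ ws k ≠ none)

/-- The items that the transactions `T`, first executed in data center `m`, create. -/
def itemsOf {C : Config.{u, v, w}} (T : Set (Entry C)) (m : Fin C.M) : Set (Item C) :=
  {d | d.sr = m ∧ ∃ e ∈ T, e.id = d.tx ∧ e.ts = d.ut ∧ e.D d.key = some d.val}

open Classical in
/-- The upper bound up to which a server may apply transactions: one less than the lowest proposed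
timestamp among the prepared transactions, or the current clock if there are none. -/
noncomputable def ServerState.bound {C : Config.{u, v, w}} (σ : ServerState C) : ℕ :=
  if σ.prepared = ∅ then max σ.clk σ.hlc else sInf (Entry.ts '' σ.prepared) - 1

open Classical in
/-- The aggregate minimum of the version vectors received from the servers of the data center of `p`.
A server has an entry only for the data centers that replicate its partition. -/
noncomputable def ServerState.aggGSV {C : Config.{u, v, w}} (σ : ServerState C) (p : Server C)
    (j : Fin C.M) : WithTop ℕ :=
  (Finset.univ.filter (fun q : Server C => q.dc = p.dc ∧ j ∈ C.replicas q.part)).inf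
    (fun q => (σ.kVV q j : WithTop ℕ))

/-- The aggregate minimum of the stabilization vectors received from all data centers. -/
noncomputable def ServerState.minGST {C : Config.{u, v, w}} (σ : ServerState C) : WithTop ℕ :=
  (Finset.univ : Finset (Server C × Fin C.M)).inf (fun x => σ.kGSV x.1 x.2)

open Classical in
/-- The oldest snapshot of an active transaction of the server, or its stable time if it has none. -/
noncomputable def ServerState.oldest {C : Config.{u, v, w}} (σ : ServerState C) : ℕ :=
  if ∀ id, σ.TX id = none then σ.ust else sInf {t | ∃ id, σ.TX id = some t}

/-- The aggregate minimum of the oldest active snapshots. -/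
noncomputable def ServerState.sOld {C : Config.{u, v, w}} (σ : ServerState C) (p : Server C) : ℕ :=
  (Finset.univ : Finset (Server C)).inf' ⟨p, Finset.mem_univ p⟩ σ.kOld

/-- Garbage collection: a key keeps its versions down to the freshest one with timestamp at most `t`. -/
def collect {C : Config.{u, v, w}} (A : Set (Item C)) (t : ℕ) : Set (Item C) :=
  {d ∈ A | ¬ ∃ d' ∈ A, d'.key = d.key ∧ d'.ut ≤ t ∧ d.rank < d'.rank}

section Updates

variable {C : Config.{u, v, w}}

open Classical in
noncomputable def State.setCl (s : State C) (c : C.Client) (κ : ClientState C) : State C :=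
  { s with cl := Function.update s.cl c κ }

noncomputable def State.setSrv (s : State C) (p : Server C) (σ : ServerState C) : State C :=
  { s with srv := Function.update s.srv p σ }

def State.withNet (s : State C) (net : Multiset (Msg C)) : State C :=
  { s with net := net }

def State.log (s : State C) (o : Op C) : State C :=
  { s with hist := s.hist ++ [o] }

/-- `p` sends the messages `ms` to all other replicas of its partition. -/
noncomputable def State.sendRepl (s : State C) (p : Server C) (ms : List (ReplMsg C)) : State C :=
  { s with repl := fun a b =>
      if a = p ∧ b.part = p.part ∧ b ≠ p then s.repl a b ++ ms else s.repl a b }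

noncomputable def State.setRepl (s : State C) (q p : Server C) (ms : List (ReplMsg C)) : State C :=
  { s with repl := Function.update s.repl q (Function.update (s.repl q) p ms) }

end Updates

/-! ### The protocol -/

/-- The steps of the protocol. Each constructor is one atomic action of a client or of a server. A
handler that reads the physical clock obtains some value `t` above the server's previous reading. -/
inductive Step {C : Config.{u, v, w}} : State C → State C → Prop
  /-- Client: request a new transaction from some coordinator `p`. -/
  | startSend (s : State C) (c : C.Client) (p : Server C)
      (hc : (s.cl c).phase = .idle) :
      Step s ((s.setCl c { s.cl c with phase := .starting p }).withNet
        (.startReq c p (s.cl c).ust ::ₘ s.net))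
  /-- Coordinator: assign an identifier and a snapshot to a new transaction. -/
  | startServe (s : State C) (net : Multiset (Msg C)) (c : C.Client) (p : Server C) (ust : ℕ)
      (id : TxId) (hm : s.net = .startReq c p ust ::ₘ net) (hid : id ∉ s.used) :
      Step s { (s.setSrv p { s.srv p with
            ust := max (s.srv p).ust ust
            TX := Function.update (s.srv p).TX id (some (max (s.srv p).ust ust)) }) with
          used := insert id s.used
          net := .startResp c id (max (s.srv p).ust ust) ::ₘ net }
  /-- Client: the transaction is started; drop from the cache what the snapshot contains. -/
  | startRecv (s : State C) (net : Multiset (Msg C)) (c : C.Client) (p : Server C) (id : TxId)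
      (ust : ℕ) (hc : (s.cl c).phase = .starting p) (hm : s.net = .startResp c id ust ::ₘ net) :
      Step s (((s.setCl c { s.cl c with
            phase := .active p id
            ust := ust
            WC := fun k => ((s.cl c).WC k).filter (fun X => ust < X.ut)
            WS := fun _ => none
            RS := fun _ => none }).withNet net).log
          (.start c id ust (fun k => ((s.cl c).WC k).filter (fun X => ust < X.ut))))
  /-- Client: read the keys `χ`; those not found locally are requested from the coordinator. -/
  | readSend (s : State C) (c : C.Client) (p : Server C) (id : TxId) (χ χ' : Finset C.Key)
      (D : C.Key → Option (Result C)) (hc : (s.cl c).phase = .active p id)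
      (hD : ∀ k, (k ∈ χ → D k = (s.cl c).lookup k) ∧ (k ∉ χ → D k = none))
      (hχ : ∀ k, k ∈ χ' ↔ k ∈ χ ∧ D k = none) :
      Step s ((s.setCl c { s.cl c with phase := .reading p id χ D }).withNet
        (.readReq c p id χ' ::ₘ s.net))
  /-- Coordinator: ask one replica of every partition involved, chosen by `tgt`. -/
  | readServe (s : State C) (net : Multiset (Msg C)) (c : C.Client) (p : Server C) (id : TxId)
      (χ : Finset C.Key) (st : ℕ) (parts : Finset (Fin C.N)) (slice : Fin C.N → Finset C.Key)
      (tgt : Fin C.N → Server C) (hm : s.net = .readReq c p id χ ::ₘ net)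
      (hst : (s.srv p).TX id = some st)
      (hparts : ∀ i, i ∈ parts ↔ ∃ k ∈ χ, C.part k = i)
      (hslice : ∀ i k, k ∈ slice i ↔ k ∈ χ ∧ C.part k = i)
      (htgt : ∀ i ∈ parts, (tgt i).part = i) :
      Step s ((s.setSrv p { s.srv p with
            reads := Function.update (s.srv p).reads id (some ⟨c, parts, fun _ => none⟩) }).withNet
          (net + parts.val.map (fun i => .sliceReq p (tgt i) id (slice i) st)))
  /-- Cohort: return, for each key, the freshest stored item in the snapshot `ust`. -/
  | sliceServe (s : State C) (net : Multiset (Msg C)) (p q : Server C) (id : TxId)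
      (χ : Finset C.Key) (ust : ℕ) (D : C.Key → Option (Item C))
      (hm : s.net = .sliceReq p q id χ ust ::ₘ net)
      (hD : ∀ k, (k ∈ χ → IsFreshest Item.rank {d ∈ (s.srv q).store | d.key = k ∧ d.ut ≤ ust} (D k))
        ∧ (k ∉ χ → D k = none)) :
      Step s ((s.setSrv q { s.srv q with ust := max (s.srv q).ust ust }).withNet
        (.sliceResp q p id D ::ₘ net))
  /-- Coordinator: collect the answer of one partition. -/
  | sliceRecv (s : State C) (net : Multiset (Msg C)) (q p : Server C) (id : TxId)
      (D : C.Key → Option (Item C)) (r : ReadCtx C) (hm : s.net = .sliceResp q p id D ::ₘ net)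
      (hr : (s.srv p).reads id = some r) :
      Step s ((s.setSrv p { s.srv p with
            reads := Function.update (s.srv p).reads id (some { r with
              wait := r.wait.erase q.part
              got := fun k => (D k).or (r.got k) }) }).withNet net)
  /-- Coordinator: all partitions have answered. -/
  | readDone (s : State C) (p : Server C) (id : TxId) (r : ReadCtx C)
      (hr : (s.srv p).reads id = some r) (hw : r.wait = ∅) :
      Step s ((s.setSrv p { s.srv p with
            reads := Function.update (s.srv p).reads id none }).withNet
          (.readResp r.client r.got ::ₘ s.net))
  /-- Client: the read returns. -/
  | readRecv (s : State C) (net : Multiset (Msg C)) (c : C.Client) (p : Server C) (id : TxId)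
      (χ : Finset C.Key) (D D' : C.Key → Option (Result C)) (I : C.Key → Option (Item C))
      (hc : (s.cl c).phase = .reading p id χ D) (hm : s.net = .readResp c I ::ₘ net)
      (hD' : ∀ k, D' k = (D k).or ((I k).map (fun d => .inr d.toVersion))) :
      Step s (((s.setCl c { s.cl c with
            phase := .active p id
            RS := fun k => (D' k).or ((s.cl c).RS k) }).withNet net).log (.read c id χ D'))
  /-- Client: buffer writes in the write set. -/
  | write (s : State C) (c : C.Client) (p : Server C) (id : TxId) (kvs : List (C.Key × C.Val))
      (hc : (s.cl c).phase = .active p id) :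
      Step s ((s.setCl c { s.cl c with WS := writeAll (s.cl c).WS kvs }).log (.write c id kvs))
  /-- Client: end a transaction that has written nothing. -/
  | finish (s : State C) (c : C.Client) (p : Server C) (id : TxId)
      (hc : (s.cl c).phase = .active p id) (hWS : ∀ k, (s.cl c).WS k = none) :
      Step s (s.setCl c { s.cl c with phase := .idle })
  /-- Client: request the commit of a transaction that has written something. -/
  | commitSend (s : State C) (c : C.Client) (p : Server C) (id : TxId)
      (hc : (s.cl c).phase = .active p id) (hWS : ∃ k, (s.cl c).WS k ≠ none) :
      Step s ((s.setCl c { s.cl c with phase := .committing p id }).withNet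
        (.commitReq c p id (s.cl c).hwt (s.cl c).WS ::ₘ s.net))
  /-- Coordinator: start the two-phase commit with one replica of every partition involved. -/
  | commitServe (s : State C) (net : Multiset (Msg C)) (c : C.Client) (p : Server C) (id : TxId)
      (hwt st : ℕ) (WS : WSet C) (tgt : Fin C.N → Server C)
      (hm : s.net = .commitReq c p id hwt WS ::ₘ net) (hst : (s.srv p).TX id = some st)
      (htgt : ∀ i ∈ WS.parts, (tgt i).part = i) :
      Step s ((s.setSrv p { s.srv p with
            commits := Function.update (s.srv p).commits id
              (some ⟨c, WS, WS.parts, tgt, fun _ => none⟩) }).withNet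
          (net + WS.parts.val.map
            (fun i => .prepareReq p (tgt i) id st (max st hwt) (WS.slice i))))
  /-- Cohort: propose a commit timestamp. -/
  | prepare (s : State C) (net : Multiset (Msg C)) (p q : Server C) (id : TxId) (ust ht : ℕ)
      (D : WSet C) (t hlc ust' pt : ℕ) (hm : s.net = .prepareReq p q id ust ht D ::ₘ net)
      (hclk : (s.srv q).clk < t) (hhlc : hlc = max t (max (ht + 1) ((s.srv q).hlc + 1)))
      (hust : ust' = max (s.srv q).ust ust) (hpt : pt = max hlc ust') :
      Step s ((s.setSrv q { s.srv q with
            clk := t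
            hlc := hlc
            ust := ust'
            prepared := insert ⟨id, pt, D⟩ (s.srv q).prepared }).withNet
          (.prepareResp q p id pt ::ₘ net))
  /-- Coordinator: collect the proposal of one partition. -/
  | prepareRecv (s : State C) (net : Multiset (Msg C)) (q p : Server C) (id : TxId) (pt : ℕ)
      (r : CommitCtx C) (hm : s.net = .prepareResp q p id pt ::ₘ net)
      (hr : (s.srv p).commits id = some r) :
      Step s ((s.setSrv p { s.srv p with
            commits := Function.update (s.srv p).commits id
              (some { r with resp := Function.update r.resp q.part (some pt) }) }).withNet net)
  /-- Coordinator: all partitions have proposed; fix the commit timestamp, tell the cohorts and the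
  client, and clear the context. The versions of the transaction now exist. -/
  | decide (s : State C) (p : Server C) (id : TxId) (r : CommitCtx C) (pt : Fin C.N → ℕ) (ct : ℕ)
      (hr : (s.srv p).commits id = some r) (hpt : ∀ i ∈ r.parts, r.resp i = some (pt i))
      (hct : ct = r.parts.sup pt) :
      Step s { (s.setSrv p { s.srv p with
            TX := Function.update (s.srv p).TX id none
            commits := Function.update (s.srv p).commits id none }) with
          net := .commitResp r.client ct ::ₘ
            (s.net + r.parts.val.map (fun i => .cohortCommit p (r.tgt i) id ct))
          versions := s.versions ∪ {X | X.tx = id ∧ X.ut = ct ∧ r.WS X.key = some X.val} }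
  /-- Cohort: move a prepared transaction to the committed ones. -/
  | cohortCommit (s : State C) (net : Multiset (Msg C)) (p q : Server C) (id : TxId) (ct t : ℕ)
      (e : Entry C) (hm : s.net = .cohortCommit p q id ct ::ₘ net) (hclk : (s.srv q).clk < t)
      (he : e ∈ (s.srv q).prepared) (hid : e.id = id) :
      Step s ((s.setSrv q { s.srv q with
            clk := t
            hlc := max (s.srv q).hlc (max ct t)
            prepared := (s.srv q).prepared \ {e}
            committed := insert ⟨id, ct, e.D⟩ (s.srv q).committed }).withNet net)
  /-- Client: the transaction is committed; its writes go to the cache, over older entries. -/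
  | commitRecv (s : State C) (net : Multiset (Msg C)) (c : C.Client) (p : Server C) (id : TxId)
      (ct : ℕ) (hc : (s.cl c).phase = .committing p id) (hm : s.net = .commitResp c ct ::ₘ net) :
      Step s (((s.setCl c { s.cl c with
            phase := .idle
            hwt := ct
            WC := fun k => (((s.cl c).WS k).map (fun v => ⟨k, v, ct, id⟩)).or ((s.cl c).WC k)
            WS := fun _ => none }).withNet net).log (.commit c id ct))
  /-- Server: apply the committed transactions up to the bound, and replicate them in increasing
  order of commit timestamps, one message for each timestamp. -/
  | apply (s : State C) (p : Server C) (t ub : ℕ) (cts : List ℕ) (hclk : (s.srv p).clk < t)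
      (hub : ub = ServerState.bound { s.srv p with clk := t }) (hne : (s.srv p).committed ≠ ∅)
      (hsorted : cts.Pairwise (· < ·))
      (hcts : ∀ ct, ct ∈ cts ↔ ct ≤ ub ∧ ∃ e ∈ (s.srv p).committed, e.ts = ct) :
      Step s ((s.setSrv p { s.srv p with
            clk := t
            store := (s.srv p).store ∪ itemsOf {e ∈ (s.srv p).committed | e.ts ≤ ub} p.dc
            committed := {e ∈ (s.srv p).committed | ub < e.ts}
            VV := Function.update (s.srv p).VV p.dc ub }).sendRepl p
          (cts.map (fun ct => .replicate {e ∈ (s.srv p).committed | e.ts = ct} ct)))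
  /-- Server: nothing to apply; advance the version clock and send it to the other replicas. -/
  | heartbeat (s : State C) (p : Server C) (t ub : ℕ) (hclk : (s.srv p).clk < t)
      (hub : ub = ServerState.bound { s.srv p with clk := t }) (hne : (s.srv p).committed = ∅) :
      Step s ((s.setSrv p { s.srv p with
            clk := t
            VV := Function.update (s.srv p).VV p.dc ub }).sendRepl p [.heartbeat ub])
  /-- Server: receive replicated transactions from `q`. -/
  | replRecv (s : State C) (q p : Server C) (T : Set (Entry C)) (ct : ℕ) (l : List (ReplMsg C))
      (hm : s.repl q p = .replicate T ct :: l) :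
      Step s ((s.setSrv p { s.srv p with
            store := (s.srv p).store ∪ itemsOf T q.dc
            VV := Function.update (s.srv p).VV q.dc ct }).setRepl q p l)
  /-- Server: receive a heartbeat from `q`. -/
  | heartbeatRecv (s : State C) (q p : Server C) (t : ℕ) (l : List (ReplMsg C))
      (hm : s.repl q p = .heartbeat t :: l) :
      Step s ((s.setSrv p { s.srv p with
            VV := Function.update (s.srv p).VV q.dc t }).setRepl q p l)
  /-- Stabilization: send the version vector to the servers of the data center. -/
  | sendVV (s : State C) (p : Server C) :
      Step s (s.withNet (s.net +
        (Finset.univ.filter (fun q : Server C => q.dc = p.dc)).val.map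
          (fun q => .gossipVV p q (s.srv p).VV)))
  | recvVV (s : State C) (net : Multiset (Msg C)) (q p : Server C) (vec : Fin C.M → ℕ)
      (hm : s.net = .gossipVV q p vec ::ₘ net) :
      Step s ((s.setSrv p { s.srv p with
        kVV := Function.update (s.srv p).kVV q vec }).withNet net)
  | computeGSV (s : State C) (p : Server C) :
      Step s (s.setSrv p { s.srv p with GSV := (s.srv p).aggGSV p })
  /-- Stabilization: send the stabilization vector to all servers. -/
  | sendGSV (s : State C) (p : Server C) :
      Step s (s.withNet (s.net + (Finset.univ : Finset (Server C)).val.map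
        (fun q => .gossipGSV p q (s.srv p).GSV)))
  | recvGSV (s : State C) (net : Multiset (Msg C)) (q p : Server C) (vec : Fin C.M → WithTop ℕ)
      (hm : s.net = .gossipGSV q p vec ::ₘ net) :
      Step s ((s.setSrv p { s.srv p with
        kGSV := Function.update (s.srv p).kGSV q vec }).withNet net)
  /-- Stabilization: compute the universal stable time. The minimum is never `⊤`, since it includes
  the entry of `p` for its own data center. -/
  | computeUST (s : State C) (p : Server C) :
      Step s (s.setSrv p { s.srv p with
        ust := max ((s.srv p).minGST.untopD 0) (s.srv p).ust })
  /-- Garbage collection: send the oldest active snapshot to all servers. -/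
  | sendOld (s : State C) (p : Server C) :
      Step s (s.withNet (s.net + (Finset.univ : Finset (Server C)).val.map
        (fun q => .gossipOld p q (s.srv p).oldest)))
  | recvOld (s : State C) (net : Multiset (Msg C)) (q p : Server C) (t : ℕ)
      (hm : s.net = .gossipOld q p t ::ₘ net) :
      Step s ((s.setSrv p { s.srv p with
        kOld := Function.update (s.srv p).kOld q t }).withNet net)
  | garbageCollect (s : State C) (p : Server C) :
      Step s (s.setSrv p { s.srv p with
        store := collect (s.srv p).store ((s.srv p).sOld p) })

/-- The states that occur in executions of the protocol. -/
def Reachable {C : Config.{u, v, w}} (s : State C) : Prop :=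
  Relation.ReflTransGen Step (State.initial C) s

/-! ### Causality -/

/-- The `i`-th operation writes the version of key `k` that belongs to transaction `id`. -/
def WritesAt {C : Config.{u, v, w}} (h : List (Op C)) (i : ℕ) (k : C.Key) (id : TxId) : Prop :=
  ∃ c kvs, h[i]? = some (.write c id kvs) ∧ k ∈ kvs.map Prod.fst

/-- The `j`-th operation is a read that returns the version of key `k` of transaction `id`. -/
def ReadsAt {C : Config.{u, v, w}} (h : List (Op C)) (j : ℕ) (k : C.Key) (id : TxId) : Prop :=
  ∃ c id' χ D X, h[j]? = some (.read c id' χ D) ∧ k ∈ χ ∧ D k = some (.inr X) ∧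
    X.key = k ∧ X.tx = id

/-- The causality relation between operations, given by their positions in the history: order within
one client, reading a written version, and transitivity. If a transaction writes a key several times,
its last write gives the version its value; the earlier ones precede it in the order of the client, so
they may be counted as writes of the version too. -/
inductive Causes {C : Config.{u, v, w}} (h : List (Op C)) : ℕ → ℕ → Prop
  | thread {i j : ℕ} (a b : Op C) (hi : h[i]? = some a) (hj : h[j]? = some b) (hij : i < j)
      (hab : a.client = b.client) : Causes h i j
  | readsFrom {i j : ℕ} (k : C.Key) (id : TxId) (hi : WritesAt h i k id) (hj : ReadsAt h j k id) :
      Causes h i j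
  | trans {i j l : ℕ} (hij : Causes h i j) (hjl : Causes h j l) : Causes h i l

/-- The version of `k₂` written by `id₂` causally depends on that of `k₁` written by `id₁`. -/
def DependsOn {C : Config.{u, v, w}} (h : List (Op C)) (k₂ : C.Key) (id₂ : TxId) (k₁ : C.Key)
    (id₁ : TxId) : Prop :=
  ∃ i j, WritesAt h i k₁ id₁ ∧ WritesAt h j k₂ id₂ ∧ Causes h i j

/-- A causally consistent snapshot. First, it contains all causal dependencies of its versions.
Second, if `X` is the version of its key that the snapshot shows and `Y` is in the snapshot, then no
other version of the key of `X` lies causally between `X` and `Y`. -/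
structure IsCausalSnapshot {C : Config.{u, v, w}} (s : State C) (S : Set (Version C)) : Prop where
  subset : S ⊆ s.versions
  closed : ∀ Y ∈ S, ∀ k id, DependsOn s.hist Y.key Y.tx k id → ∃ X ∈ S, X.key = k ∧ X.tx = id
  no_between : ∀ X Y : Version C, IsFreshest Version.rank {Z ∈ S | Z.key = X.key} (some X) → Y ∈ S →
    ¬ ∃ X' ∈ s.versions, X'.key = X.key ∧ X' ≠ X ∧
      DependsOn s.hist X'.key X'.tx X.key X.tx ∧ DependsOn s.hist Y.key Y.tx X'.key X'.tx

/-! ### The snapshot of a transaction -/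

/-- Client `c` committed transaction `id'` before it started transaction `id`. -/
def CommittedBefore {C : Config.{u, v, w}} (h : List (Op C)) (c : C.Client) (id' id : TxId) : Prop :=
  ∃ (i j ct st : ℕ) (cache : C.Key → Option (Version C)), i < j ∧ h[i]? = some (.commit c id' ct) ∧ h[j]? = some (.start c id st cache)

/-- The stable part of a snapshot: all versions with timestamp at most `st`. -/
def stablePart {C : Config.{u, v, w}} (s : State C) (st : ℕ) : Set (Version C) :=
  {X ∈ s.versions | X.ut ≤ st}

/-- The client's own part of the snapshot of transaction `id`: what `c` wrote in its earlier
transactions and is not in the stable part. -/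
def ownPart {C : Config.{u, v, w}} (s : State C) (c : C.Client) (id : TxId) (st : ℕ) :
    Set (Version C) :=
  {X ∈ s.versions | st < X.ut ∧ CommittedBefore s.hist c X.tx id}

/-- The snapshot of transaction `id` of client `c` with snapshot timestamp `st`. -/
def snapshot {C : Config.{u, v, w}} (s : State C) (c : C.Client) (id : TxId) (st : ℕ) :
    Set (Version C) :=
  stablePart s st ∪ ownPart s c id st

open Classical in
/-- What transaction `id` has written in the operations `h`. -/
noncomputable def bufferedWrites {C : Config.{u, v, w}} (h : List (Op C)) (id : TxId) : WSet C :=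
  h.foldl (fun ws o => match o with
    | .write _ id' kvs => if id' = id then writeAll ws kvs else ws
    | _ => ws) (fun _ => none)

/-- The result `o` of reading `k` in a transaction with write buffer `ws` and snapshot `S`: the
transaction's own last write of `k` if there is one, else the freshest version of `k` in `S`. -/
def ReadsCorrectly {C : Config.{u, v, w}} (ws : WSet C) (S : Set (Version C)) (k : C.Key)
    (o : Option (Result C)) : Prop :=
  match ws k with
  | some x => o = some (.inl x)
  | none => ∃ oX : Option (Version C), o = oX.map .inr ∧
      IsFreshest Version.rank {X ∈ S | X.key = k} oX

end PaRiS

namespace PaRiS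

universe u v w

variable {C : Config.{u, v, w}}

/-! The proof carries an inductive invariant `Inv` through the steps. It is stated with a ghost
state that records what each transaction has fixed so far: client, coordinator and snapshot
timestamp; final write set; proposals; commit timestamp. Each of these is set once and never changes
(`GStep.le`). Three arguments then give the theorem.

Stable part. Call a timestamp safe if no relevant version vector entry is below it (`Safe`). Gossip
only takes minima of values that once were version vector entries, and those entries never decrease
(`Clk.VV_mono`), so every stable time and every snapshot timestamp is safe (`Stab`). A server's own
entry stays strictly below all its prepared transactions and all its committed transactions not yet
applied, and along a FIFO channel the receiver's entry is strictly below every transaction still in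
transit (`Clk`). Hence a new commit timestamp exceeds every safe timestamp
(`GStep.lt_of_new_version`), which freezes the set of versions with timestamp at most `st`. Moreover
no such version can still be prepared, unapplied or in a channel, so it has reached every replica
(`covered_of_version`). Garbage collection may have removed it, but only in favour of a fresher item
below every active snapshot (`Covered.collect`), a property that persists because the oldest active
snapshot of a server never decreases (`Old.oldest_le`). So any replica answers a read with the
freshest stable version (`isFreshest_stablePart`).

Own part. A commit timestamp exceeds the `hwt` sent with the commit request (`Ctl.lt_ct`), so the
commit timestamps of one client increase and overwriting the cache keeps the freshest version.
Pruning at a start leaves exactly the own part (`Cache`), which does not change afterwards. Its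
versions are newer than `st`, so looking into the cache before asking a server is right
(`readsCorrectly_of_read`). Since snapshots are constant, the read set stays right as well.

Causality. Following a causal chain from a write of transaction `id`, every operation either comes
later at the same client or belongs to a transaction whose snapshot timestamp is at least the commit
timestamp of `id` (`knows_of_causes`). A dependency of a version thus comes from the same
transaction or has a strictly smaller timestamp (`exists_version_of_dependsOn`). Closure of the
snapshot and the absence of an intermediate version follow (`isCausalSnapshot`). -/

/-- The transaction that an operation belongs to. -/
def Op.tx : Op C → TxId
  | .start _ id _ _ => id
  | .read _ id _ _ => id
  | .write _ id _ => id
  | .commit _ id _ => id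

/-- The transaction of a client that may still read and write, with its coordinator. -/
def Phase.run : Phase C → Option (Server C × TxId)
  | .active p id => some (p, id)
  | .reading p id _ _ => some (p, id)
  | _ => none

/-- The transaction of a client that has not ended yet, with its coordinator. -/
def Phase.cur : Phase C → Option (Server C × TxId)
  | .active p id => some (p, id)
  | .reading p id _ _ => some (p, id)
  | .committing p id => some (p, id)
  | _ => none

theorem Phase.cur_of_run {φ : Phase C} {x : Server C × TxId} (h : φ.run = some x) :
    φ.cur = some x := by
  cases φ <;> first | exact h | exact absurd h (by simp [Phase.run])

/-! ### Ghost state and the control invariant -/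

/-- What has been fixed about the transactions so far: client, coordinator and snapshot timestamp; the
final write set, and the `hwt` that was sent with it; for each partition the cohort and its proposal;
the commit timestamp. -/
structure Ghost (C : Config.{u, v, w}) where
  info : TxId → Option (C.Client × Server C × ℕ)
  fin : TxId → Option (WSet C × ℕ)
  prop : TxId → Fin C.N → Option (Server C × ℕ)
  ct : TxId → Option ℕ

def Ghost.initial (C : Config.{u, v, w}) : Ghost C :=
  ⟨fun _ => none, fun _ => none, fun _ _ => none, fun _ => none⟩

/-- Tokens: at most one message in transit carries a given one. -/
inductive Tok (C : Config.{u, v, w}) where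
  | cl (c : C.Client)
  | slice (id : TxId) (i : Fin C.N)
  | prep (id : TxId) (i : Fin C.N)

/-- A request and the answer to it share a token, so each handler consumes a token and passes it on.
Uniqueness of tokens in transit then says that a client, or a partition asked by a coordinator, has
at most one outstanding exchange. The remaining messages need no uniqueness. -/
def Msg.tok : Msg C → Option (Tok C)
  | .startReq c _ _ => some (.cl c)
  | .startResp c _ _ => some (.cl c)
  | .readReq c _ _ _ => some (.cl c)
  | .readResp c _ => some (.cl c)
  | .commitReq c _ _ _ _ => some (.cl c)
  | .commitResp c _ => some (.cl c)
  | .sliceReq _ q id _ _ => some (.slice id q.part)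
  | .sliceResp q _ id _ => some (.slice id q.part)
  | .prepareReq _ q id _ _ _ => some (.prep id q.part)
  | _ => none

def NoTok (net : Multiset (Msg C)) (a : Tok C) : Prop := ∀ m ∈ net, m.tok ≠ some a

/-- What a message in transit says about the state. -/
def MsgOK (s : State C) (g : Ghost C) : Msg C → Prop
  | .startReq c p u => (s.cl c).phase = .starting p ∧ u = (s.cl c).ust
  | .startResp c id u => ∃ p, (s.cl c).phase = .starting p ∧ g.info id = some (c, p, u) ∧
      (s.srv p).TX id = some u ∧ g.fin id = none ∧ (s.cl c).ust ≤ u ∧ ∀ o ∈ s.hist, o.tx ≠ id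
  | .readReq c p id χ' => ∃ χ D, (s.cl c).phase = .reading p id χ D ∧
      ∀ k, k ∈ χ' ↔ k ∈ χ ∧ D k = none
  | .readResp c _ => ∃ p id χ D, (s.cl c).phase = .reading p id χ D
  | .sliceReq p q id _ st => (∃ r, (s.srv p).reads id = some r ∧ q.part ∈ r.wait) ∧
      ∃ c, g.info id = some (c, p, st)
  | .sliceResp q p id _ => ∃ r, (s.srv p).reads id = some r ∧ q.part ∈ r.wait
  | .commitReq c p id hwt WS => (s.cl c).phase = .committing p id ∧ hwt = (s.cl c).hwt ∧
      WS = (s.cl c).WS ∧ g.ct id = none ∧ ∀ i, g.prop id i = none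
  | .commitResp c t => ∃ p id, (s.cl c).phase = .committing p id ∧ g.ct id = some t
  | .prepareReq p q id ust ht D => ∃ r c h, (s.srv p).commits id = some r ∧ q.part ∈ r.parts ∧
      r.tgt q.part = q ∧ g.prop id q.part = none ∧ g.info id = some (c, p, ust) ∧
      g.fin id = some (r.WS, h) ∧ D = r.WS.slice q.part ∧ ht = max ust h
  | .prepareResp q _ id pt => g.prop id q.part = some (q, pt)
  | .cohortCommit _ q id t => g.ct id = some t ∧ ∃ pt, g.prop id q.part = some (q, pt)
  | _ => True

/-- The invariant for the context of a two-phase commit. -/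
structure CommitOK (s : State C) (g : Ghost C) (p : Server C) (id : TxId) (r : CommitCtx C) :
    Prop where
  phase : (s.cl r.client).phase = .committing p id
  noTok : NoTok s.net (.cl r.client)
  fin : ∃ h, g.fin id = some (r.WS, h)
  ct : g.ct id = none
  parts : r.parts = r.WS.parts
  tgt_part : ∀ i ∈ r.parts, (r.tgt i).part = i
  tgt : ∀ i q pt, g.prop id i = some (q, pt) → r.tgt i = q
  resp : ∀ i pt, r.resp i = some pt → ∃ q, g.prop id i = some (q, pt)

/-- The control part of the invariant: sessions of the clients and two-phase commit. -/
structure Ctl (s : State C) (g : Ghost C) : Prop where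
  used : ∀ id, id ∈ s.used ↔ g.info id ≠ none
  used_finite : s.used.Finite
  nodup : (s.net.filterMap Msg.tok).Nodup
  msg : ∀ m ∈ s.net, MsgOK s g m
  hist : ∀ o ∈ s.hist, ∃ p st, g.info o.tx = some (o.client, p, st)
  cur : ∀ c p id, (s.cl c).phase.cur = some (p, id) → g.info id = some (c, p, (s.cl c).ust)
  run : ∀ c p id, (s.cl c).phase.run = some (p, id) →
    (s.srv p).TX id = some (s.cl c).ust ∧ g.fin id = none
  committing : ∀ c p id, (s.cl c).phase = .committing p id →
    g.fin id = some ((s.cl c).WS, (s.cl c).hwt)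
  reads : ∀ p id r, (s.srv p).reads id = some r →
    (∃ χ D, (s.cl r.client).phase = .reading p id χ D) ∧ NoTok s.net (.cl r.client)
  commits : ∀ p id r, (s.srv p).commits id = some r → CommitOK s g p id r
  tx : ∀ p id st, (s.srv p).TX id = some st → ∃ c, g.info id = some (c, p, st)
  fin : ∀ id W h, g.fin id = some (W, h) → g.info id ≠ none ∧ ∃ k, W k ≠ none
  prop : ∀ id i q pt, g.prop id i = some (q, pt) → q.part = i ∧ ∃ W h c p st,
    g.fin id = some (W, h) ∧ g.info id = some (c, p, st) ∧ i ∈ W.parts ∧ h < pt ∧ st < pt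
  ct : ∀ id t, g.ct id = some t → ∃ W h, g.fin id = some (W, h) ∧
    ∀ i ∈ W.parts, ∃ q pt, g.prop id i = some (q, pt) ∧ pt ≤ t
  versions : ∀ X, X ∈ s.versions ↔
    g.ct X.tx = some X.ut ∧ ∃ W h, g.fin X.tx = some (W, h) ∧ W X.key = some X.val

/-! ### Projections of updated states -/

section Projections

variable (s : State C)

open Classical in
theorem State.cl_setCl (c c' : C.Client) (κ : ClientState C) :
    (s.setCl c κ).cl c' = if c' = c then κ else s.cl c' := by
  simp [State.setCl, Function.update_apply]

@[simp] theorem State.cl_setCl_self (c : C.Client) (κ : ClientState C) :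
    (s.setCl c κ).cl c = κ := by
  simp [State.setCl]

theorem State.cl_setCl_ne {c c' : C.Client} (κ : ClientState C) (h : c' ≠ c) :
    (s.setCl c κ).cl c' = s.cl c' := by
  simp [State.setCl, h]

theorem State.srv_setSrv (p p' : Server C) (σ : ServerState C) :
    (s.setSrv p σ).srv p' = if p' = p then σ else s.srv p' := by
  simp [State.setSrv, Function.update_apply]

@[simp] theorem State.srv_setSrv_self (p : Server C) (σ : ServerState C) :
    (s.setSrv p σ).srv p = σ := by
  simp [State.setSrv]

theorem State.srv_setSrv_ne {p p' : Server C} (σ : ServerState C) (h : p' ≠ p) :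
    (s.setSrv p σ).srv p' = s.srv p' := by
  simp [State.setSrv, h]

@[simp] theorem State.srv_setCl (c : C.Client) (κ : ClientState C) :
    (s.setCl c κ).srv = s.srv := rfl
@[simp] theorem State.hist_setCl (c : C.Client) (κ : ClientState C) :
    (s.setCl c κ).hist = s.hist := rfl

@[simp] theorem State.cl_setSrv (p : Server C) (σ : ServerState C) :
    (s.setSrv p σ).cl = s.cl := rfl
@[simp] theorem State.repl_setSrv (p : Server C) (σ : ServerState C) :
    (s.setSrv p σ).repl = s.repl := rfl

@[simp] theorem State.cl_withNet (net : Multiset (Msg C)) : (s.withNet net).cl = s.cl := rfl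
@[simp] theorem State.srv_withNet (net : Multiset (Msg C)) : (s.withNet net).srv = s.srv := rfl
@[simp] theorem State.net_withNet (net : Multiset (Msg C)) : (s.withNet net).net = net := rfl
@[simp] theorem State.hist_withNet (net : Multiset (Msg C)) : (s.withNet net).hist = s.hist := rfl

@[simp] theorem State.cl_log (o : Op C) : (s.log o).cl = s.cl := rfl
@[simp] theorem State.srv_log (o : Op C) : (s.log o).srv = s.srv := rfl
@[simp] theorem State.hist_log (o : Op C) : (s.log o).hist = s.hist ++ [o] := rfl

@[simp] theorem State.cl_sendRepl (p : Server C) (ms : List (ReplMsg C)) :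
    (s.sendRepl p ms).cl = s.cl := rfl
@[simp] theorem State.srv_sendRepl (p : Server C) (ms : List (ReplMsg C)) :
    (s.sendRepl p ms).srv = s.srv := rfl
@[simp] theorem State.repl_sendRepl (p : Server C) (ms : List (ReplMsg C)) (a b : Server C) :
    (s.sendRepl p ms).repl a b =
      if a = p ∧ b.part = p.part ∧ b ≠ p then s.repl a b ++ ms else s.repl a b := by
  simp only [State.sendRepl]

@[simp] theorem State.cl_setRepl (q p : Server C) (ms : List (ReplMsg C)) :
    (s.setRepl q p ms).cl = s.cl := rfl
@[simp] theorem State.srv_setRepl (q p : Server C) (ms : List (ReplMsg C)) :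
    (s.setRepl q p ms).srv = s.srv := rfl
@[simp] theorem State.repl_setRepl (q p : Server C) (ms : List (ReplMsg C)) (a b : Server C) :
    (s.setRepl q p ms).repl a b = if a = q ∧ b = p then ms else s.repl a b := by
  simp only [State.setRepl, Function.update_apply]
  by_cases h : a = q <;> by_cases h' : b = p <;> simp [h, h']

variable {s}

/-- A component of the server states that an update does not touch. -/
theorem State.proj_setSrv {α : Type*} (f : ServerState C → α) {p : Server C} {σ : ServerState C}
    (h : f σ = f (s.srv p)) (p' : Server C) : f ((s.setSrv p σ).srv p') = f (s.srv p') := by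
  rw [State.srv_setSrv]
  split_ifs with hp
  · rw [h, hp]
  · rfl

/-- A component of the server states that an update changes at one transaction. -/
theorem State.proj_setSrv_update {α : Type*} (f : ServerState C → TxId → α) {p : Server C}
    {σ : ServerState C} {id : TxId} {x : α} (h : f σ = Function.update (f (s.srv p)) id x)
    (p' : Server C) (id' : TxId) :
    f ((s.setSrv p σ).srv p') id' = if p' = p ∧ id' = id then x else f (s.srv p') id' := by
  rw [State.srv_setSrv]
  by_cases hp : p' = p
  · simp [h, hp, Function.update_apply]
  · simp [hp]

theorem State.proj_setCl {α : Type*} (f : ClientState C → α) {c : C.Client} {κ : ClientState C}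
    (h : f κ = f (s.cl c)) (c' : C.Client) : f ((s.setCl c κ).cl c') = f (s.cl c') := by
  rw [State.cl_setCl]
  split_ifs with hp
  · rw [h, hp]
  · rfl

end Projections

variable {s s' : State C} {g g' : Ghost C}

/-! ### Tokens -/

def toks (net : Multiset (Msg C)) : Multiset (Tok C) := net.filterMap Msg.tok

theorem mem_toks {net : Multiset (Msg C)} {a : Tok C} :
    a ∈ toks net ↔ ∃ m ∈ net, m.tok = some a := by
  simp [toks]

theorem noTok_iff {net : Multiset (Msg C)} {a : Tok C} : NoTok net a ↔ a ∉ toks net := by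
  simp [NoTok, mem_toks]

theorem toks_cons_some {m : Msg C} {a : Tok C} (net : Multiset (Msg C)) (h : m.tok = some a) :
    toks (m ::ₘ net) = a ::ₘ toks net :=
  Multiset.filterMap_cons_some _ _ _ h

theorem toks_cons_none {m : Msg C} (net : Multiset (Msg C)) (h : m.tok = none) :
    toks (m ::ₘ net) = toks net :=
  Multiset.filterMap_cons_none _ _ h

theorem toks_add (net net' : Multiset (Msg C)) : toks (net + net') = toks net + toks net' :=
  Multiset.filterMap_add _ _ _

theorem toks_map_none {ι : Type*} (S : Multiset ι) (f : ι → Msg C) (h : ∀ i, (f i).tok = none) :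
    toks (S.map f) = 0 := by
  induction S using Multiset.induction_on with
  | empty => rfl
  | cons i S ih => rw [Multiset.map_cons, toks_cons_none _ (h i), ih]

theorem toks_map_some {ι : Type*} (S : Multiset ι) (f : ι → Msg C) (t : ι → Tok C)
    (h : ∀ i ∈ S, (f i).tok = some (t i)) : toks (S.map f) = S.map t := by
  induction S using Multiset.induction_on with
  | empty => rfl
  | cons i S ih =>
    rw [Multiset.map_cons, toks_cons_some _ (h i (by simp)), ih fun j hj => h j (by simp [hj]),
      Multiset.map_cons]

theorem nodup_toks_add_map {ι : Type*} {net : Multiset (Msg C)} {S : Finset ι} {f : ι → Msg C}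
    {t : ι → Tok C} (hn : (toks net).Nodup) (h : ∀ i ∈ S, (f i).tok = some (t i))
    (ht : t.Injective) (hd : ∀ i ∈ S, NoTok net (t i)) : (toks (net + S.val.map f)).Nodup := by
  rw [toks_add, toks_map_some S.val f t h, Multiset.nodup_add]
  refine ⟨hn, (Multiset.nodup_map_iff_of_injective ht).2 S.nodup, ?_⟩
  rw [Multiset.disjoint_left]
  intro a ha ha'
  obtain ⟨i, hi, rfl⟩ := Multiset.mem_map.1 ha'
  exact noTok_iff.1 (hd i hi) ha

theorem Ctl.nodup_rest (h : Ctl s g) {m : Msg C} {net : Multiset (Msg C)}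
    (hm : s.net = m ::ₘ net) : (toks net).Nodup := by
  have := h.nodup
  rw [hm] at this
  cases ht : m.tok with
  | none => rwa [← toks, toks_cons_none _ ht] at this
  | some a =>
    rw [← toks, toks_cons_some _ ht] at this
    exact (Multiset.nodup_cons.1 this).2

theorem Ctl.noTok_rest (h : Ctl s g) {m : Msg C} {net : Multiset (Msg C)} {a : Tok C}
    (hm : s.net = m ::ₘ net) (ht : m.tok = some a) : NoTok net a := by
  have := h.nodup
  rw [hm, ← toks, toks_cons_some _ ht] at this
  exact noTok_iff.2 (Multiset.nodup_cons.1 this).1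

theorem nodup_toks_cons {m : Msg C} {net : Multiset (Msg C)} {a : Tok C} (ht : m.tok = some a)
    (hn : (toks net).Nodup) (ha : NoTok net a) : (toks (m ::ₘ net)).Nodup := by
  rw [toks_cons_some _ ht]
  exact Multiset.nodup_cons.2 ⟨noTok_iff.1 ha, hn⟩

/-! ### Steps that change the state of one client or of one server -/

structure OnlyClient (s s' : State C) (c : C.Client) (κ : ClientState C) : Prop where
  self : s'.cl c = κ
  other : ∀ c', c' ≠ c → s'.cl c' = s.cl c'
  srv : s'.srv = s.srv
  used : s'.used = s.used
  versions : s'.versions = s.versions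

theorem onlyClient_setCl (c : C.Client) (κ : ClientState C) (net : Multiset (Msg C)) :
    OnlyClient s ((s.setCl c κ).withNet net) c κ :=
  ⟨by simp, fun _ h => by simp [State.cl_setCl_ne, h], rfl, rfl, rfl⟩

theorem onlyClient_log (c : C.Client) (κ : ClientState C) (net : Multiset (Msg C)) (o : Op C) :
    OnlyClient s (((s.setCl c κ).withNet net).log o) c κ :=
  ⟨by simp, fun _ h => by simp [State.cl_setCl_ne, h], rfl, rfl, rfl⟩

/-- A message with the token of a client pins its phase to `starting`, `reading` or `committing`. -/
theorem Ctl.noTok_of_phase (h : Ctl s g) {c : C.Client}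
    (hc : (s.cl c).phase = .idle ∨ ∃ p id, (s.cl c).phase = .active p id) :
    NoTok s.net (.cl c) := by
  intro m hm ht
  have := h.msg m hm
  cases m <;> simp only [Msg.tok, Option.some.injEq, Tok.cl.injEq, reduceCtorEq] at ht <;>
    simp only [MsgOK] at this <;> grind

/-- Serves all steps of a client. The hypothesis `hno` ensures that no coordinator holds a context
for `c`: a context requires that `c` is reading or committing and that no message with its token is
in transit. Only the final write set of the running transaction may be fixed, so nothing known about
other transactions is disturbed. -/
theorem Ctl.of_client {c : C.Client} {κ : ClientState C} {fin' : TxId → Option (WSet C × ℕ)}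
    (h : Ctl s g) (e : OnlyClient s s' c κ)
    (hf : ∀ id, fin' id = g.fin id ∨
      g.fin id = none ∧ (∃ p, (s.cl c).phase.run = some (p, id)) ∧ ∃ W h, fin' id = some (W, h) ∧
        ∃ k, W k ≠ none)
    (hnodup : (toks s'.net).Nodup)
    (hnet : ∀ m ∈ s'.net, m ∈ s.net ∧ m.tok ≠ some (.cl c) ∨
      m.tok = some (.cl c) ∧ MsgOK s' { g with fin := fin' } m)
    (hhist : ∀ o ∈ s'.hist, o ∈ s.hist ∨ o.client = c ∧ ∃ p st, g.info o.tx = some (c, p, st))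
    (hcur : ∀ p id, κ.phase.cur = some (p, id) → g.info id = some (c, p, κ.ust))
    (hrun : ∀ p id, κ.phase.run = some (p, id) →
      (s.srv p).TX id = some κ.ust ∧ fin' id = none)
    (hcom : ∀ p id, κ.phase = .committing p id → fin' id = some (κ.WS, κ.hwt))
    (hno : ((s.cl c).phase = .idle ∨ ∃ p id, (s.cl c).phase = .active p id) ∨
      ¬ NoTok s.net (.cl c)) : Ctl s' { g with fin := fin' } := by
  have hreads : ∀ p id r, (s.srv p).reads id = some r → r.client ≠ c := by
    rintro p id r hr rfl
    obtain ⟨⟨χ, D, h1⟩, h2⟩ := h.reads p id r hr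
    grind
  have hcommits : ∀ p id r, (s.srv p).commits id = some r → r.client ≠ c := by
    rintro p id r hr rfl
    obtain ⟨h1, h2⟩ := h.commits p id r hr
    grind
  have hmono : ∀ id W h, g.fin id = some (W, h) → fin' id = some (W, h) := by grind
  have hnt : ∀ c', c' ≠ c → NoTok s.net (.cl c') → NoTok s'.net (.cl c') := by
    intro c' hc' hn m hm
    rcases hnet m hm with h1 | h1
    · exact hn m h1.1
    · rw [h1.1]; simpa using fun h => hc' h.symm
  have hfc : ∀ id, fin' id = g.fin id ∨ ∃ p st, g.info id = some (c, p, st) := by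
    intro id
    rcases hf id with h1 | ⟨-, ⟨p, h2⟩, -⟩
    · exact .inl h1
    · exact .inr ⟨p, _, h.cur c p id (Phase.cur_of_run h2)⟩
  constructor
  · rw [e.used]; exact h.used
  · rw [e.used]; exact h.used_finite
  · exact hnodup
  · intro m hm
    rcases hnet m hm with ⟨h1, h2⟩ | ⟨-, h1⟩
    swap; · exact h1
    have ho := e.other
    have := h.msg m h1
    cases m <;> simp only [Msg.tok, ne_eq, Option.some.injEq, Tok.cl.injEq, reduceCtorEq,
      not_false_eq_true] at h2 <;> simp only [MsgOK, e.srv] at this ⊢ <;>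
      try rw [ho _ h2]
    case startResp c' id u =>
      obtain ⟨p, h3, h4, h5, h6, h7, h8⟩ := this
      refine ⟨p, h3, h4, h5, ?_, h7, ?_⟩
      · grind
      · intro o ho
        rcases hhist o ho with h9 | ⟨h9, p', st, h10⟩
        · exact h8 o h9
        -- A new record of this transaction would make `c` its client, but its client is `c'`.
        · rintro rfl
          grind
    case prepareReq => grind
    all_goals exact this
  · intro o ho
    rcases hhist o ho with h1 | ⟨h1, p, st, h2⟩
    · exact h.hist o h1
    · exact ⟨p, st, h1 ▸ h2⟩
  · intro c' p id hc'
    by_cases hcc : c' = c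
    · subst hcc; rw [e.self] at hc' ⊢; exact hcur p id hc'
    · rw [e.other _ hcc] at hc' ⊢; exact h.cur c' p id hc'
  · intro c' p id hc'
    by_cases hcc : c' = c
    · subst hcc; rw [e.self] at hc' ⊢; rw [e.srv]; exact hrun p id hc'
    · rw [e.other _ hcc] at hc' ⊢; rw [e.srv]
      refine ⟨(h.run c' p id hc').1, ?_⟩
      have h1 := h.cur c' p id (Phase.cur_of_run hc')
      have := (h.run c' p id hc').2
      grind
  · intro c' p id hc'
    by_cases hcc : c' = c
    · subst hcc; rw [e.self] at hc' ⊢; exact hcom p id hc'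
    · rw [e.other _ hcc] at hc' ⊢; exact hmono _ _ _ (h.committing c' p id hc')
  · intro p id r hr
    rw [e.srv] at hr
    have hne := hreads p id r hr
    rw [e.other _ hne]
    exact ⟨(h.reads p id r hr).1, hnt _ hne (h.reads p id r hr).2⟩
  · intro p id r hr
    rw [e.srv] at hr
    have hne := hcommits p id r hr
    obtain ⟨h1, h2, ⟨h', h3⟩, h4, h5, h6, h7, h8⟩ := h.commits p id r hr
    exact ⟨by rw [e.other _ hne]; exact h1, hnt _ hne h2, ⟨h', hmono _ _ _ h3⟩, h4, h5, h6, h7, h8⟩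
  · rw [e.srv]; exact h.tx
  · intro id W h' hW
    rcases hf id with h1 | ⟨h1, ⟨p, h2⟩, W', h'', h3, h4⟩
    · exact h.fin id W h' (h1 ▸ hW)
    · refine ⟨?_, ?_⟩
      · simp [h.cur c p id (Phase.cur_of_run h2)]
      · simp only at hW
        rw [h3] at hW
        obtain ⟨rfl, rfl⟩ : W' = W ∧ h'' = h' := by simpa using hW
        exact h4
  · intro id i q pt hp
    obtain ⟨h1, W, h', c', p, st, h2, h3⟩ := h.prop id i q pt hp
    exact ⟨h1, W, h', c', p, st, hmono _ _ _ h2, h3⟩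
  · intro id t ht
    obtain ⟨W, h', h2, h3⟩ := h.ct id t ht
    exact ⟨W, h', hmono _ _ _ h2, h3⟩
  · intro X
    rw [e.versions, h.versions]
    constructor
    · rintro ⟨h1, W, h', h2, h3⟩
      exact ⟨h1, W, h', hmono _ _ _ h2, h3⟩
    · rintro ⟨h1, W, h', h2, h3⟩
      -- The transaction already has a commit timestamp, hence a final write set, which the step
      -- cannot have changed.
      obtain ⟨W', h'', h4, -⟩ := h.ct _ _ h1
      exact ⟨h1, W, h', h4.trans ((hmono _ _ _ h4).symm.trans h2), h3⟩

/-- Steps that leave clients, contexts and the history alone. -/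
theorem Ctl.of_net (h : Ctl s g) (hcl : s'.cl = s.cl) (hused : s'.used = s.used)
    (hver : s'.versions = s.versions) (hhist : s'.hist = s.hist)
    (hreads : ∀ p, (s'.srv p).reads = (s.srv p).reads)
    (hcommits : ∀ p, (s'.srv p).commits = (s.srv p).commits)
    (hTX : ∀ p, (s'.srv p).TX = (s.srv p).TX) (hnodup : (toks s'.net).Nodup)
    (hnet : ∀ m ∈ s'.net, m ∈ s.net ∨ (∀ c, m.tok ≠ some (.cl c)) ∧ MsgOK s g m) : Ctl s' g := by
  have hnt : ∀ c', NoTok s.net (.cl c') → NoTok s'.net (.cl c') := by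
    intro c' hn m hm
    rcases hnet m hm with h1 | h1
    · exact hn m h1
    · exact h1.1 c'
  constructor
  · rw [hused]; exact h.used
  · rw [hused]; exact h.used_finite
  · exact hnodup
  · intro m hm
    have : MsgOK s g m := by
      rcases hnet m hm with h1 | h1
      · exact h.msg m h1
      · exact h1.2
    cases m <;> simp only [MsgOK, hcl, hreads, hcommits, hTX, hhist] at this ⊢ <;> exact this
  · rw [hhist]; exact h.hist
  · rw [hcl]; exact h.cur
  · simp only [hcl, hTX]; exact h.run
  · rw [hcl]; exact h.committing
  · simp only [hcl, hreads]
    exact fun p id r hr => ⟨(h.reads p id r hr).1, hnt _ (h.reads p id r hr).2⟩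
  · simp only [hcommits]
    intro p id r hr
    obtain ⟨h1, h2, h3, h4, h5, h6, h7, h8⟩ := h.commits p id r hr
    exact ⟨by rw [hcl]; exact h1, hnt _ h2, h3, h4, h5, h6, h7, h8⟩
  · simp only [hTX]; exact h.tx
  · exact h.fin
  · exact h.prop
  · exact h.ct
  · rw [hver]; exact h.versions

/-! ### Steps with their effect on the ghost state -/

/-- Steps that fix nothing about a transaction. -/
def Silent (s s' : State C) : Prop :=
  s'.used = s.used ∧
  (∀ c p id, (s'.cl c).phase = .committing p id → (s.cl c).phase = .committing p id) ∧
  (∀ p id, (s.srv p).commits id ≠ none → (s'.srv p).commits id ≠ none) ∧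
  ∀ m ∈ s.net, (∃ id i, m.tok = some (.prep id i)) → m ∈ s'.net

/-- Steps together with what they fix. -/
inductive GStep (s : State C) (g : Ghost C) : State C → Ghost C → Prop
  | silent (s' : State C) (h : Step s s') (hs : Silent s s') : GStep s g s' g
  | startServe (net : Multiset (Msg C)) (c : C.Client) (p : Server C) (ust : ℕ)
      (id : TxId) (hm : s.net = .startReq c p ust ::ₘ net) (hid : id ∉ s.used) :
      GStep s g { (s.setSrv p { s.srv p with
            ust := max (s.srv p).ust ust
            TX := Function.update (s.srv p).TX id (some (max (s.srv p).ust ust)) }) with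
          used := insert id s.used
          net := .startResp c id (max (s.srv p).ust ust) ::ₘ net }
        { g with info := Function.update g.info id (some (c, p, max (s.srv p).ust ust)) }
  | commitSend (c : C.Client) (p : Server C) (id : TxId)
      (hc : (s.cl c).phase = .active p id) (hWS : ∃ k, (s.cl c).WS k ≠ none) :
      GStep s g ((s.setCl c { s.cl c with phase := .committing p id }).withNet
          (.commitReq c p id (s.cl c).hwt (s.cl c).WS ::ₘ s.net))
        { g with fin := Function.update g.fin id (some ((s.cl c).WS, (s.cl c).hwt)) }
  | prepare (net : Multiset (Msg C)) (p q : Server C) (id : TxId) (ust ht : ℕ)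
      (D : WSet C) (t hlc ust' pt : ℕ) (hm : s.net = .prepareReq p q id ust ht D ::ₘ net)
      (hclk : (s.srv q).clk < t) (hhlc : hlc = max t (max (ht + 1) ((s.srv q).hlc + 1)))
      (hust : ust' = max (s.srv q).ust ust)
      (hpt : pt = max hlc ust') :
      GStep s g ((s.setSrv q { s.srv q with
            clk := t
            hlc := hlc
            ust := ust'
            prepared := insert ⟨id, pt, D⟩ (s.srv q).prepared }).withNet
          (.prepareResp q p id pt ::ₘ net))
        { g with
          prop := Function.update g.prop id (Function.update (g.prop id) q.part (some (q, pt))) }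
  | commit (p : Server C) (id : TxId) (r : CommitCtx C) (pt : Fin C.N → ℕ) (ct : ℕ)
      (hr : (s.srv p).commits id = some r) (hpt : ∀ i ∈ r.parts, r.resp i = some (pt i))
      (hct : ct = r.parts.sup pt) :
      GStep s g { (s.setSrv p { s.srv p with
            TX := Function.update (s.srv p).TX id none
            commits := Function.update (s.srv p).commits id none }) with
          net := .commitResp r.client ct ::ₘ
            (s.net + r.parts.val.map (fun i => .cohortCommit p (r.tgt i) id ct))
          versions := s.versions ∪ {X | X.tx = id ∧ X.ut = ct ∧ r.WS X.key = some X.val} }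
        { g with ct := Function.update g.ct id (some ct) }

/-- Four kinds of steps fix something, and each breaks one clause of `Silent`: a fresh identifier is
used, a client enters `committing`, a prepare request is consumed, a commit context is closed. So no
step has to be counted both as silent and as one of the four. -/
theorem Step.exists_gstep (h : Step s s') (g : Ghost C) : ∃ g', GStep s g s' g' := by
  cases h
  case startServe net c p ust id hm hid => exact ⟨_, .startServe net c p ust id hm hid⟩
  case commitSend c p id hc hWS => exact ⟨_, .commitSend c p id hc hWS⟩
  case prepare net p q id ust ht D t hlc ust' pt hm h1 h2 h3 h4 =>
    exact ⟨_, .prepare net p q id ust ht D t hlc ust' pt hm h1 h2 h3 h4⟩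
  case decide p id r pt ct h1 h2 h3 => exact ⟨_, .commit p id r pt ct h1 h2 h3⟩
  all_goals
    refine ⟨g, .silent _ (by constructor <;> assumption) ⟨rfl, ?_, ?_, ?_⟩⟩
    · intro c' p' id'
      simp only [State.cl_withNet, State.cl_log, State.cl_setSrv, State.cl_sendRepl,
        State.cl_setRepl, State.cl_setCl]
      first
        | exact fun h => h
        | split_ifs with hc'
          · first | subst hc'; exact fun h => h | simp
          · exact fun h => h
    · intro p' id'
      simp only [State.srv_withNet, State.srv_log, State.srv_setCl, State.srv_sendRepl,
        State.srv_setRepl, State.srv_setSrv]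
      first
        | exact fun h => h
        | split_ifs with hp'
          · subst hp'
            first | exact fun h => h | (simp only [Function.update_apply]; split_ifs <;> simp)
          · exact fun h => h
    · rintro m hm ⟨id', i, ht⟩
      first
        | exact hm
        | exact Multiset.mem_cons_of_mem hm
        | exact Multiset.mem_add.2 (.inl hm)
        | rename s.net = _ => hnet
          rw [hnet] at hm
          rcases Multiset.mem_cons.1 hm with rfl | hm
          · simp [Msg.tok] at ht
          · first
              | exact hm
              | exact Multiset.mem_cons_of_mem hm
              | exact Multiset.mem_add.2 (.inl hm)

/-! ### Control invariant: steps of coordinators and cohorts -/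

/-- For the messages that a step leaves in transit. The hypotheses on contexts are restricted by the
token of `m`, so that uniqueness of tokens can be used to show that the step does not concern what
`m` refers to. -/
theorem MsgOK.mono {m : Msg C} (h : MsgOK s g m) (hcl : s'.cl = s.cl) (hhist : s'.hist = s.hist)
    (hinfo : ∀ id x, g.info id = some x → g'.info id = some x) (hfin : g'.fin = g.fin)
    (hprop : ∀ id i x, g.prop id i = some x → g'.prop id i = some x)
    (hct : ∀ id t, g.ct id = some t → g'.ct id = some t)
    (hTX : ∀ c id u p, m = .startResp c id u → (s.srv p).TX id = some u → g.fin id = none →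
      (s'.srv p).TX id = some u)
    (hreads : ∀ p id i r, m.tok = some (.slice id i) → (s.srv p).reads id = some r → i ∈ r.wait →
      ∃ r', (s'.srv p).reads id = some r' ∧ i ∈ r'.wait)
    (hcommits : ∀ p id i r, m.tok = some (.prep id i) → (s.srv p).commits id = some r →
      i ∈ r.parts → g.prop id i = none → ∃ r', (s'.srv p).commits id = some r' ∧
        r'.parts = r.parts ∧ r'.tgt = r.tgt ∧ r'.WS = r.WS ∧ g'.prop id i = none)
    (hreq : ∀ c p id hwt W, m = .commitReq c p id hwt W → g.ct id = none →
      (∀ i, g.prop id i = none) → g'.ct id = none ∧ ∀ i, g'.prop id i = none) : MsgOK s' g' m := by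
  cases m
  case startResp c id u =>
    obtain ⟨p, h1, h2, h3, h4, h5, h6⟩ := h
    simp only [MsgOK, hcl, hfin, hhist]
    exact ⟨p, h1, hinfo _ _ h2, hTX c id u p rfl h3 h4, h4, h5, h6⟩
  case sliceReq p q id χ st =>
    obtain ⟨⟨r, h1, h2⟩, c, h3⟩ := h
    exact ⟨hreads p id q.part r rfl h1 h2, c, hinfo _ _ h3⟩
  case sliceResp q p id D =>
    obtain ⟨r, h1, h2⟩ := h
    exact hreads p id q.part r rfl h1 h2
  case commitReq c p id hwt W =>
    obtain ⟨h1, h2, h3, h4, h5⟩ := h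
    simp only [MsgOK, hcl]
    exact ⟨h1, h2, h3, hreq c p id hwt W rfl h4 h5⟩
  case commitResp c t =>
    obtain ⟨p, id, h1, h2⟩ := h
    exact ⟨p, id, by rw [hcl]; exact h1, hct _ _ h2⟩
  case prepareReq p q id ust ht D =>
    obtain ⟨r, c, h', h1, h2, h3, h4, h5, h6, h7, h8⟩ := h
    obtain ⟨r', h9, h10, h11, h12, h13⟩ := hcommits p id q.part r rfl h1 h2 h4
    exact ⟨r', c, h', h9, h10 ▸ h2, h11 ▸ h3, h13, hinfo _ _ h5, by rw [hfin, h12]; exact h6,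
      by rw [h12]; exact h7, h8⟩
  case prepareResp q p id pt => exact hprop _ _ _ h
  case cohortCommit p q id t => exact ⟨hct _ _ h.1, h.2.imp fun _ h => hprop _ _ _ h⟩
  all_goals simp only [MsgOK, hcl] at h ⊢ <;> exact h

/-- Serves the steps of a coordinator or cohort that change read contexts, commit contexts or
proposals and nothing else that the control invariant mentions. -/
theorem Ctl.of_contexts {prop' : TxId → Fin C.N → Option (Server C × ℕ)} (h : Ctl s g)
    (hcl : s'.cl = s.cl) (hused : s'.used = s.used)
    (hver : s'.versions = s.versions) (hhist : s'.hist = s.hist)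
    (hTX : ∀ p, (s'.srv p).TX = (s.srv p).TX) (hnodup : (toks s'.net).Nodup)
    (hmsg : ∀ m ∈ s'.net, MsgOK s' { g with prop := prop' } m)
    (hreads : ∀ p id r, (s'.srv p).reads id = some r →
      (∃ χ D, (s.cl r.client).phase = .reading p id χ D) ∧ NoTok s'.net (.cl r.client))
    (hcommits : ∀ p id r, (s'.srv p).commits id = some r → CommitOK s' { g with prop := prop' } p id r)
    (hmono : ∀ id i x, g.prop id i = some x → prop' id i = some x)
    (hprop : ∀ id i q pt, prop' id i = some (q, pt) → g.prop id i = some (q, pt) ∨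
      q.part = i ∧ ∃ W h c p st, g.fin id = some (W, h) ∧ g.info id = some (c, p, st) ∧
        i ∈ W.parts ∧ h < pt ∧ st < pt) : Ctl s' { g with prop := prop' } := by
  constructor
  · rw [hused]; exact h.used
  · rw [hused]; exact h.used_finite
  · exact hnodup
  · exact hmsg
  · rw [hhist]; exact h.hist
  · rw [hcl]; exact h.cur
  · simp only [hcl, hTX]; exact h.run
  · rw [hcl]; exact h.committing
  · rw [hcl]; exact hreads
  · exact hcommits
  · simp only [hTX]; exact h.tx
  · exact h.fin
  · intro id i q pt hp
    rcases hprop id i q pt hp with h1 | h1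
    · exact h.prop id i q pt h1
    · exact h1
  · intro id t ht
    obtain ⟨W, h', h1, h2⟩ := h.ct id t ht
    exact ⟨W, h', h1, fun i hi => (h2 i hi).imp fun q => .imp fun pt h => ⟨hmono _ _ _ h.1, h.2⟩⟩
  · rw [hver]; exact h.versions

theorem CommitOK.of_eq {p : Server C} {id : TxId} {r : CommitCtx C} (h : CommitOK s g p id r)
    (hcl : s'.cl = s.cl) (hn : NoTok s.net (.cl r.client) → NoTok s'.net (.cl r.client)) :
    CommitOK s' g p id r :=
  ⟨by rw [hcl]; exact h.phase, hn h.noTok, h.fin, h.ct, h.parts, h.tgt_part, h.tgt, h.resp⟩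

/-- While a client message is in transit, the transaction of the client has no open read. -/
theorem Ctl.reads_eq_none (h : Ctl s g) {c : C.Client} {p p' : Server C} {id : TxId}
    (hc : (s.cl c).phase.cur = some (p, id)) (hn : ¬ NoTok s.net (.cl c)) :
    (s.srv p').reads id = none := by
  cases hr : (s.srv p').reads id with
  | none => rfl
  | some r =>
    obtain ⟨⟨χ, D, h1⟩, h2⟩ := h.reads p' id r hr
    have h3 := h.cur r.client p' id (by rw [h1]; rfl)
    rw [h.cur c p id hc] at h3
    obtain rfl : c = r.client := by simpa using congrArg (Option.map Prod.fst) h3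
    exact absurd h2 hn

theorem Ctl.commits_eq_none (h : Ctl s g) {c : C.Client} {p p' : Server C} {id : TxId}
    (hc : (s.cl c).phase.cur = some (p, id)) (hn : ¬ NoTok s.net (.cl c)) :
    (s.srv p').commits id = none := by
  cases hr : (s.srv p').commits id with
  | none => rfl
  | some r =>
    have h1 := h.commits p' id r hr
    have h3 := h.cur r.client p' id (by rw [h1.phase]; rfl)
    rw [h.cur c p id hc] at h3
    obtain rfl : c = r.client := by simpa using congrArg (Option.map Prod.fst) h3
    exact absurd h1.noTok hn

theorem Ctl.noTok_slice (h : Ctl s g) {id : TxId} (hr : ∀ p, (s.srv p).reads id = none)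
    (i : Fin C.N) : NoTok s.net (.slice id i) := by
  intro m hm ht
  have := h.msg m hm
  cases m <;> simp only [Msg.tok, Option.some.injEq, Tok.slice.injEq, reduceCtorEq] at ht <;>
    simp only [MsgOK] at this <;> grind

theorem Ctl.noTok_prep (h : Ctl s g) {id : TxId} (hr : ∀ p, (s.srv p).commits id = none)
    (i : Fin C.N) : NoTok s.net (.prep id i) := by
  intro m hm ht
  have := h.msg m hm
  cases m <;> simp only [Msg.tok, Option.some.injEq, Tok.prep.injEq, reduceCtorEq] at ht
  simp only [MsgOK] at this
  grind

/-- The ghost state stores one client and one coordinator for each identifier. -/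
theorem Ctl.coord_eq (h : Ctl s g) {c c' : C.Client} {p p' : Server C} {id : TxId}
    (hc : (s.cl c).phase.cur = some (p, id)) (hc' : (s.cl c').phase.cur = some (p', id)) :
    c = c' ∧ p = p' := by
  have h3 := h.cur c p id hc
  rw [h.cur c' p' id hc'] at h3
  simp only [Option.some.injEq, Prod.mk.injEq] at h3
  exact ⟨h3.1.symm, h3.2.1.symm⟩

theorem not_noTok {m : Msg C} {net net' : Multiset (Msg C)} {a : Tok C} (hm : net' = m ::ₘ net)
    (ht : m.tok = some a) : ¬ NoTok net' a :=
  fun h => h m (by simp [hm]) ht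

theorem NoTok.cons {m : Msg C} {net : Multiset (Msg C)} {a : Tok C} (h : NoTok net a)
    (hm : m.tok ≠ some a) : NoTok (m ::ₘ net) a := by
  intro m' hm'
  rcases Multiset.mem_cons.1 hm' with rfl | hm'
  · exact hm
  · exact h m' hm'

theorem NoTok.rest {m : Msg C} {net net' : Multiset (Msg C)} {a : Tok C} (h : NoTok net' a)
    (hm : net' = m ::ₘ net) : NoTok net a :=
  fun m' hm' => h m' (by simp [hm, hm'])

theorem NoTok.add_map {ι : Type*} {net : Multiset (Msg C)} {a : Tok C} (h : NoTok net a)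
    {S : Multiset ι} {f : ι → Msg C} (hf : ∀ i ∈ S, (f i).tok ≠ some a) :
    NoTok (net + S.map f) a := by
  intro m' hm'
  rcases Multiset.mem_add.1 hm' with hm' | hm'
  · exact h m' hm'
  · obtain ⟨i, hi, rfl⟩ := Multiset.mem_map.1 hm'
    exact hf i hi

theorem Ctl.readServe {net : Multiset (Msg C)} {c : C.Client} {p : Server C} {id : TxId}
    {χ : Finset C.Key} {st : ℕ} {parts : Finset (Fin C.N)} {slice : Fin C.N → Finset C.Key}
    {tgt : Fin C.N → Server C} (h : Ctl s g) (hm : s.net = .readReq c p id χ ::ₘ net)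
    (hst : (s.srv p).TX id = some st) (htgt : ∀ i ∈ parts, (tgt i).part = i)
    (hcl : s'.cl = s.cl) (hused : s'.used = s.used) (hver : s'.versions = s.versions)
    (hhist : s'.hist = s.hist) (hTX : ∀ p, (s'.srv p).TX = (s.srv p).TX)
    (hcommits : ∀ p, (s'.srv p).commits = (s.srv p).commits)
    (hreads : ∀ p' id', (s'.srv p').reads id' =
      if p' = p ∧ id' = id then some ⟨c, parts, fun _ => none⟩ else (s.srv p').reads id')
    (hnet : s'.net = net + parts.val.map (fun i => .sliceReq p (tgt i) id (slice i) st)) :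
    Ctl s' g := by
  obtain ⟨χ', D, h1, -⟩ : MsgOK s g _ := h.msg _ (hm ▸ Multiset.mem_cons_self _ _)
  have hcur : (s.cl c).phase.cur = some (p, id) := by rw [h1]; rfl
  have hn : ¬ NoTok s.net (.cl c) := not_noTok hm rfl
  -- The request is still in transit, so no read of this transaction is open and no slice message
  -- for it exists; the new slice tokens are therefore fresh.
  have hnone := fun p' => h.reads_eq_none (p' := p') hcur hn
  have hsl := h.noTok_slice hnone
  have hnt : ∀ c', NoTok s.net (.cl c') ∨ c' = c → NoTok s'.net (.cl c') := by
    rintro c' h2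
    rw [hnet]
    refine NoTok.add_map ?_ (by simp [Msg.tok])
    rcases h2 with h2 | rfl
    · exact h2.rest hm
    · exact h.noTok_rest hm rfl
  refine Ctl.of_contexts (prop' := g.prop) h hcl hused hver hhist hTX ?_ ?_ ?_ ?_ (fun _ _ _ h => h)
    (fun _ _ _ _ h => .inl h)
  · rw [hnet]
    refine nodup_toks_add_map (h.nodup_rest hm) (t := fun i => .slice id i) ?_ ?_ ?_
    · intro i hi
      simp only [Msg.tok, htgt i hi]
    · intro i j hij; simpa using hij
    · intro i _
      exact (hsl i).rest hm
  · intro m hm'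
    rw [hnet] at hm'
    rcases Multiset.mem_add.1 hm' with hm' | hm'
    · have hms : m ∈ s.net := by rw [hm]; exact Multiset.mem_cons_of_mem hm'
      refine (h.msg m hms).mono hcl hhist (fun _ _ h => h) rfl (fun _ _ _ h => h) (fun _ _ h => h) ?_
        ?_ ?_ (fun _ _ _ _ _ _ h1 h2 => ⟨h1, h2⟩)
      · intro c' id' u p' _ h1 _
        rwa [hTX]
      · intro p' id' i r ht h2 h3
        have : id' ≠ id := by rintro rfl; simp [hnone] at h2
        exact ⟨r, by simpa [hreads, this] using h2, h3⟩
      · intro p' id' i r ht h2 h3 h4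
        exact ⟨r, by rwa [hcommits], rfl, rfl, rfl, h4⟩
    · obtain ⟨i, hi, rfl⟩ := Multiset.mem_map.1 hm'
      refine ⟨⟨⟨c, parts, fun _ => none⟩, by simp [hreads], ?_⟩, h.tx p id st hst⟩
      show (tgt i).part ∈ parts
      rw [htgt i hi]; exact hi
  · intro p' id' r hr'
    rw [hreads] at hr'
    split_ifs at hr' with hp
    · obtain ⟨rfl, rfl⟩ := hp
      cases hr'
      exact ⟨⟨χ', D, h1⟩, hnt _ (.inr rfl)⟩
    · exact ⟨(h.reads p' id' r hr').1, hnt _ (.inl (h.reads p' id' r hr').2)⟩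
  · intro p' id' r hr'
    rw [hcommits] at hr'
    exact (h.commits p' id' r hr').of_eq hcl fun hn => hnt _ (.inl hn)

theorem Ctl.sliceRecv {net : Multiset (Msg C)} {q p : Server C} {id : TxId}
    {D : C.Key → Option (Item C)} {r : ReadCtx C} {got : C.Key → Option (Item C)} (h : Ctl s g)
    (hm : s.net = .sliceResp q p id D ::ₘ net) (hr : (s.srv p).reads id = some r)
    (hcl : s'.cl = s.cl) (hused : s'.used = s.used) (hver : s'.versions = s.versions)
    (hhist : s'.hist = s.hist) (hTX : ∀ p, (s'.srv p).TX = (s.srv p).TX)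
    (hcommits : ∀ p, (s'.srv p).commits = (s.srv p).commits)
    (hreads : ∀ p' id', (s'.srv p').reads id' =
      if p' = p ∧ id' = id then some { r with wait := r.wait.erase q.part, got := got }
      else (s.srv p').reads id')
    (hnet : s'.net = net) : Ctl s' g := by
  have hsub : ∀ c, NoTok s.net (.cl c) → NoTok s'.net (.cl c) :=
    fun c h' => hnet ▸ h'.rest hm
  refine Ctl.of_contexts (prop' := g.prop) h hcl hused hver hhist hTX ?_ ?_ ?_ ?_ (fun _ _ _ h => h)
    (fun _ _ _ _ h => .inl h)
  · rw [hnet]; exact h.nodup_rest hm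
  · intro m hm'
    rw [hnet] at hm'
    have hms : m ∈ s.net := by rw [hm]; exact Multiset.mem_cons_of_mem hm'
    refine (h.msg m hms).mono hcl hhist (fun _ _ h => h) rfl (fun _ _ _ h => h) (fun _ _ h => h) ?_
      ?_ ?_ (fun _ _ _ _ _ _ h1 h2 => ⟨h1, h2⟩)
    · intro c' id' u p' _ h1 _
      rwa [hTX]
    · intro p' id' i r' ht h2 h3
      rw [hreads]
      split_ifs with hp
      · obtain ⟨rfl, rfl⟩ := hp
        refine ⟨_, rfl, ?_⟩
        obtain rfl : r = r' := by simpa [hr] using h2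
        refine Finset.mem_erase.2 ⟨?_, h3⟩
        rintro rfl
        exact h.noTok_rest hm rfl m hm' ht
      · exact ⟨r', h2, h3⟩
    · intro p' id' i r ht h2 h3 h4
      exact ⟨r, by rwa [hcommits], rfl, rfl, rfl, h4⟩
  · intro p' id' r' hr'
    rw [hreads] at hr'
    split_ifs at hr' with hp
    · obtain ⟨rfl, rfl⟩ := hp
      cases hr'
      exact ⟨(h.reads _ _ _ hr).1, hsub _ (h.reads _ _ _ hr).2⟩
    · exact ⟨(h.reads p' id' r' hr').1, hsub _ (h.reads p' id' r' hr').2⟩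
  · intro p' id' r hr'
    rw [hcommits] at hr'
    exact (h.commits p' id' r hr').of_eq hcl fun hn => hsub _ hn

theorem Ctl.readDone {p : Server C} {id : TxId} {r : ReadCtx C} (h : Ctl s g)
    (hr : (s.srv p).reads id = some r) (hw : r.wait = ∅)
    (hcl : s'.cl = s.cl) (hused : s'.used = s.used) (hver : s'.versions = s.versions)
    (hhist : s'.hist = s.hist) (hTX : ∀ p, (s'.srv p).TX = (s.srv p).TX)
    (hcommits : ∀ p, (s'.srv p).commits = (s.srv p).commits)
    (hreads : ∀ p' id', (s'.srv p').reads id' =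
      if p' = p ∧ id' = id then none else (s.srv p').reads id')
    (hnet : s'.net = .readResp r.client r.got ::ₘ s.net) : Ctl s' g := by
  obtain ⟨⟨χ, D, h1⟩, h2⟩ := h.reads p id r hr
  have hcur : (s.cl r.client).phase.cur = some (p, id) := by rw [h1]; rfl
  refine Ctl.of_contexts (prop' := g.prop) h hcl hused hver hhist hTX ?_ ?_ ?_ ?_ (fun _ _ _ h => h)
    (fun _ _ _ _ h => .inl h)
  · rw [hnet]; exact nodup_toks_cons rfl h.nodup h2
  · intro m hm'
    rw [hnet] at hm'
    rcases Multiset.mem_cons.1 hm' with rfl | hm'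
    · exact ⟨p, id, χ, D, by rw [hcl]; exact h1⟩
    refine (h.msg m hm').mono hcl hhist (fun _ _ h => h) rfl (fun _ _ _ h => h) (fun _ _ h => h) ?_
      ?_ ?_ (fun _ _ _ _ _ _ h1 h2 => ⟨h1, h2⟩)
    · intro c' id' u p' _ h1 _
      rwa [hTX]
    · intro p' id' i r' ht h3 h4
      rw [hreads]
      split_ifs with hp
      · obtain ⟨rfl, rfl⟩ := hp
        obtain rfl : r = r' := by simpa [hr] using h3
        simp [hw] at h4
      · exact ⟨r', h3, h4⟩
    · intro p' id' i r ht h2 h3 h4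
      exact ⟨r, by rwa [hcommits], rfl, rfl, rfl, h4⟩
  · intro p' id' r' hr'
    rw [hreads] at hr'
    split_ifs at hr' with hp
    obtain ⟨⟨χ', D', h3⟩, h4⟩ := h.reads p' id' r' hr'
    refine ⟨⟨χ', D', h3⟩, hnet ▸ h4.cons ?_⟩
    simp only [Msg.tok, ne_eq, Option.some.injEq, Tok.cl.injEq]
    intro hc
    rw [← hc, h1] at h3
    cases h3
    exact hp ⟨rfl, rfl⟩
  · intro p' id' r' hr'
    rw [hcommits] at hr'
    refine (h.commits p' id' r' hr').of_eq hcl fun hn => hnet ▸ hn.cons ?_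
    simp only [Msg.tok, ne_eq, Option.some.injEq, Tok.cl.injEq]
    intro hc
    have := (h.commits p' id' r' hr').phase
    rw [← hc, h1] at this
    cases this

theorem Ctl.commitServe {net : Multiset (Msg C)} {c : C.Client} {p : Server C} {id : TxId}
    {hwt st : ℕ} {WS : WSet C} {tgt : Fin C.N → Server C} (h : Ctl s g)
    (hm : s.net = .commitReq c p id hwt WS ::ₘ net) (hst : (s.srv p).TX id = some st)
    (htgt : ∀ i ∈ WS.parts, (tgt i).part = i)
    (hcl : s'.cl = s.cl) (hused : s'.used = s.used) (hver : s'.versions = s.versions)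
    (hhist : s'.hist = s.hist) (hTX : ∀ p, (s'.srv p).TX = (s.srv p).TX)
    (hreads : ∀ p, (s'.srv p).reads = (s.srv p).reads)
    (hcommits : ∀ p' id', (s'.srv p').commits id' =
      if p' = p ∧ id' = id then some ⟨c, WS, WS.parts, tgt, fun _ => none⟩
      else (s.srv p').commits id')
    (hnet : s'.net = net + WS.parts.val.map
      (fun i => .prepareReq p (tgt i) id st (max st hwt) (WS.slice i))) :
    Ctl s' g := by
  obtain ⟨h1, rfl, rfl, h2, h3⟩ : MsgOK s g _ := h.msg _ (hm ▸ Multiset.mem_cons_self _ _)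
  have hcur : (s.cl c).phase.cur = some (p, id) := by rw [h1]; rfl
  have hn : ¬ NoTok s.net (.cl c) := not_noTok hm rfl
  have hnone := fun p' => h.commits_eq_none (p' := p') hcur hn
  have hsl := h.noTok_prep hnone
  have hfin := h.committing c p id h1
  have hnt : ∀ c', NoTok s.net (.cl c') ∨ c' = c → NoTok s'.net (.cl c') := by
    rintro c' h2
    rw [hnet]
    refine NoTok.add_map ?_ (by simp [Msg.tok])
    rcases h2 with h2 | rfl
    · exact h2.rest hm
    · exact h.noTok_rest hm rfl
  refine Ctl.of_contexts (prop' := g.prop) h hcl hused hver hhist hTX ?_ ?_ ?_ ?_ (fun _ _ _ h => h)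
    (fun _ _ _ _ h => .inl h)
  · rw [hnet]
    refine nodup_toks_add_map (h.nodup_rest hm) (t := fun i => .prep id i) ?_ ?_ ?_
    · intro i hi
      simp only [Msg.tok, htgt i hi]
    · intro i j hij; simpa using hij
    · intro i _
      exact (hsl i).rest hm
  · intro m hm'
    rw [hnet] at hm'
    rcases Multiset.mem_add.1 hm' with hm' | hm'
    · have hms : m ∈ s.net := by rw [hm]; exact Multiset.mem_cons_of_mem hm'
      refine (h.msg m hms).mono hcl hhist (fun _ _ h => h) rfl (fun _ _ _ h => h) (fun _ _ h => h) ?_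
        ?_ ?_ (fun _ _ _ _ _ _ h1 h2 => ⟨h1, h2⟩)
      · intro c' id' u p' _ h1 _
        rwa [hTX]
      · intro p' id' i r ht h2 h3
        exact ⟨r, by rwa [hreads], h3⟩
      · intro p' id' i r ht h5 h6 h7
        have : id' ≠ id := by rintro rfl; simp [hnone] at h5
        exact ⟨r, by simpa [hcommits, this] using h5, rfl, rfl, rfl, h7⟩
    · obtain ⟨i, hi, rfl⟩ := Multiset.mem_map.1 hm'
      have hi' : i ∈ ((s.cl c).WS).parts := by simpa using hi
      obtain ⟨c', h4⟩ := h.tx p id st hst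
      refine ⟨_, c', _, by rw [hcommits, if_pos ⟨rfl, rfl⟩], ?_, ?_, h3 _, h4, hfin, ?_, rfl⟩
      · show (tgt i).part ∈ _
        rw [htgt i hi']; exact hi'
      · show tgt (tgt i).part = _
        rw [htgt i hi']
      · show WSet.slice _ i = WSet.slice _ (tgt i).part
        rw [htgt i hi']
  · intro p' id' r hr'
    rw [hreads] at hr'
    exact ⟨(h.reads p' id' r hr').1, hnt _ (.inl (h.reads p' id' r hr').2)⟩
  · intro p' id' r hr'
    rw [hcommits] at hr'
    split_ifs at hr' with hp
    · obtain ⟨rfl, rfl⟩ := hp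
      cases hr'
      exact ⟨by rw [hcl]; exact h1, hnt _ (.inr rfl), ⟨_, hfin⟩, h2, rfl, htgt,
        fun i q pt hp => by simp [h3] at hp, nofun⟩
    · exact (h.commits p' id' r hr').of_eq hcl fun hn => hnt _ (.inl hn)

theorem Ctl.prepareRecv {net : Multiset (Msg C)} {q p : Server C} {id : TxId} {pt : ℕ}
    {r : CommitCtx C} (h : Ctl s g)
    (hm : s.net = .prepareResp q p id pt ::ₘ net) (hr : (s.srv p).commits id = some r)
    (hcl : s'.cl = s.cl) (hused : s'.used = s.used) (hver : s'.versions = s.versions)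
    (hhist : s'.hist = s.hist) (hTX : ∀ p, (s'.srv p).TX = (s.srv p).TX)
    (hreads : ∀ p, (s'.srv p).reads = (s.srv p).reads)
    (hcommits : ∀ p' id', (s'.srv p').commits id' =
      if p' = p ∧ id' = id then
        some { r with resp := Function.update r.resp q.part (some pt) }
      else (s.srv p').commits id')
    (hnet : s'.net = net) : Ctl s' g := by
  have hsub : ∀ c, NoTok s.net (.cl c) → NoTok s'.net (.cl c) :=
    fun c h' => hnet ▸ h'.rest hm
  have hpt : MsgOK s g _ := h.msg _ (hm ▸ Multiset.mem_cons_self _ _)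
  refine Ctl.of_contexts (prop' := g.prop) h hcl hused hver hhist hTX ?_ ?_ ?_ ?_ (fun _ _ _ h => h)
    (fun _ _ _ _ h => .inl h)
  · rw [hnet]; exact h.nodup_rest hm
  · intro m hm'
    rw [hnet] at hm'
    have hms : m ∈ s.net := by rw [hm]; exact Multiset.mem_cons_of_mem hm'
    refine (h.msg m hms).mono hcl hhist (fun _ _ h => h) rfl (fun _ _ _ h => h) (fun _ _ h => h) ?_
      ?_ ?_ (fun _ _ _ _ _ _ h1 h2 => ⟨h1, h2⟩)
    · intro c' id' u p' _ h1 _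
      rwa [hTX]
    · intro p' id' i r' ht h2 h3
      exact ⟨r', by rwa [hreads], h3⟩
    · intro p' id' i r' ht h2 h3 h4
      rw [hcommits]
      split_ifs with hp
      · obtain ⟨rfl, rfl⟩ := hp
        obtain rfl : r = r' := by simpa [hr] using h2
        exact ⟨_, rfl, rfl, rfl, rfl, h4⟩
      · exact ⟨r', h2, rfl, rfl, rfl, h4⟩
  · intro p' id' r' hr'
    rw [hreads] at hr'
    exact ⟨(h.reads p' id' r' hr').1, hsub _ (h.reads p' id' r' hr').2⟩
  · intro p' id' r' hr'
    rw [hcommits] at hr'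
    split_ifs at hr' with hp
    · obtain ⟨rfl, rfl⟩ := hp
      cases hr'
      obtain ⟨h1, h2, h3, h4, h5, h6, h7, h8⟩ := h.commits _ _ _ hr
      refine ⟨by rw [hcl]; exact h1, hsub _ h2, h3, h4, h5, h6, h7, ?_⟩
      intro i pt'
      simp only [Function.update_apply]
      split_ifs with hi
      · rintro ⟨⟩
        exact ⟨q, hi ▸ hpt⟩
      · exact h8 i pt'
    · exact (h.commits p' id' r' hr').of_eq hcl fun hn => hsub _ hn

/-- While the prepare request is in transit its partition has no proposal, so recording one
overwrites nothing. The bound `ht < pt` places the proposal above both the snapshot timestamp and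
the `hwt` of the client. -/
theorem Ctl.prepare {net : Multiset (Msg C)} {q p : Server C} {id : TxId} {ust ht pt : ℕ}
    {D : WSet C} (h : Ctl s g) (hm : s.net = .prepareReq p q id ust ht D ::ₘ net)
    (hpt : ht < pt)
    (hcl : s'.cl = s.cl) (hused : s'.used = s.used) (hver : s'.versions = s.versions)
    (hhist : s'.hist = s.hist) (hTX : ∀ p, (s'.srv p).TX = (s.srv p).TX)
    (hreads : ∀ p, (s'.srv p).reads = (s.srv p).reads)
    (hcommits : ∀ p, (s'.srv p).commits = (s.srv p).commits)
    (hnet : s'.net = .prepareResp q p id pt ::ₘ net) :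
    Ctl s' { g with
      prop := Function.update g.prop id (Function.update (g.prop id) q.part (some (q, pt))) } := by
  obtain ⟨r, c, h', h1, h2, h3, h4, h5, h6, rfl, rfl⟩ : MsgOK s g _ :=
    h.msg _ (hm ▸ Multiset.mem_cons_self _ _)
  have hrk := h.commits _ _ _ h1
  have hcur : (s.cl r.client).phase.cur = some (p, id) := by rw [hrk.phase]; rfl
  have hmono : ∀ id' i x, g.prop id' i = some x → Function.update g.prop id
      (Function.update (g.prop id) q.part (some (q, pt))) id' i = some x := by
    intro id' i x hx
    by_cases hid : id' = id
    · subst hid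
      by_cases hi : i = q.part
      · subst hi; simp [h4] at hx
      · simpa [hi] using hx
    · simpa [hid] using hx
  have hnt : ∀ c', NoTok s.net (.cl c') → NoTok s'.net (.cl c') := by
    intro c' h2
    rw [hnet]
    exact (h2.rest hm).cons (by simp [Msg.tok])
  refine Ctl.of_contexts h hcl hused hver hhist hTX ?_ ?_ ?_ ?_ hmono ?_
  · rw [hnet, toks_cons_none _ rfl]; exact h.nodup_rest hm
  · intro m hm'
    rw [hnet] at hm'
    rcases Multiset.mem_cons.1 hm' with rfl | hmn
    · simp [MsgOK]
    have hms : m ∈ s.net := by rw [hm]; exact Multiset.mem_cons_of_mem hmn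
    refine (h.msg m hms).mono hcl hhist (fun _ _ h => h) rfl hmono (fun _ _ h => h) ?_ ?_ ?_ ?_
    · intro c' id' u p' _ h1 _
      rwa [hTX]
    · intro p' id' i r' ht h2 h3
      exact ⟨r', by rwa [hreads], h3⟩
    · intro p' id' i r' ht h7 h8 h9
      refine ⟨r', by rwa [hcommits], rfl, rfl, rfl, ?_⟩
      by_cases hid : id' = id
      · subst hid
        by_cases hi : i = q.part
        · subst hi
          exact absurd ht (h.noTok_rest hm rfl m hmn)
        · simpa [hi] using h9
      · simpa [hid] using h9
    · rintro c' p' id' hwt W rfl h7 h8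
      refine ⟨h7, ?_⟩
      by_cases hid : id' = id
      · subst hid
        obtain ⟨h9, -⟩ : MsgOK s g _ := h.msg _ hms
        have := h.commits_eq_none (p' := p) (by rw [h9]; rfl) fun hn => hn _ hms rfl
        simp [h1] at this
      · simpa [hid] using h8
  · intro p' id' r' hr'
    rw [hreads] at hr'
    exact ⟨(h.reads p' id' r' hr').1, hnt _ (h.reads p' id' r' hr').2⟩
  · intro p' id' r' hr'
    rw [hcommits] at hr'
    obtain ⟨k1, k2, k3, k4, k5, k6, k7, k8⟩ := h.commits p' id' r' hr'
    refine ⟨by rw [hcl]; exact k1, hnt _ k2, k3, k4, k5, k6, ?_, ?_⟩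
    · intro i q' pt' hp
      by_cases hid : id' = id
      · subst hid
        -- A transaction has a single coordinator, so the context at `p'` is the one that sent the
        -- request.
        have hp' : p' = p := by
          have := (h.coord_eq hcur (show (s.cl r'.client).phase.cur = some (p', id') by
            rw [k1]; rfl)).2
          exact this.symm
        subst hp'
        obtain rfl : r = r' := by simpa [h1] using hr'
        by_cases hi : i = q.part
        · subst hi
          obtain ⟨rfl, -⟩ : q = q' ∧ _ := by simpa using hp
          exact h3
        · exact k7 i q' pt' (by simpa [hi] using hp)
      · exact k7 i q' pt' (by simpa [hid] using hp)
    · exact fun i pt' hp => (k8 i pt' hp).imp fun q' hq => hmono _ _ _ hq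
  · intro id' i q' pt' hp
    by_cases hid : id' = id
    · subst hid
      by_cases hi : i = q.part
      · subst hi
        obtain ⟨rfl, rfl⟩ : q = q' ∧ pt = pt' := by simpa using hp
        exact .inr ⟨rfl, _, _, _, _, _, h6, h5, hrk.parts ▸ h2, by omega, by omega⟩
      · exact .inl (by simpa [hi] using hp)
    · exact .inl (by simpa [hid] using hp)

/-- The open context witnesses that no commit timestamp was fixed before. As the context holds the
final write set, the versions added are those that the characterization of `versions` demands, and
the supremum dominates every proposal. -/
theorem Ctl.commit {p : Server C} {id : TxId} {r : CommitCtx C} {pt : Fin C.N → ℕ} {ct : ℕ}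
    (h : Ctl s g) (hr : (s.srv p).commits id = some r)
    (hpt : ∀ i ∈ r.parts, r.resp i = some (pt i)) (hct : ct = r.parts.sup pt)
    (hcl : s'.cl = s.cl) (hused : s'.used = s.used) (hhist : s'.hist = s.hist)
    (hver : s'.versions = s.versions ∪ {X | X.tx = id ∧ X.ut = ct ∧ r.WS X.key = some X.val})
    (hTX : ∀ p' id', (s'.srv p').TX id' = if p' = p ∧ id' = id then none else (s.srv p').TX id')
    (hreads : ∀ p, (s'.srv p).reads = (s.srv p).reads)
    (hcommits : ∀ p' id', (s'.srv p').commits id' =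
      if p' = p ∧ id' = id then none else (s.srv p').commits id')
    (hnet : s'.net = .commitResp r.client ct ::ₘ
      (s.net + r.parts.val.map (fun i => .cohortCommit p (r.tgt i) id ct))) :
    Ctl s' { g with ct := Function.update g.ct id (some ct) } := by
  have hrk := h.commits _ _ _ hr
  obtain ⟨h', hfin⟩ := hrk.fin
  have hcur : (s.cl r.client).phase.cur = some (p, id) := by rw [hrk.phase]; rfl
  have hctm : ∀ id' t, g.ct id' = some t → Function.update g.ct id (some ct) id' = some t := by
    intro id' t ht
    have : id' ≠ id := by rintro rfl; simp [hrk.ct] at ht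
    simpa [this] using ht
  have hnt : ∀ c', c' ≠ r.client → NoTok s.net (.cl c') → NoTok s'.net (.cl c') := by
    intro c' hc hn
    rw [hnet]
    exact (hn.add_map (by simp [Msg.tok])).cons (by simpa [Msg.tok] using hc.symm)
  have hprop : ∀ i ∈ r.parts, ∃ q, g.prop id i = some (q, pt i) :=
    fun i hi => hrk.resp i _ (hpt i hi)
  constructor
  · rw [hused]; exact h.used
  · rw [hused]; exact h.used_finite
  · rw [← toks, hnet]
    refine nodup_toks_cons rfl ?_ (hrk.noTok.add_map (by simp [Msg.tok]))
    rw [toks_add, toks_map_none _ _ fun i => rfl, add_zero]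
    exact h.nodup
  · intro m hm'
    rw [hnet] at hm'
    rcases Multiset.mem_cons.1 hm' with rfl | hm'
    · exact ⟨p, id, by rw [hcl]; exact hrk.phase, by simp⟩
    rcases Multiset.mem_add.1 hm' with hms | hms
    · refine (h.msg m hms).mono hcl hhist (fun _ _ h => h) rfl (fun _ _ _ h => h) hctm ?_ ?_ ?_ ?_
      · intro c' id' u p' _ h1 h2
        have : id' ≠ id := by rintro rfl; simp [hfin] at h2
        simpa [hTX, this] using h1
      · intro p' id' i r' ht h2 h3
        exact ⟨r', by rwa [hreads], h3⟩
      · intro p' id' i r' ht h7 h8 h9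
        refine ⟨r', ?_, rfl, rfl, rfl, h9⟩
        rw [hcommits, if_neg]
        · exact h7
        -- A pending prepare request would mean a missing proposal, but all partitions of the closed
        -- context have proposed.
        · rintro ⟨rfl, rfl⟩
          obtain rfl : r = r' := by simpa [hr] using h7
          obtain ⟨q, hq⟩ := hprop i h8
          simp [h9] at hq
      · rintro c' p' id' hwt W rfl h7 h8
        refine ⟨?_, h8⟩
        have : id' ≠ id := by
          rintro rfl
          obtain ⟨h9, -⟩ : MsgOK s g _ := h.msg _ hms
          have := h.commits_eq_none (p' := p) (by rw [h9]; rfl) fun hn => hn _ hms rfl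
          simp [hr] at this
        simpa [this] using h7
    · obtain ⟨i, hi, rfl⟩ := Multiset.mem_map.1 hms
      refine ⟨by simp, pt i, ?_⟩
      obtain ⟨q, hq⟩ := hprop i hi
      have := hrk.tgt i q _ hq
      have h2 := hrk.tgt_part i hi
      rw [h2, this]; exact hq
  · rw [hhist]; exact h.hist
  · rw [hcl]; exact h.cur
  · intro c' p' id' hc'
    rw [hcl] at hc' ⊢
    obtain ⟨h1, h2⟩ := h.run c' p' id' hc'
    have : id' ≠ id := by rintro rfl; simp [hfin] at h2
    exact ⟨by simpa [hTX, this] using h1, h2⟩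
  · rw [hcl]; exact h.committing
  · intro p' id' r' hr'
    rw [hreads] at hr'
    obtain ⟨⟨χ, D, h1⟩, h2⟩ := h.reads p' id' r' hr'
    refine ⟨⟨χ, D, by rw [hcl]; exact h1⟩, hnt _ ?_ h2⟩
    intro hc
    have := hrk.phase
    rw [← hc, h1] at this
    cases this
  · intro p' id' r' hr'
    rw [hcommits] at hr'
    split_ifs at hr' with hp
    obtain ⟨k1, k2, k3, k4, k5, k6, k7, k8⟩ := h.commits p' id' r' hr'
    -- Another open context for `id` would be at the same coordinator, and that one has just been
    -- closed.
    have hne : id' ≠ id := by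
      rintro rfl
      have := (h.coord_eq hcur (show (s.cl r'.client).phase.cur = some (p', id') by
        rw [k1]; rfl)).2
      exact hp ⟨this.symm, rfl⟩
    refine ⟨by rw [hcl]; exact k1, hnt _ ?_ k2, k3, by simpa [hne] using k4, k5, k6, k7, k8⟩
    intro hc
    have := hrk.phase
    rw [← hc, k1] at this
    cases this
    exact hne rfl
  · intro p' id' st
    rw [hTX]
    split_ifs
    · nofun
    · exact h.tx p' id' st
  · exact h.fin
  · exact h.prop
  · intro id' t ht
    by_cases hid : id' = id
    · subst hid
      obtain rfl : ct = t := by simpa using ht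
      refine ⟨r.WS, h', hfin, ?_⟩
      intro i hi
      rw [← hrk.parts] at hi
      obtain ⟨q, hq⟩ := hprop i hi
      exact ⟨q, pt i, hq, hct ▸ Finset.le_sup hi⟩
    · exact h.ct id' t (by simpa [hid] using ht)
  · intro X
    rw [hver, Set.mem_union, h.versions]
    by_cases hid : X.tx = id
    · subst hid
      simp [hrk.ct, hfin, eq_comm]
    · simp [hid]

theorem Ctl.startServe {net : Multiset (Msg C)} {c : C.Client} {p : Server C} {ust st : ℕ}
    {id : TxId} (h : Ctl s g) (hm : s.net = .startReq c p ust ::ₘ net) (hid : id ∉ s.used)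
    (hst : ust ≤ st)
    (hcl : s'.cl = s.cl) (hused : s'.used = insert id s.used) (hhist : s'.hist = s.hist)
    (hver : s'.versions = s.versions)
    (hTX : ∀ p' id', (s'.srv p').TX id' =
      if p' = p ∧ id' = id then some st else (s.srv p').TX id')
    (hreads : ∀ p, (s'.srv p).reads = (s.srv p).reads)
    (hcommits : ∀ p, (s'.srv p).commits = (s.srv p).commits)
    (hnet : s'.net = .startResp c id st ::ₘ net) :
    Ctl s' { g with info := Function.update g.info id (some (c, p, st)) } := by
  obtain ⟨h1, rfl⟩ : MsgOK s g _ := h.msg _ (hm ▸ Multiset.mem_cons_self _ _)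
  have hnone : g.info id = none := by
    by_contra hne; exact hid ((h.used id).2 hne)
  have hfin : g.fin id = none := by
    cases hf : g.fin id with
    | none => rfl
    | some x => exact absurd hnone (h.fin id x.1 x.2 hf).1
  have hinfo : ∀ id' x, g.info id' = some x →
      Function.update g.info id (some (c, p, st)) id' = some x := by
    intro id' x hx
    have : id' ≠ id := by rintro rfl; simp [hnone] at hx
    simpa [this] using hx
  have hnt : ∀ c', NoTok s.net (.cl c') → NoTok s'.net (.cl c') := by
    intro c' hn
    have : c' ≠ c := by rintro rfl; exact not_noTok hm rfl hn
    rw [hnet]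
    exact (hn.rest hm).cons (by simpa [Msg.tok] using this.symm)
  constructor
  · intro id'
    rw [hused, Set.mem_insert_iff, h.used]
    by_cases hid' : id' = id <;> simp [hid']
  · rw [hused]; exact h.used_finite.insert id
  · rw [← toks, hnet]
    exact nodup_toks_cons rfl (h.nodup_rest hm) (h.noTok_rest hm rfl)
  · intro m hm'
    rw [hnet] at hm'
    rcases Multiset.mem_cons.1 hm' with rfl | hm'
    · refine ⟨p, by rw [hcl]; exact h1, by simp, by simp [hTX], hfin, by rw [hcl]; exact hst, ?_⟩
      rw [hhist]
      rintro o ho rfl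
      obtain ⟨p', st', h2⟩ := h.hist o ho
      simp [hnone] at h2
    have hms : m ∈ s.net := by rw [hm]; exact Multiset.mem_cons_of_mem hm'
    refine (h.msg m hms).mono hcl hhist hinfo rfl (fun _ _ _ h => h) (fun _ _ h => h) ?_ ?_ ?_
      (fun _ _ _ _ _ _ h1 h2 => ⟨h1, h2⟩)
    · intro c' id' u p' _ h1 _
      obtain ⟨c'', h2⟩ := h.tx _ _ _ h1
      have : id' ≠ id := by rintro rfl; simp [hnone] at h2
      simpa [hTX, this] using h1
    · intro p' id' i r' ht h2 h3
      exact ⟨r', by rwa [hreads], h3⟩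
    · intro p' id' i r' ht h7 h8 h9
      exact ⟨r', by rwa [hcommits], rfl, rfl, rfl, h9⟩
  · rw [hhist]
    intro o ho
    obtain ⟨p', st', h2⟩ := h.hist o ho
    exact ⟨p', st', hinfo _ _ h2⟩
  · rw [hcl]
    exact fun c' p' id' hc => hinfo _ _ (h.cur c' p' id' hc)
  · intro c' p' id' hc
    rw [hcl] at hc ⊢
    obtain ⟨h2, h3⟩ := h.run c' p' id' hc
    have h4 := h.cur c' p' id' (Phase.cur_of_run hc)
    have : id' ≠ id := by rintro rfl; simp [hnone] at h4
    exact ⟨by simpa [hTX, this] using h2, h3⟩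
  · rw [hcl]; exact h.committing
  · intro p' id' r' hr'
    rw [hreads] at hr'
    exact hcl ▸ ⟨(h.reads p' id' r' hr').1, hnt _ (h.reads p' id' r' hr').2⟩
  · intro p' id' r' hr'
    rw [hcommits] at hr'
    obtain ⟨k1, k2, k3, k4, k5, k6, k7, k8⟩ := h.commits p' id' r' hr'
    exact ⟨by rw [hcl]; exact k1, hnt _ k2, k3, k4, k5, k6, k7, k8⟩
  · intro p' id' st'
    rw [hTX]
    split_ifs with hp
    · obtain ⟨rfl, rfl⟩ := hp
      rintro ⟨⟩
      exact ⟨c, by simp⟩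
    · exact fun h' => (h.tx p' id' st' h').imp fun c' => hinfo _ _
  · intro id' W h' hf
    refine ⟨?_, (h.fin id' W h' hf).2⟩
    obtain ⟨x, hx⟩ := Option.ne_none_iff_exists'.1 (h.fin id' W h' hf).1
    simp only [hinfo _ _ hx]
    simp
  · intro id' i q pt hp
    obtain ⟨k1, W, h', c', p', st', k2, k3, k4⟩ := h.prop id' i q pt hp
    exact ⟨k1, W, h', c', p', st', k2, hinfo _ _ k3, k4⟩
  · exact h.ct
  · rw [hver]; exact h.versions

theorem Ctl.mem_rest {m m' : Msg C} {net : Multiset (Msg C)} (h : Ctl s g)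
    (hm : s.net = m ::ₘ net) {a : Tok C} (ht : m.tok = some a) (hm' : m' ∈ net) :
    m' ∈ s.net ∧ m'.tok ≠ some a :=
  ⟨by rw [hm]; exact Multiset.mem_cons_of_mem hm', h.noTok_rest hm ht m' hm'⟩

theorem Ctl.gstep (h : Ctl s g) (hs : GStep s g s' g') : Ctl s' g' := by
  cases hs
  case silent hs hq =>
    cases hs
    case startSend c p hc =>
      have hno := h.noTok_of_phase (.inl hc)
      refine Ctl.of_client (fin' := g.fin) h (onlyClient_setCl c _ _) (fun _ => .inl rfl)
        (nodup_toks_cons rfl h.nodup hno) ?_ (fun o ho => .inl ho) nofun nofun nofun (.inl (.inl hc))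
      intro m hm
      rcases Multiset.mem_cons.1 hm with rfl | hm
      · exact .inr ⟨rfl, by simp [MsgOK]⟩
      · exact .inl ⟨hm, hno m hm⟩
    case startServe net c p ust id hm hid =>
      -- Not silent: the identifier is new.
      have h1 : insert id s.used = s.used := hq.1
      exact absurd (h1 ▸ Set.mem_insert id s.used) hid
    case startRecv net c p id ust hc hm =>
      obtain ⟨p', h1, h2, h3, h4, h5, h6⟩ : MsgOK s g _ := h.msg _ (hm ▸ Multiset.mem_cons_self _ _)
      obtain rfl : p = p' := by rw [hc] at h1; cases h1; rfl
      refine Ctl.of_client (fin' := g.fin) h (onlyClient_log c _ _ _) (fun _ => .inl rfl)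
        (h.nodup_rest hm) (fun m hm' => .inl (h.mem_rest hm rfl hm')) ?_ ?_ ?_ nofun
        (.inr (not_noTok hm rfl))
      · intro o ho
        rcases List.mem_append.1 ho with ho | ho
        · exact .inl ho
        · obtain rfl := List.mem_singleton.1 ho
          exact .inr ⟨rfl, p, _, h2⟩
      · rintro p' id' ⟨⟩; exact h2
      · rintro p' id' ⟨⟩; exact ⟨h3, h4⟩
    case readSend c p id χ χ' D hc hD hχ =>
      have hno := h.noTok_of_phase (.inr ⟨p, id, hc⟩)
      refine Ctl.of_client (fin' := g.fin) h (onlyClient_setCl c _ _) (fun _ => .inl rfl)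
        (nodup_toks_cons rfl h.nodup hno) ?_ (fun o ho => .inl ho) ?_ ?_ nofun
        (.inl (.inr ⟨p, id, hc⟩))
      · intro m hm
        rcases Multiset.mem_cons.1 hm with rfl | hm
        · exact .inr ⟨rfl, χ, D, by simp, hχ⟩
        · exact .inl ⟨hm, hno m hm⟩
      · rintro p' id' ⟨⟩; exact h.cur c p id (by rw [hc]; rfl)
      · rintro p' id' ⟨⟩; exact h.run c p id (by rw [hc]; rfl)
    case readServe hm hst hparts hslice htgt =>
      exact h.readServe hm hst htgt rfl rfl rfl rfl (State.proj_setSrv ServerState.TX rfl)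
        (State.proj_setSrv ServerState.commits rfl)
        (State.proj_setSrv_update ServerState.reads rfl) rfl
    case sliceServe hm hD =>
      refine h.of_net rfl rfl rfl rfl (State.proj_setSrv ServerState.reads rfl)
        (State.proj_setSrv ServerState.commits rfl) (State.proj_setSrv ServerState.TX rfl)
        (nodup_toks_cons rfl (h.nodup_rest hm) (h.noTok_rest hm rfl)) ?_
      obtain ⟨h1, h2⟩ : MsgOK s g _ := h.msg _ (hm ▸ Multiset.mem_cons_self _ _)
      intro m hm'
      rcases Multiset.mem_cons.1 hm' with rfl | hm'
      · exact .inr ⟨by simp [Msg.tok], h1⟩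
      · exact .inl (h.mem_rest hm rfl hm').1
    case sliceRecv hm hr =>
      exact h.sliceRecv hm hr rfl rfl rfl rfl (State.proj_setSrv ServerState.TX rfl)
        (State.proj_setSrv ServerState.commits rfl)
        (State.proj_setSrv_update ServerState.reads rfl) rfl
    case readDone hr hw =>
      exact h.readDone hr hw rfl rfl rfl rfl (State.proj_setSrv ServerState.TX rfl)
        (State.proj_setSrv ServerState.commits rfl)
        (State.proj_setSrv_update ServerState.reads rfl) rfl
    case readRecv net c p id χ D D' I hc hm hD' =>
      have hcur := h.cur c p id (by rw [hc]; rfl)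
      refine Ctl.of_client (fin' := g.fin) h (onlyClient_log c _ _ _) (fun _ => .inl rfl)
        (h.nodup_rest hm) (fun m hm' => .inl (h.mem_rest hm rfl hm')) ?_ ?_ ?_ nofun
        (.inr (not_noTok hm rfl))
      · intro o ho
        rcases List.mem_append.1 ho with ho | ho
        · exact .inl ho
        · obtain rfl := List.mem_singleton.1 ho
          exact .inr ⟨rfl, p, _, hcur⟩
      · rintro p' id' ⟨⟩; exact hcur
      · rintro p' id' ⟨⟩; exact h.run c p id (by rw [hc]; rfl)
    case write c p id kvs hc =>
      have hno := h.noTok_of_phase (.inr ⟨p, id, hc⟩)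
      have hcur := h.cur c p id (by rw [hc]; rfl)
      refine Ctl.of_client (fin' := g.fin) h (onlyClient_log c _ s.net _) (fun _ => .inl rfl)
        h.nodup (fun m hm' => .inl ⟨hm', hno m hm'⟩) ?_ ?_ ?_ ?_ (.inl (.inr ⟨p, id, hc⟩))
      · intro o ho
        rcases List.mem_append.1 ho with ho | ho
        · exact .inl ho
        · obtain rfl := List.mem_singleton.1 ho
          exact .inr ⟨rfl, p, _, hcur⟩
      · exact h.cur c
      · exact h.run c
      · simp [hc]
    case finish c p id hc hWS =>
      have hno := h.noTok_of_phase (.inr ⟨p, id, hc⟩)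
      exact Ctl.of_client (fin' := g.fin) h (onlyClient_setCl c _ s.net) (fun _ => .inl rfl)
        h.nodup (fun m hm' => .inl ⟨hm', hno m hm'⟩) (fun o ho => .inl ho) nofun nofun nofun
        (.inl (.inr ⟨p, id, hc⟩))
    case commitSend c p id hc hWS =>
      have := hq.2.1 c p id (by simp)
      simp [hc] at this
    case commitServe hm hst htgt =>
      exact h.commitServe hm hst htgt rfl rfl rfl rfl (State.proj_setSrv ServerState.TX rfl)
        (State.proj_setSrv ServerState.reads rfl)
        (State.proj_setSrv_update ServerState.commits rfl) rfl
    case prepare net p q id ust ht D t hlc ust' pt hm _ _ _ _ =>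
      -- Not silent: the consumed prepare request would have to remain in transit, against
      -- uniqueness of its token.
      have h1 : _ ∈ Msg.prepareResp q p id pt ::ₘ net :=
        hq.2.2.2 _ (hm ▸ Multiset.mem_cons_self _ _) ⟨id, q.part, rfl⟩
      exact absurd rfl (h.noTok_rest hm rfl _ (by simpa using h1))
    case prepareRecv hm hr =>
      exact h.prepareRecv hm hr rfl rfl rfl rfl (State.proj_setSrv ServerState.TX rfl)
        (State.proj_setSrv ServerState.reads rfl)
        (State.proj_setSrv_update ServerState.commits rfl) rfl
    case decide p id r pt ct hr hpt hct =>
      have := hq.2.2.1 p id (by simp [hr])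
      simp at this
    case cohortCommit hm _ _ _ =>
      refine h.of_net rfl rfl rfl rfl (State.proj_setSrv ServerState.reads rfl)
        (State.proj_setSrv ServerState.commits rfl) (State.proj_setSrv ServerState.TX rfl)
        (h.nodup_rest hm) ?_
      intro m hm'
      exact .inl (by rw [hm]; exact Multiset.mem_cons_of_mem hm')
    case commitRecv net c p id ct hc hm =>
      have hcur := h.cur c p id (by rw [hc]; rfl)
      refine Ctl.of_client (fin' := g.fin) h (onlyClient_log c _ _ _) (fun _ => .inl rfl)
        (h.nodup_rest hm) (fun m hm' => .inl (h.mem_rest hm rfl hm')) ?_ nofun nofun nofun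
        (.inr (not_noTok hm rfl))
      intro o ho
      rcases List.mem_append.1 ho with ho | ho
      · exact .inl ho
      · obtain rfl := List.mem_singleton.1 ho
        exact .inr ⟨rfl, p, _, hcur⟩
    case recvVV hm | recvGSV hm | recvOld hm =>
      exact h.of_net rfl rfl rfl rfl (State.proj_setSrv ServerState.reads rfl)
        (State.proj_setSrv ServerState.commits rfl) (State.proj_setSrv ServerState.TX rfl)
        (h.nodup_rest hm) fun m hm' => .inl (by rw [hm]; exact Multiset.mem_cons_of_mem hm')
    case sendVV | sendGSV | sendOld =>
      refine h.of_net rfl rfl rfl rfl (fun _ => rfl) (fun _ => rfl) (fun _ => rfl) ?_ ?_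
      · rw [State.net_withNet, toks_add, toks_map_none _ _ fun i => rfl, add_zero]
        exact h.nodup
      · intro m hm
        rcases Multiset.mem_add.1 hm with hm | hm
        · exact .inl hm
        · obtain ⟨q, -, rfl⟩ := Multiset.mem_map.1 hm
          exact .inr ⟨by simp [Msg.tok], trivial⟩
    all_goals
      exact h.of_net rfl rfl rfl rfl (State.proj_setSrv ServerState.reads rfl)
        (State.proj_setSrv ServerState.commits rfl) (State.proj_setSrv ServerState.TX rfl)
        h.nodup fun m hm => .inl hm
  case startServe hm hid =>
    exact h.startServe hm hid (le_max_right _ _) rfl rfl rfl rfl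
      (State.proj_setSrv_update ServerState.TX rfl)
      (State.proj_setSrv ServerState.reads rfl) (State.proj_setSrv ServerState.commits rfl) rfl
  case commitSend c p id hc hWS =>
    have hno := h.noTok_of_phase (.inr ⟨p, id, hc⟩)
    have hcur := h.cur c p id (by rw [hc]; rfl)
    have hrun := (h.run c p id (by rw [hc]; rfl)).2
    have hct : g.ct id = none := by
      cases hct : g.ct id with
      | none => rfl
      | some t =>
        obtain ⟨W, h', h1, -⟩ := h.ct id t hct
        simp [hrun] at h1
    have hprop : ∀ i, g.prop id i = none := by
      intro i
      cases hp : g.prop id i with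
      | none => rfl
      | some x =>
        obtain ⟨-, W, h', -, -, -, h1, -⟩ := h.prop id i x.1 x.2 hp
        simp [hrun] at h1
    refine Ctl.of_client h (onlyClient_setCl c _ _) ?_
      (nodup_toks_cons rfl h.nodup hno) ?_ (fun o ho => .inl ho) ?_ nofun ?_
      (.inl (.inr ⟨p, id, hc⟩))
    · intro id'
      by_cases hid : id' = id
      · subst hid
        exact .inr ⟨hrun, ⟨p, by rw [hc]; rfl⟩, _, _, Function.update_self _ _ _, hWS⟩
      · simp [hid]
    · intro m hm
      rcases Multiset.mem_cons.1 hm with rfl | hm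
      · exact .inr ⟨rfl, by simp, by simp, by simp, hct, hprop⟩
      · exact .inl ⟨hm, hno m hm⟩
    · rintro p' id' ⟨⟩; exact hcur
    · rintro p' id' ⟨⟩; exact Function.update_self _ _ _
  case prepare net p q id ust ht D t hlc ust' pt hm h1 h2 h3 h4 =>
    exact h.prepare hm (by omega) rfl rfl rfl rfl (State.proj_setSrv ServerState.TX rfl)
      (State.proj_setSrv ServerState.reads rfl) (State.proj_setSrv ServerState.commits rfl) rfl
  case commit hr hpt hct =>
    exact h.commit hr hpt hct rfl rfl rfl rfl (State.proj_setSrv_update ServerState.TX rfl)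
      (State.proj_setSrv ServerState.reads rfl)
      (State.proj_setSrv_update ServerState.commits rfl) rfl

/-! ### Entries and items agree with what has been fixed -/

/-- The ghost state is write-once. This makes facts about transactions persistent and lets
identifiers be compared across states. -/
structure Ghost.Le (g g' : Ghost C) : Prop where
  info : ∀ id x, g.info id = some x → g'.info id = some x
  fin : ∀ id x, g.fin id = some x → g'.fin id = some x
  prop : ∀ id i x, g.prop id i = some x → g'.prop id i = some x
  ct : ∀ id t, g.ct id = some t → g'.ct id = some t

theorem Ghost.Le.refl (g : Ghost C) : g.Le g :=
  ⟨fun _ _ h => h, fun _ _ h => h, fun _ _ _ h => h, fun _ _ h => h⟩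

theorem eq_some_update {α : Type*} {f : TxId → Option α} {id id' : TxId} {x y : α}
    (h : f id = none) (hx : f id' = some x) : Function.update f id (some y) id' = some x := by
  have : id' ≠ id := by rintro rfl; simp [h] at hx
  simpa [this] using hx

theorem GStep.le (hs : GStep s g s' g') (h : Ctl s g) : g.Le g' := by
  cases hs
  case silent => exact .refl g
  case startServe hm hid =>
    refine ⟨fun _ _ => eq_some_update ?_, fun _ _ h => h, fun _ _ _ h => h, fun _ _ h => h⟩
    by_contra hne; exact hid ((h.used _).2 hne)
  case commitSend c p id hc hWS =>
    exact ⟨fun _ _ h => h, fun _ _ => eq_some_update (h.run c p id (by rw [hc]; rfl)).2,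
      fun _ _ _ h => h, fun _ _ h => h⟩
  case prepare net p q id ust ht D t hlc ust' pt hm h1 h2 h3 h4 =>
    obtain ⟨r, c, h', h1, h2, h3, h4, -⟩ : MsgOK s g _ :=
      h.msg _ (hm ▸ Multiset.mem_cons_self _ _)
    refine ⟨fun _ _ h => h, fun _ _ h => h, fun id' i x hx => ?_, fun _ _ h => h⟩
    by_cases hid : id' = id
    · subst hid
      have hi : i ≠ q.part := by rintro rfl; simp [h4] at hx
      simpa [hi] using hx
    · simpa [hid] using hx
  case commit hr hpt hct =>
    exact ⟨fun _ _ h => h, fun _ _ h => h, fun _ _ _ h => h,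
      fun _ _ => eq_some_update (h.commits _ _ _ hr).ct⟩

/-- The entry `e` is prepared at the cohort `q`. -/
def PrepOK (g : Ghost C) (q : Server C) (e : Entry C) : Prop :=
  ∃ W h, g.fin e.id = some (W, h) ∧ g.prop e.id q.part = some (q, e.ts) ∧ e.D = W.slice q.part

/-- The entry `e` of the cohort `q` is committed. -/
def DoneOK (g : Ghost C) (q : Server C) (e : Entry C) : Prop :=
  ∃ W h pt, g.fin e.id = some (W, h) ∧ g.prop e.id q.part = some (q, pt) ∧
    e.D = W.slice q.part ∧ g.ct e.id = some e.ts

def ItemOK (g : Ghost C) (p : Server C) (d : Item C) : Prop :=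
  C.part d.key = p.part ∧ g.ct d.tx = some d.ut ∧
    ∃ W h, g.fin d.tx = some (W, h) ∧ W d.key = some d.val

/-- Ties the data held by servers and replication channels to the ghost state, so that each prepared
or committed entry is the slice of a final write set and each stored item is a genuine version. The
`replicas` field excludes messages from a server to itself or across partitions. -/
structure Ent (s : State C) (g : Ghost C) : Prop where
  prepared : ∀ q, ∀ e ∈ (s.srv q).prepared, PrepOK g q e
  committed : ∀ q, ∀ e ∈ (s.srv q).committed, DoneOK g q e
  repl : ∀ q p T t, .replicate T t ∈ s.repl q p → ∀ e ∈ T, DoneOK g q e ∧ e.ts = t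
  replicas : ∀ q p, s.repl q p ≠ [] → p.part = q.part ∧ p ≠ q
  store : ∀ p, ∀ d ∈ (s.srv p).store, ItemOK g p d

theorem PrepOK.mono {q : Server C} {e : Entry C} (h : PrepOK g q e) (hle : g.Le g') :
    PrepOK g' q e := by
  obtain ⟨W, h', h1, h2, h3⟩ := h
  exact ⟨W, h', hle.fin _ _ h1, hle.prop _ _ _ h2, h3⟩

theorem DoneOK.mono {q : Server C} {e : Entry C} (h : DoneOK g q e) (hle : g.Le g') :
    DoneOK g' q e := by
  obtain ⟨W, h', pt, h1, h2, h3, h4⟩ := h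
  exact ⟨W, h', pt, hle.fin _ _ h1, hle.prop _ _ _ h2, h3, hle.ct _ _ h4⟩

theorem ItemOK.mono {p : Server C} {d : Item C} (h : ItemOK g p d) (hle : g.Le g') :
    ItemOK g' p d := by
  obtain ⟨h1, h2, W, h', h3, h4⟩ := h
  exact ⟨h1, hle.ct _ _ h2, W, h', hle.fin _ _ h3, h4⟩

theorem WSet.slice_eq_some {W : WSet C} {i : Fin C.N} {k : C.Key} {x : C.Val} :
    W.slice i k = some x ↔ C.part k = i ∧ W k = some x := by
  simp [WSet.slice]

/-- An item keeps no trace of the cohort beyond its data center, so the conclusion holds at every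
replica of the partition and for any source `m`. -/
theorem DoneOK.itemOK {q p : Server C} {T : Set (Entry C)} (h : ∀ e ∈ T, DoneOK g q e)
    (hp : p.part = q.part) {m : Fin C.M} {d : Item C} (hd : d ∈ itemsOf T m) : ItemOK g p d := by
  obtain ⟨-, e, he, h1, h2, h3⟩ := hd
  obtain ⟨W, h', pt, h4, h5, h6, h7⟩ := h e he
  rw [h6, WSet.slice_eq_some] at h3
  exact ⟨by rw [h3.1, hp], by rw [← h1, ← h2]; exact h7, W, h', by rw [← h1]; exact h4, h3.2⟩

theorem Ctl.mem_versions (h : Ctl s g) {p : Server C} {d : Item C} (hd : ItemOK g p d) :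
    d.toVersion ∈ s.versions :=
  (h.versions _).2 hd.2

theorem Ent.of_diff (h : Ent s g) (hle : g.Le g')
    (hp : ∀ q, ∀ e ∈ (s'.srv q).prepared, e ∈ (s.srv q).prepared ∨ PrepOK g' q e)
    (hc : ∀ q, ∀ e ∈ (s'.srv q).committed, e ∈ (s.srv q).committed ∨ DoneOK g' q e)
    (hr : ∀ q p, ∀ m ∈ s'.repl q p, m ∈ s.repl q p ∨ (p.part = q.part ∧ p ≠ q) ∧
      ∀ T t, m = .replicate T t → ∀ e ∈ T, DoneOK g' q e ∧ e.ts = t)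
    (hst : ∀ p, ∀ d ∈ (s'.srv p).store, d ∈ (s.srv p).store ∨ ItemOK g' p d) : Ent s' g' := by
  constructor
  · intro q e he
    exact (hp q e he).elim (fun h1 => (h.prepared q e h1).mono hle) id
  · intro q e he
    exact (hc q e he).elim (fun h1 => (h.committed q e h1).mono hle) id
  · intro q p T t hm e he
    rcases hr q p _ hm with h1 | h1
    · exact ⟨(h.repl q p T t h1 e he).1.mono hle, (h.repl q p T t h1 e he).2⟩
    · exact h1.2 T t rfl e he
  · intro q p hne
    obtain ⟨m, hm⟩ := List.exists_mem_of_ne_nil _ hne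
    rcases hr q p _ hm with h1 | h1
    · exact h.replicas q p (List.ne_nil_of_mem h1)
    · exact h1.1
  · intro p d hd
    exact (hst p d hd).elim (fun h1 => (h.store p d h1).mono hle) id

theorem Ent.of_eq (h : Ent s g) (hle : g.Le g')
    (hp : ∀ q, (s'.srv q).prepared = (s.srv q).prepared)
    (hc : ∀ q, (s'.srv q).committed = (s.srv q).committed)
    (hst : ∀ q, (s'.srv q).store = (s.srv q).store) (hr : s'.repl = s.repl) : Ent s' g' := by
  refine h.of_diff hle ?_ ?_ ?_ ?_
  · exact fun q e he => .inl (hp q ▸ he)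
  · exact fun q e he => .inl (hc q ▸ he)
  · exact fun q p m hm => .inl (hr ▸ hm)
  · exact fun q e he => .inl (hst q ▸ he)

/-- A component of the server states that an update changes at one server. -/
theorem State.mem_proj_setSrv {α : Type*} (f : ServerState C → Set α) {p p' : Server C}
    {σ : ServerState C} {x : α} (h : x ∈ f ((s.setSrv p σ).srv p')) :
    x ∈ f (s.srv p') ∨ p' = p ∧ x ∈ f σ := by
  rw [State.srv_setSrv] at h
  split_ifs at h with hp
  · exact .inr ⟨hp, h⟩
  · exact .inl h

theorem State.mem_of_mem_proj {α : Type*} (f : ServerState C → Set α) {p p' : Server C}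
    {σ : ServerState C} {x : α} (hx : x ∈ f ((s.setSrv p σ).srv p')) (h : f σ = f (s.srv p)) :
    x ∈ f (s.srv p') := by
  rwa [State.proj_setSrv f h] at hx

theorem Ent.gstep (h : Ent s g) (hctl : Ctl s g) (hs : GStep s g s' g') : Ent s' g' := by
  have hle := hs.le hctl
  cases hs
  case silent hs hq =>
    cases hs
    case prepare net p q id ust ht D t hlc ust' pt hm _ _ _ _ =>
      have h1 : _ ∈ Msg.prepareResp q p id pt ::ₘ net :=
        hq.2.2.2 _ (hm ▸ Multiset.mem_cons_self _ _) ⟨id, q.part, rfl⟩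
      exact absurd rfl (hctl.noTok_rest hm rfl _ (by simpa using h1))
    case cohortCommit net p q id ct t e hm hclk he hid =>
      obtain ⟨h1, -⟩ : MsgOK s g _ := hctl.msg _ (hm ▸ Multiset.mem_cons_self _ _)
      refine h.of_diff hle ?_ ?_ (fun _ _ _ => .inl)
        (fun _ _ he => .inl (State.mem_of_mem_proj ServerState.store he rfl))
      · intro q' e' he'
        rcases State.mem_proj_setSrv ServerState.prepared he' with h2 | ⟨rfl, h2⟩
        · exact .inl h2
        · exact .inl h2.1
      · intro q' e' he'
        rcases State.mem_proj_setSrv ServerState.committed he' with h2 | ⟨rfl, rfl | h2⟩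
        · exact .inl h2
        · obtain ⟨W, h', h3, h4, h5⟩ := h.prepared q' e he
          exact .inr ⟨W, h', e.ts, hid ▸ h3, hid ▸ h4, h5, h1⟩
        · exact .inl h2
    case apply p t ub cts hclk hub hne hsorted hcts =>
      have hcom : ∀ e ∈ (s.srv p).committed, DoneOK g p e := h.committed p
      refine h.of_diff hle
        (fun _ _ he => .inl (State.mem_of_mem_proj ServerState.prepared he rfl)) ?_ ?_ ?_
      · intro q' e' he'
        rcases State.mem_proj_setSrv ServerState.committed he' with h2 | ⟨rfl, h2⟩
        · exact .inl h2
        · exact .inl h2.1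
      · intro q p' m hm
        rw [State.repl_sendRepl] at hm
        split_ifs at hm with hp
        · obtain ⟨rfl, hpp, hpp'⟩ := hp
          rcases List.mem_append.1 hm with hm | hm
          · exact .inl hm
          obtain ⟨t', -, rfl⟩ := List.mem_map.1 hm
          refine .inr ⟨⟨hpp, hpp'⟩, ?_⟩
          rintro T t ⟨rfl, rfl⟩ e he
          exact ⟨hcom e he.1, he.2⟩
        · exact .inl hm
      · intro q' d hd
        rcases State.mem_proj_setSrv ServerState.store hd with h2 | ⟨rfl, h2 | h2⟩
        · exact .inl h2
        · exact .inl h2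
        · exact .inr (DoneOK.itemOK (fun e he => hcom e he.1) rfl h2)
    case heartbeat p t ub hclk hub hne =>
      refine h.of_diff hle
        (fun _ _ he => .inl (State.mem_of_mem_proj ServerState.prepared he rfl))
        (fun _ _ he => .inl (State.mem_of_mem_proj ServerState.committed he rfl)) ?_
        (fun _ _ he => .inl (State.mem_of_mem_proj ServerState.store he rfl))
      intro q p' m hm
      rw [State.repl_sendRepl] at hm
      split_ifs at hm with hp
      · obtain ⟨rfl, hpp, hpp'⟩ := hp
        rcases List.mem_append.1 hm with hm | hm
        · exact .inl hm
        obtain rfl := List.mem_singleton.1 hm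
        exact .inr ⟨⟨hpp, hpp'⟩, nofun⟩
      · exact .inl hm
    case replRecv q p T ct l hm =>
      have hpart := (h.replicas q p (by simp [hm])).1
      have hT := h.repl q p T ct (by simp [hm])
      refine h.of_diff hle
        (fun _ _ he => .inl (State.mem_of_mem_proj ServerState.prepared he rfl))
        (fun _ _ he => .inl (State.mem_of_mem_proj ServerState.committed he rfl)) ?_ ?_
      · intro q' p' m hm'
        rw [State.repl_setRepl] at hm'
        split_ifs at hm' with hp
        · obtain ⟨rfl, rfl⟩ := hp
          exact .inl (by rw [hm]; exact List.mem_cons_of_mem _ hm')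
        · exact .inl hm'
      · intro q' d hd
        rcases State.mem_proj_setSrv ServerState.store hd with h2 | ⟨rfl, h2 | h2⟩
        · exact .inl h2
        · exact .inl h2
        · exact .inr (DoneOK.itemOK (fun e he => (hT e he).1) hpart h2)
    case heartbeatRecv q p t l hm =>
      refine h.of_diff hle
        (fun _ _ he => .inl (State.mem_of_mem_proj ServerState.prepared he rfl))
        (fun _ _ he => .inl (State.mem_of_mem_proj ServerState.committed he rfl)) ?_
        (fun _ _ he => .inl (State.mem_of_mem_proj ServerState.store he rfl))
      intro q' p' m hm'
      rw [State.repl_setRepl] at hm'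
      split_ifs at hm' with hp
      · obtain ⟨rfl, rfl⟩ := hp
        exact .inl (by rw [hm]; exact List.mem_cons_of_mem _ hm')
      · exact .inl hm'
    case garbageCollect p =>
      refine h.of_diff hle
        (fun _ _ he => .inl (State.mem_of_mem_proj ServerState.prepared he rfl))
        (fun _ _ he => .inl (State.mem_of_mem_proj ServerState.committed he rfl))
        (fun _ _ _ => .inl) ?_
      intro q' d hd
      rcases State.mem_proj_setSrv ServerState.store hd with h2 | ⟨rfl, h2⟩
      · exact .inl h2
      · exact .inl h2.1
    all_goals first
      | exact h.of_eq hle (fun _ => rfl) (fun _ => rfl) (fun _ => rfl) rfl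
      | exact h.of_eq hle (State.proj_setSrv ServerState.prepared rfl)
          (State.proj_setSrv ServerState.committed rfl) (State.proj_setSrv ServerState.store rfl) rfl
  case prepare net p q id ust ht D t hlc ust' pt hm h1 h2 h3 h4 =>
    obtain ⟨r, c, h', h1, h2, h3, h4, h5, h6, h7, -⟩ : MsgOK s g _ :=
      hctl.msg _ (hm ▸ Multiset.mem_cons_self _ _)
    refine h.of_diff hle ?_
      (fun _ _ he => .inl (State.mem_of_mem_proj ServerState.committed he rfl))
      (fun _ _ _ => .inl)
      (fun _ _ he => .inl (State.mem_of_mem_proj ServerState.store he rfl))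
    intro q' e' he'
    rcases State.mem_proj_setSrv ServerState.prepared he' with h2 | ⟨rfl, rfl | h2⟩
    · exact .inl h2
    · exact .inr ⟨r.WS, h', h6, by simp, h7⟩
    · exact .inl h2
  case commitSend =>
    exact h.of_eq hle (fun _ => rfl) (fun _ => rfl) (fun _ => rfl) rfl
  all_goals
    exact h.of_eq hle (State.proj_setSrv ServerState.prepared rfl)
      (State.proj_setSrv ServerState.committed rfl) (State.proj_setSrv ServerState.store rfl) rfl

/-! ### Clocks, version vectors and replication channels -/

/-- The timestamps in a replication channel increase from `a` to `b`, strictly before transactions. -/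
def Chan : ℕ → List (ReplMsg C) → ℕ → Prop
  | a, [], b => a ≤ b
  | a, .replicate _ t :: l, b => a < t ∧ Chan t l b
  | a, .heartbeat t :: l, b => a ≤ t ∧ Chan t l b

theorem Chan.le {l : List (ReplMsg C)} {a b : ℕ} (h : Chan a l b) : a ≤ b := by
  induction l generalizing a with
  | nil => exact h
  | cons m l ih => cases m with
    | replicate T t => exact h.1.le.trans (ih h.2)
    | heartbeat t => exact h.1.trans (ih h.2)

theorem Chan.append {l l' : List (ReplMsg C)} {a b c : ℕ} (h : Chan a l b) (h' : Chan b l' c) :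
    Chan a (l ++ l') c := by
  induction l generalizing a with
  | nil =>
    have hab : a ≤ b := h
    cases l' with
    | nil => exact le_trans hab h'
    | cons m l' => cases m with
      | replicate T t => exact ⟨hab.trans_lt h'.1, h'.2⟩
      | heartbeat t => exact ⟨hab.trans h'.1, h'.2⟩
  | cons m l ih => cases m with
    | replicate T t => exact ⟨h.1, ih h.2⟩
    | heartbeat t => exact ⟨h.1, ih h.2⟩

theorem Chan.lt_of_mem {l : List (ReplMsg C)} {a b t : ℕ} {T : Set (Entry C)} (h : Chan a l b)
    (hm : .replicate T t ∈ l) : a < t := by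
  induction l generalizing a with
  | nil => simp at hm
  | cons m l ih =>
    rcases List.mem_cons.1 hm with rfl | hml
    · exact h.1
    · cases m with
      | replicate T t => exact h.1.trans (ih h.2 hml)
      | heartbeat t => exact h.1.trans_lt (ih h.2 hml)

theorem chan_map {f : ℕ → Set (Entry C)} {l : List ℕ} {a b : ℕ} (hl : l.Pairwise (· < ·))
    (ha : ∀ t ∈ l, a < t) (hb : ∀ t ∈ l, t ≤ b) (hab : a ≤ b) :
    Chan a (l.map fun t => .replicate (f t) t) b := by
  induction l generalizing a with
  | nil => exact hab
  | cons t l ih =>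
    rw [List.pairwise_cons] at hl
    exact ⟨ha t (by simp), ih hl.2 hl.1 (fun t' ht' => hb t' (by simp [ht'])) (hb t (by simp))⟩

/-- Version vectors are indexed by data centers. By this lemma distinct replicas of one partition
occupy distinct entries. -/
theorem Server.ext {p q : Server C} (h : p.part = q.part) (h' : p.dc = q.dc) : p = q :=
  Subtype.ext (Prod.ext h h')

/-- The meaning of a version vector. The own entry of a server is strictly below everything it has
yet to apply. The entry kept for another replica is behind that replica's own entry only by what the
channel contains. The two bounds by the clocks make the next bound `ub` at least the current entry
and the next proposal strictly above it. -/
structure Clk (s : State C) : Prop where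
  prepared_le : ∀ p, ∀ e ∈ (s.srv p).prepared, e.ts ≤ (s.srv p).hlc
  VV_le : ∀ p, (s.srv p).VV p.dc ≤ max (s.srv p).clk (s.srv p).hlc
  VV_lt_prepared : ∀ p, ∀ e ∈ (s.srv p).prepared, (s.srv p).VV p.dc < e.ts
  VV_lt_committed : ∀ p, ∀ e ∈ (s.srv p).committed, (s.srv p).VV p.dc < e.ts
  chan : ∀ q p, p.part = q.part → Chan ((s.srv p).VV q.dc) (s.repl q p) ((s.srv q).VV q.dc)

theorem Clk.of_eq (h : Clk s)
    (hclk : ∀ q, (s'.srv q).clk = (s.srv q).clk)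
    (hhlc : ∀ q, (s'.srv q).hlc = (s.srv q).hlc)
    (hVV : ∀ q, (s'.srv q).VV = (s.srv q).VV)
    (hp : ∀ q, (s'.srv q).prepared = (s.srv q).prepared)
    (hc : ∀ q, (s'.srv q).committed = (s.srv q).committed)
    (hr : s'.repl = s.repl) : Clk s' := by
  constructor <;> simp only [hclk, hhlc, hVV, hp, hc, hr]
  · exact h.prepared_le
  · exact h.VV_le
  · exact h.VV_lt_prepared
  · exact h.VV_lt_committed
  · exact h.chan

theorem Clk.of_VV (h : Clk s) (hVV : ∀ q, (s'.srv q).VV = (s.srv q).VV) (hr : s'.repl = s.repl)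
    (hclk : ∀ q, (s.srv q).clk ≤ (s'.srv q).clk) (hhlc : ∀ q, (s.srv q).hlc ≤ (s'.srv q).hlc)
    (hp : ∀ q, ∀ e ∈ (s'.srv q).prepared, e ∈ (s.srv q).prepared ∨
      (s.srv q).VV q.dc < e.ts ∧ e.ts ≤ (s'.srv q).hlc)
    (hc : ∀ q, ∀ e ∈ (s'.srv q).committed, e ∈ (s.srv q).committed ∨ (s.srv q).VV q.dc < e.ts) :
    Clk s' := by
  refine ⟨?_, ?_, ?_, ?_, ?_⟩
  · exact fun q e he => (hp q e he).elim (fun h1 => (h.prepared_le q e h1).trans (hhlc q)) And.right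
  · exact fun q => hVV q ▸ (h.VV_le q).trans (max_le_max (hclk q) (hhlc q))
  · exact fun q e he => hVV q ▸ (hp q e he).elim (h.VV_lt_prepared q e) And.left
  · exact fun q e he => hVV q ▸ (hc q e he).elim (h.VV_lt_committed q e) id
  · simp only [hVV, hr]
    exact h.chan

/-! ### Safe timestamps, upper bounds and stabilization -/

/-- `t` is below all version vectors. -/
def Safe (s : State C) (t : ℕ) : Prop :=
  ∀ p : Server C, ∀ j ∈ C.replicas p.part, t ≤ (s.srv p).VV j

theorem Safe.own {t : ℕ} (h : Safe s t) (p : Server C) : t ≤ (s.srv p).VV p.dc :=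
  h p p.dc p.2

/-- Gossip is compared with the current version vector of its sender, not with the one at sending
time; this persists because version vectors only grow. A stabilization vector is compared only at
data centers replicating the sender's partition, where the sender itself takes part in the minimum.
-/
def StabMsg (s : State C) : Msg C → Prop
  | .gossipVV q _ vec => ∀ j, vec j ≤ (s.srv q).VV j
  | .gossipGSV q _ vec => ∀ j ∈ C.replicas q.part, vec j ≤ ((s.srv q).VV j : WithTop ℕ)
  | _ => True

/-- Bounds on the values that are exchanged for stabilization. -/
structure Stab (s : State C) (g : Ghost C) : Prop where
  info : ∀ id c p st, g.info id = some (c, p, st) → Safe s st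
  cl : ∀ c, Safe s (s.cl c).ust
  srv : ∀ p, Safe s (s.srv p).ust
  kVV : ∀ p q j, (s.srv p).kVV q j ≤ (s.srv q).VV j
  GSV : ∀ q : Server C, ∀ j ∈ C.replicas q.part, (s.srv q).GSV j ≤ ((s.srv q).VV j : WithTop ℕ)
  kGSV : ∀ p q : Server C, ∀ j ∈ C.replicas q.part,
    (s.srv p).kGSV q j ≤ ((s.srv q).VV j : WithTop ℕ)
  msg : ∀ m ∈ s.net, StabMsg s m

section Bound

variable {σ : ServerState C} {b : ℕ}

/-- The hypothesis makes `e.ts` positive, so the truncated subtraction in `bound` does end strictly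
below it. -/
theorem ServerState.bound_lt {e : Entry C} (he : e ∈ σ.prepared) (hb : ∀ e ∈ σ.prepared, b < e.ts) :
    σ.bound < e.ts := by
  have hne : σ.prepared ≠ ∅ := Set.nonempty_iff_ne_empty.1 ⟨e, he⟩
  rw [ServerState.bound, if_neg hne]
  have h1 : sInf (Entry.ts '' σ.prepared) ≤ e.ts := Nat.sInf_le ⟨e, he, rfl⟩
  have := hb e he
  omega

theorem ServerState.bound_le (hb : ∀ e ∈ σ.prepared, e.ts ≤ σ.hlc) :
    σ.bound ≤ max σ.clk σ.hlc := by
  rw [ServerState.bound]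
  split_ifs with hne
  · exact le_rfl
  · obtain ⟨e, he⟩ := Set.nonempty_iff_ne_empty.2 hne
    have h1 : sInf (Entry.ts '' σ.prepared) ≤ e.ts := Nat.sInf_le ⟨e, he, rfl⟩
    have := hb e he
    omega

/-- The lowest proposal is attained and exceeds `b`, so one less is still at least `b`. Applied to
the own version vector entry, this shows that the entry never moves backwards. -/
theorem ServerState.le_bound (hb : ∀ e ∈ σ.prepared, b < e.ts) (hb' : b ≤ max σ.clk σ.hlc) :
    b ≤ σ.bound := by
  rw [ServerState.bound]
  split_ifs with hne
  · exact hb'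
  · obtain ⟨e, he, h1⟩ := Nat.sInf_mem
      ((Set.nonempty_iff_ne_empty.2 hne).image (Entry.ts (C := C)))
    have := hb e he
    omega

end Bound

/-- A server raises its own version vector entry and extends its channels. -/
theorem Clk.advance {p : Server C} {σ : ServerState C} {ms : List (ReplMsg C)} {t ub : ℕ}
    (h : Clk s) (hclk : (s.srv p).clk < t)
    (hub : ub = ServerState.bound { s.srv p with clk := t })
    (eclk : σ.clk = t) (ehlc : σ.hlc = (s.srv p).hlc)
    (eVV : σ.VV = Function.update (s.srv p).VV p.dc ub)
    (ep : σ.prepared = (s.srv p).prepared)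
    (ec : ∀ e ∈ σ.committed, ub < e.ts)
    (hms : Chan ((s.srv p).VV p.dc) ms ub) (hself : s.repl p p = []) :
    Clk ((s.setSrv p σ).sendRepl p ms) := by
  have h1 : (s.srv p).VV p.dc ≤ ub := hms.le
  have h2 : ub ≤ max t (s.srv p).hlc := hub ▸ ServerState.bound_le (h.prepared_le p)
  -- Subtracting one from the lowest proposal keeps the new entry strictly below all prepared
  -- transactions.
  have h3 : ∀ e ∈ (s.srv p).prepared, ub < e.ts := fun e he =>
    hub ▸ ServerState.bound_lt (σ := { s.srv p with clk := t }) he (h.VV_lt_prepared p)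
  constructor
  · intro q e he
    rw [State.srv_sendRepl] at he ⊢
    by_cases hq : q = p
    · subst hq
      simp only [State.srv_setSrv_self, ep, ehlc] at he ⊢
      exact h.prepared_le q e he
    · rw [State.srv_setSrv_ne _ _ hq] at he ⊢
      exact h.prepared_le q e he
  · intro q
    rw [State.srv_sendRepl]
    by_cases hq : q = p
    · subst hq
      simpa [eVV, eclk, ehlc] using h2
    · rw [State.srv_setSrv_ne _ _ hq]
      exact h.VV_le q
  · intro q e he
    rw [State.srv_sendRepl] at he ⊢
    by_cases hq : q = p
    · subst hq
      simp only [State.srv_setSrv_self, ep, eVV, Function.update_self] at he ⊢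
      exact h3 e he
    · rw [State.srv_setSrv_ne _ _ hq] at he ⊢
      exact h.VV_lt_prepared q e he
  · intro q e he
    rw [State.srv_sendRepl] at he ⊢
    by_cases hq : q = p
    · subst hq
      simp only [State.srv_setSrv_self, eVV, Function.update_self] at he ⊢
      exact ec e he
    · rw [State.srv_setSrv_ne _ _ hq] at he ⊢
      exact h.VV_lt_committed q e he
  · intro q p' hpart
    rw [State.srv_sendRepl, State.repl_sendRepl]
    have hch := h.chan q p' hpart
    by_cases hq : q = p
    · subst hq
      by_cases hp' : p' = q
      · subst hp'
        -- The channel from a server to itself stays empty, as `sendRepl` skips the sender.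
        simp only [State.repl_setSrv, ne_eq, not_true_eq_false, and_false, if_false, hself]
        exact le_rfl
      · rw [if_pos ⟨rfl, hpart, hp'⟩, State.srv_setSrv_ne _ _ hp', State.srv_setSrv_self, eVV,
          Function.update_self]
        exact hch.append hms
    · rw [if_neg (fun hh => hq hh.1), State.srv_setSrv_ne _ _ hq]
      by_cases hp' : p' = p
      · subst hp'
        rw [State.srv_setSrv_self, eVV, Function.update_of_ne]
        · exact hch
        -- The update concerns the entry of `p` itself; the entry of another replica `q` is a
        -- different one.
        · exact fun hdc => hq (Server.ext hpart.symm hdc)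
      · rw [State.srv_setSrv_ne _ _ hp']
        exact hch

/-- A server receives the first message of a channel. -/
theorem Clk.receive {p q : Server C} {σ : ServerState C} {l : List (ReplMsg C)} {t : ℕ}
    (h : Clk s) (eclk : σ.clk = (s.srv p).clk) (ehlc : σ.hlc = (s.srv p).hlc)
    (eVV : σ.VV = Function.update (s.srv p).VV q.dc t)
    (ep : σ.prepared = (s.srv p).prepared) (ec : σ.committed = (s.srv p).committed)
    (hpart : p.part = q.part) (hne : p ≠ q) (hl : Chan t l ((s.srv q).VV q.dc)) :
    Clk ((s.setSrv p σ).setRepl q p l) := by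
  have hdc : p.dc ≠ q.dc := fun hdc => hne (Server.ext hpart hdc)
  have hown : ∀ q', ((s.setSrv p σ).srv q').VV q'.dc = (s.srv q').VV q'.dc := by
    intro q'
    by_cases hq : q' = p
    · subst hq
      rw [State.srv_setSrv_self, eVV, Function.update_of_ne hdc]
    · rw [State.srv_setSrv_ne _ _ hq]
  constructor
  · simp only [State.srv_setRepl, State.proj_setSrv ServerState.prepared ep,
      State.proj_setSrv ServerState.hlc ehlc]
    exact h.prepared_le
  · simp only [State.srv_setRepl, hown, State.proj_setSrv ServerState.clk eclk,
      State.proj_setSrv ServerState.hlc ehlc]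
    exact h.VV_le
  · simp only [State.srv_setRepl, hown, State.proj_setSrv ServerState.prepared ep]
    exact h.VV_lt_prepared
  · simp only [State.srv_setRepl, hown, State.proj_setSrv ServerState.committed ec]
    exact h.VV_lt_committed
  · intro q' p' hpart'
    rw [State.srv_setRepl, State.repl_setRepl, hown]
    by_cases hp' : p' = p
    · subst hp'
      rw [State.srv_setSrv_self, eVV]
      by_cases hq : q' = q
      · subst hq
        rw [if_pos ⟨rfl, rfl⟩, Function.update_self]
        exact hl
      · rw [if_neg (fun hh => hq hh.1), Function.update_of_ne]
        · exact h.chan q' p' hpart'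
        · exact fun hdc => hq (Server.ext (hpart'.symm.trans hpart) hdc)
    · rw [if_neg (fun hh => hp' hh.2), State.srv_setSrv_ne _ _ hp']
      exact h.chan q' p' hpart'

theorem Clk.gstep (h : Clk s) (hctl : Ctl s g) (hent : Ent s g) (hstab : Stab s g)
    (hs : Step s s') : Clk s' := by
  have hself : ∀ p, s.repl p p = [] := by
    intro p
    by_contra hne
    exact (hent.replicas p p hne).2 rfl
  cases hs
  case prepare net p q id ust ht D t hlc ust' pt hm hclk hhlc hust hpt =>
    obtain ⟨r, c, h', h1, h2, h3, h4, h5, h6, h7, h8⟩ : MsgOK s g _ :=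
      hctl.msg _ (hm ▸ Multiset.mem_cons_self _ _)
    -- The stable time of the cohort and the snapshot timestamp are safe, hence at most the own
    -- entry, which is at most the maximum of the old clocks. The new hybrid clock exceeds both old
    -- clocks, so the proposal is this clock: it is above the own entry and not above `hlc`.
    have k1 := (hstab.srv q).own q
    have k2 := (hstab.info _ _ _ _ h5).own q
    have k3 := h.VV_le q
    have k4 : pt = hlc := by omega
    subst k4
    refine h.of_VV (State.proj_setSrv ServerState.VV rfl) rfl ?_ ?_ ?_
      (fun _ _ he => .inl (State.mem_of_mem_proj ServerState.committed he rfl))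
    · intro q'
      rw [State.srv_withNet, State.srv_setSrv]
      split_ifs with hq
      · subst hq; exact hclk.le
      · exact le_rfl
    · intro q'
      rw [State.srv_withNet, State.srv_setSrv]
      split_ifs with hq
      · subst hq; show _ ≤ pt; omega
      · exact le_rfl
    · intro q' e he
      rcases State.mem_proj_setSrv ServerState.prepared he with h2 | ⟨rfl, rfl | h2⟩
      · exact .inl h2
      · refine .inr ⟨?_, by simp⟩
        show _ < pt
        omega
      · exact .inl h2
  case cohortCommit net p q id ct t e hm hclk he hid =>
    obtain ⟨h1, -⟩ : MsgOK s g _ := hctl.msg _ (hm ▸ Multiset.mem_cons_self _ _)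
    obtain ⟨W, h', h2, h3⟩ := hctl.ct _ _ h1
    obtain ⟨W', h'', h4, h5, h6⟩ := hent.prepared q e he
    subst hid
    obtain ⟨-, W₃, h₃, _, _, _, h7, -, h8, -⟩ := hctl.prop _ _ _ _ h5
    obtain rfl : W = W₃ := by rw [h2] at h7; cases h7; rfl
    -- The commit timestamp is at least this cohort's own proposal, which was strictly above its
    -- entry.
    obtain ⟨q', pt, h9, h10⟩ := h3 _ h8
    obtain ⟨rfl, rfl⟩ : q = q' ∧ e.ts = pt := by rw [h5] at h9; cases h9; exact ⟨rfl, rfl⟩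
    have hlt := h.VV_lt_prepared q e he
    refine h.of_VV (State.proj_setSrv ServerState.VV rfl) rfl ?_ ?_ ?_ ?_
    · intro q'
      rw [State.srv_withNet, State.srv_setSrv]
      split_ifs with hq
      · subst hq; exact hclk.le
      · exact le_rfl
    · intro q'
      rw [State.srv_withNet, State.srv_setSrv]
      split_ifs with hq
      · subst hq; exact le_max_left _ _
      · exact le_rfl
    · intro q' e' he'
      rcases State.mem_proj_setSrv ServerState.prepared he' with h2 | ⟨rfl, h2⟩
      · exact .inl h2
      · exact .inl h2.1
    · intro q' e' he'
      rcases State.mem_proj_setSrv ServerState.committed he' with h2 | ⟨rfl, rfl | h2⟩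
      · exact .inl h2
      · exact .inr (hlt.trans_le h10)
      · exact .inl h2
  case apply p t ub cts hclk hub hne hsorted hcts =>
    refine h.advance hclk hub rfl rfl rfl rfl (fun e he => he.2) ?_ (hself p)
    refine chan_map hsorted ?_ (fun t ht => ((hcts t).1 ht).1) ?_
    · intro t' ht'
      obtain ⟨-, e, he, rfl⟩ := (hcts t').1 ht'
      exact h.VV_lt_committed p e he
    · rw [hub]
      exact ServerState.le_bound (h.VV_lt_prepared p)
        ((h.VV_le p).trans (max_le_max hclk.le le_rfl))
  case heartbeat p t ub hclk hub hne =>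
    have hle : (s.srv p).VV p.dc ≤ ub := by
      rw [hub]
      exact ServerState.le_bound (h.VV_lt_prepared p)
        ((h.VV_le p).trans (max_le_max hclk.le le_rfl))
    exact h.advance hclk hub rfl rfl rfl rfl (by simp [hne]) ⟨hle, le_refl ub⟩ (hself p)
  case replRecv q p T ct l hm =>
    have hr := hent.replicas q p (by simp [hm])
    have hch := h.chan q p hr.1
    rw [hm] at hch
    exact h.receive rfl rfl rfl rfl rfl hr.1 hr.2 hch.2
  case heartbeatRecv q p t l hm =>
    have hr := hent.replicas q p (by simp [hm])
    have hch := h.chan q p hr.1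
    rw [hm] at hch
    exact h.receive rfl rfl rfl rfl rfl hr.1 hr.2 hch.2
  all_goals first
    | exact h.of_eq (fun _ => rfl) (fun _ => rfl) (fun _ => rfl) (fun _ => rfl) (fun _ => rfl) rfl
    | exact h.of_eq (State.proj_setSrv ServerState.clk rfl) (State.proj_setSrv ServerState.hlc rfl)
        (State.proj_setSrv ServerState.VV rfl) (State.proj_setSrv ServerState.prepared rfl)
        (State.proj_setSrv ServerState.committed rfl) rfl

theorem le_of_VV_eq (h : ∀ p, (s'.srv p).VV = (s.srv p).VV) (p : Server C) (j : Fin C.M) :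
    (s.srv p).VV j ≤ (s'.srv p).VV j :=
  (congrFun (h p) j).ge

theorem forall_or_of_forall {α : Sort*} {P Q : α → Prop} (h : ∀ a, P a) : ∀ a, P a ∨ Q a :=
  fun a => .inl (h a)

theorem apply_eq_or_of_eq {α β γ : Type*} {F G : α → β → γ} {R : α → β → Prop}
    (h : ∀ a, F a = G a) : ∀ a b, F a b = G a b ∨ R a b :=
  fun a b => .inl (congrFun (h a) b)

/-- For the own entry this is the lower estimate of `bound`; for the other entries it is the order
of timestamps in FIFO channels. -/
theorem Clk.VV_mono (h : Clk s) (hent : Ent s g) (hs : Step s s') (p : Server C) (j : Fin C.M) :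
    (s.srv p).VV j ≤ (s'.srv p).VV j := by
  have hset : ∀ (q : Server C) (σ : ServerState C) (i : Fin C.M) (t : ℕ),
      σ.VV = Function.update (s.srv q).VV i t → (s.srv q).VV i ≤ t →
        (s.srv p).VV j ≤ ((s.setSrv q σ).srv p).VV j := by
    intro q σ i t hσ ht
    rw [State.srv_setSrv]
    split_ifs with hq
    · subst hq
      rw [hσ, Function.update_apply]
      split_ifs with hj
      · exact hj ▸ ht
      · exact le_rfl
    · exact le_rfl
  cases hs
  case apply q t ub cts hclk hub hne hsorted hcts =>
    refine hset q _ q.dc ub rfl ?_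
    rw [hub]
    exact ServerState.le_bound (h.VV_lt_prepared q)
      ((h.VV_le q).trans (max_le_max hclk.le le_rfl))
  case heartbeat q t ub hclk hub hne =>
    refine hset q _ q.dc ub rfl ?_
    rw [hub]
    exact ServerState.le_bound (h.VV_lt_prepared q)
      ((h.VV_le q).trans (max_le_max hclk.le le_rfl))
  case replRecv q p' T ct l hm =>
    have hr := hent.replicas q p' (by simp [hm])
    have hch := h.chan q p' hr.1
    rw [hm] at hch
    exact hset p' _ q.dc ct rfl hch.1.le
  case heartbeatRecv q p' t l hm =>
    have hr := hent.replicas q p' (by simp [hm])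
    have hch := h.chan q p' hr.1
    rw [hm] at hch
    exact hset p' _ q.dc t rfl hch.1
  all_goals first
    | exact le_rfl
    | (refine le_of_VV_eq ?_ p j
       exact State.proj_setSrv ServerState.VV rfl)

theorem Safe.mono {t : ℕ} (h : Safe s t) (hVV : ∀ p j, (s.srv p).VV j ≤ (s'.srv p).VV j) :
    Safe s' t :=
  fun p j hj => (h p j hj).trans (hVV p j)

/-- Monotone version vectors preserve all old bounds. New values need only be checked against the
state before the step. -/
theorem Stab.of_diff (h : Stab s g) (hVV : ∀ p j, (s.srv p).VV j ≤ (s'.srv p).VV j)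
    (hinfo : ∀ id c p st, g'.info id = some (c, p, st) →
      g.info id = some (c, p, st) ∨ Safe s st)
    (hcl : ∀ c, (s'.cl c).ust = (s.cl c).ust ∨ Safe s (s'.cl c).ust)
    (hsrv : ∀ p, (s'.srv p).ust = (s.srv p).ust ∨ Safe s (s'.srv p).ust)
    (hkVV : ∀ p q, (s'.srv p).kVV q = (s.srv p).kVV q ∨
      ∀ j, (s'.srv p).kVV q j ≤ (s.srv q).VV j)
    (hGSV : ∀ q : Server C, (s'.srv q).GSV = (s.srv q).GSV ∨ ∀ j ∈ C.replicas q.part,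
      (s'.srv q).GSV j ≤ ((s.srv q).VV j : WithTop ℕ))
    (hkGSV : ∀ p q : Server C, (s'.srv p).kGSV q = (s.srv p).kGSV q ∨ ∀ j ∈ C.replicas q.part,
      (s'.srv p).kGSV q j ≤ ((s.srv q).VV j : WithTop ℕ))
    (hmsg : ∀ m ∈ s'.net, m ∈ s.net ∨ StabMsg s m) : Stab s' g' := by
  have hVV' : ∀ p j, ((s.srv p).VV j : WithTop ℕ) ≤ (s'.srv p).VV j :=
    fun p j => WithTop.coe_le_coe.2 (hVV p j)
  constructor
  · exact fun id c p st hi => ((hinfo id c p st hi).elim (h.info id c p st) _root_.id).mono hVV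
  · exact fun c => ((hcl c).elim (fun h1 => h1 ▸ h.cl c) id).mono hVV
  · exact fun c => ((hsrv c).elim (fun h1 => h1 ▸ h.srv c) id).mono hVV
  · exact fun p q j => ((hkVV p q).elim (fun h1 => h1 ▸ h.kVV p q j) (fun h1 => h1 j)).trans
      (hVV q j)
  · exact fun q j hj => ((hGSV q).elim (fun h1 => h1 ▸ h.GSV q j hj) (fun h1 => h1 j hj)).trans
      (hVV' q j)
  · exact fun p q j hj => ((hkGSV p q).elim (fun h1 => h1 ▸ h.kGSV p q j hj)
      (fun h1 => h1 j hj)).trans (hVV' q j)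
  · intro m hm
    have : StabMsg s m := (hmsg m hm).elim (h.msg m) id
    cases m
    case gossipVV q p vec => exact fun j => (this j).trans (hVV q j)
    case gossipGSV q p vec => exact fun j hj => (this j hj).trans (hVV' q j)
    all_goals trivial

theorem Stab.of_net (h : Stab s g) (hVV : ∀ p j, (s.srv p).VV j ≤ (s'.srv p).VV j)
    (hinfo : ∀ id c p st, g'.info id = some (c, p, st) →
      g.info id = some (c, p, st) ∨ Safe s st)
    (hcl : ∀ c, (s'.cl c).ust = (s.cl c).ust ∨ Safe s (s'.cl c).ust)
    (hsrv : ∀ p, (s'.srv p).ust = (s.srv p).ust ∨ Safe s (s'.srv p).ust)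
    (hkVV : ∀ p, (s'.srv p).kVV = (s.srv p).kVV)
    (hGSV : ∀ p, (s'.srv p).GSV = (s.srv p).GSV)
    (hkGSV : ∀ p, (s'.srv p).kGSV = (s.srv p).kGSV)
    (hmsg : ∀ m ∈ s'.net, m ∈ s.net ∨ StabMsg s m) : Stab s' g' :=
  h.of_diff hVV hinfo hcl hsrv (fun p q => .inl (congrFun (hkVV p) q)) (fun p => .inl (hGSV p))
    (fun p q => .inl (congrFun (hkGSV p) q)) hmsg

theorem Safe.max {t t' : ℕ} (h : Safe s t) (h' : Safe s t') : Safe s (max t t') :=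
  fun p j hj => max_le (h p j hj) (h' p j hj)

theorem safe_srv_setSrv {p : Server C} {σ : ServerState C} (h : Safe s σ.ust) (p' : Server C) :
    ((s.setSrv p σ).srv p').ust = (s.srv p').ust ∨ Safe s ((s.setSrv p σ).srv p').ust := by
  rw [State.srv_setSrv]
  split_ifs
  · exact .inr h
  · exact .inl rfl

theorem safe_cl_setCl {c : C.Client} {κ : ClientState C} (h : Safe s κ.ust) (c' : C.Client) :
    ((s.setCl c κ).cl c').ust = (s.cl c').ust ∨ Safe s ((s.setCl c κ).cl c').ust := by
  rw [State.cl_setCl]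
  split_ifs
  · exact .inr h
  · exact .inl rfl

theorem Stab.gstep (h : Stab s g) (hctl : Ctl s g) (hent : Ent s g) (hclk : Clk s)
    (hs : GStep s g s' g') (hstep : Step s s') : Stab s' g' := by
  have hVV := hclk.VV_mono hent hstep
  clear hstep
  have hrest : ∀ {m : Msg C} {net : Multiset (Msg C)}, s.net = m ::ₘ net → ∀ m' ∈ net, m' ∈ s.net :=
    fun hm m' hm' => by rw [hm]; exact Multiset.mem_cons_of_mem hm'
  cases hs
  case silent hs hq =>
    cases hs
    case startServe net c p ust id hm hid =>
      have h1 : insert id s.used = s.used := hq.1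
      exact absurd (h1 ▸ Set.mem_insert id s.used) hid
    case startRecv net c p id ust hc hm =>
      obtain ⟨p', h1, h2, -⟩ : MsgOK s g _ := hctl.msg _ (hm ▸ Multiset.mem_cons_self _ _)
      exact h.of_net hVV (fun _ _ _ _ => .inl) (safe_cl_setCl (h.info _ _ _ _ h2))
        (fun _ => .inl rfl) (fun _ => rfl) (fun _ => rfl) (fun _ => rfl)
        (fun m hm' => .inl (hrest hm m hm'))
    case prepare net p q id ust ht D t hlc ust' pt hm _ _ _ _ =>
      have h1 : _ ∈ Msg.prepareResp q p id pt ::ₘ net :=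
        hq.2.2.2 _ (hm ▸ Multiset.mem_cons_self _ _) ⟨id, q.part, rfl⟩
      exact absurd rfl (hctl.noTok_rest hm rfl _ (by simpa using h1))
    case decide p id r pt ct hr hpt hct =>
      have := hq.2.2.1 p id (by simp [hr])
      simp at this
    case sliceServe net p q id χ ust D hm hD =>
      obtain ⟨-, c, h1⟩ : MsgOK s g _ := hctl.msg _ (hm ▸ Multiset.mem_cons_self _ _)
      refine h.of_net hVV (fun _ _ _ _ => .inl) (fun _ => .inl rfl)
        (safe_srv_setSrv ((h.srv q).max (h.info _ _ _ _ h1)))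
        (State.proj_setSrv ServerState.kVV rfl) (State.proj_setSrv ServerState.GSV rfl)
        (State.proj_setSrv ServerState.kGSV rfl) ?_
      intro m hm'
      rcases Multiset.mem_cons.1 hm' with rfl | hm'
      · exact .inr trivial
      · exact .inl (hrest hm m hm')
    case sendVV p =>
      refine h.of_net hVV (fun _ _ _ _ => .inl) (fun _ => .inl rfl) (fun _ => .inl rfl)
        (fun _ => rfl) (fun _ => rfl) (fun _ => rfl) ?_
      intro m hm
      rcases Multiset.mem_add.1 hm with hm | hm
      · exact .inl hm
      · obtain ⟨q, -, rfl⟩ := Multiset.mem_map.1 hm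
        exact .inr fun j => le_rfl
    case sendGSV p =>
      refine h.of_net hVV (fun _ _ _ _ => .inl) (fun _ => .inl rfl) (fun _ => .inl rfl)
        (fun _ => rfl) (fun _ => rfl) (fun _ => rfl) ?_
      intro m hm
      rcases Multiset.mem_add.1 hm with hm | hm
      · exact .inl hm
      · obtain ⟨q, -, rfl⟩ := Multiset.mem_map.1 hm
        exact .inr fun j hj => h.GSV p j hj
    case recvVV net q p vec hm =>
      have h1 : StabMsg s _ := h.msg _ (hm ▸ Multiset.mem_cons_self _ _)
      refine h.of_diff hVV (fun _ _ _ _ => .inl) (fun _ => .inl rfl)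
        (forall_or_of_forall (State.proj_setSrv ServerState.ust rfl)) ?_
        (forall_or_of_forall (State.proj_setSrv ServerState.GSV rfl))
        (apply_eq_or_of_eq (State.proj_setSrv ServerState.kGSV rfl))
        (fun m hm' => .inl (hrest hm m hm'))
      intro p' q'
      rw [State.srv_withNet, State.srv_setSrv]
      split_ifs with hp
      · subst hp
        simp only [Function.update_apply]
        split_ifs with hq
        · subst hq; exact .inr h1
        · exact .inl rfl
      · exact .inl rfl
    case recvGSV net q p vec hm =>
      have h1 : StabMsg s _ := h.msg _ (hm ▸ Multiset.mem_cons_self _ _)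
      refine h.of_diff hVV (fun _ _ _ _ => .inl) (fun _ => .inl rfl)
        (forall_or_of_forall (State.proj_setSrv ServerState.ust rfl))
        (apply_eq_or_of_eq (State.proj_setSrv ServerState.kVV rfl))
        (forall_or_of_forall (State.proj_setSrv ServerState.GSV rfl)) ?_
        (fun m hm' => .inl (hrest hm m hm'))
      intro p' q'
      rw [State.srv_withNet, State.srv_setSrv]
      split_ifs with hp
      · subst hp
        simp only [Function.update_apply]
        split_ifs with hq
        · subst hq; exact .inr h1
        · exact .inl rfl
      · exact .inl rfl
    case computeGSV p =>
      refine h.of_diff hVV (fun _ _ _ _ => .inl) (fun _ => .inl rfl)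
        (forall_or_of_forall (State.proj_setSrv ServerState.ust rfl))
        (apply_eq_or_of_eq (State.proj_setSrv ServerState.kVV rfl)) ?_
        (apply_eq_or_of_eq (State.proj_setSrv ServerState.kGSV rfl))
        (fun m hm => .inl hm)
      intro q
      rw [State.srv_setSrv]
      split_ifs with hp
      · subst hp
        refine .inr fun j hj => ?_
        -- The server `q` belongs to its own data center and replicates a partition stored at `j`,
        -- so its own reported vector is among those minimised.
        refine (Finset.inf_le (b := q) (by simpa using hj)).trans ?_
        exact WithTop.coe_le_coe.2 (h.kVV q q j)
      · exact .inl rfl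
    case computeUST p =>
      refine h.of_net hVV (fun _ _ _ _ => .inl) (fun _ => .inl rfl) (safe_srv_setSrv ?_)
        (State.proj_setSrv ServerState.kVV rfl) (State.proj_setSrv ServerState.GSV rfl)
        (State.proj_setSrv ServerState.kGSV rfl) (fun m hm => .inl hm)
      refine Safe.max (fun q j hj => ?_) (h.srv p)
      -- The universal minimum runs over all pairs of a server and a data center, in particular `(q,
      -- j)`. It is therefore finite and the default value of `untopD` plays no role in this bound.
      have h1 : (s.srv p).minGST ≤ ((s.srv q).VV j : WithTop ℕ) :=
        (Finset.inf_le (b := (q, j)) (Finset.mem_univ _)).trans (h.kGSV p q j hj)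
      obtain ⟨t, ht⟩ := WithTop.ne_top_iff_exists.1 (ne_top_of_le_ne_top WithTop.coe_ne_top h1)
      rw [← ht] at h1 ⊢
      exact WithTop.coe_le_coe.1 h1
    all_goals
      refine h.of_net hVV (fun _ _ _ _ => .inl)
        (by first
          | exact fun _ => .inl rfl
          | exact forall_or_of_forall (State.proj_setCl ClientState.ust rfl))
        (by first
          | exact fun _ => .inl rfl
          | exact forall_or_of_forall (State.proj_setSrv ServerState.ust rfl))
        (by first | exact fun _ => rfl | exact State.proj_setSrv ServerState.kVV rfl)
        (by first | exact fun _ => rfl | exact State.proj_setSrv ServerState.GSV rfl)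
        (by first | exact fun _ => rfl | exact State.proj_setSrv ServerState.kGSV rfl) ?_
      intro m hm'
      first
        | exact .inl hm'
        | exact .inl (hrest (by assumption) m hm')
        | rcases Multiset.mem_cons.1 hm' with rfl | hm'
          · exact .inr trivial
          · exact .inl hm'
        | rcases Multiset.mem_add.1 hm' with hm' | hm'
          · first | exact .inl hm' | exact .inl (hrest (by assumption) m hm')
          · obtain ⟨q, -, rfl⟩ := Multiset.mem_map.1 hm'
            exact .inr trivial
  case startServe net c p ust id hm hid =>
    obtain ⟨-, rfl⟩ : MsgOK s g _ := hctl.msg _ (hm ▸ Multiset.mem_cons_self _ _)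
    have h1 := (h.srv p).max (h.cl c)
    refine h.of_net hVV ?_ (fun _ => .inl rfl) (safe_srv_setSrv h1)
      (State.proj_setSrv ServerState.kVV rfl) (State.proj_setSrv ServerState.GSV rfl)
      (State.proj_setSrv ServerState.kGSV rfl) ?_
    · intro id' c' p' st' hi
      by_cases hid' : id' = id
      · subst hid'
        simp only [Function.update_self, Option.some.injEq, Prod.mk.injEq] at hi
        exact .inr (hi.2.2 ▸ h1)
      · exact .inl (by simpa [hid'] using hi)
    · intro m hm'
      rcases Multiset.mem_cons.1 hm' with rfl | hm'
      · exact .inr trivial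
      · exact .inl (hrest hm m hm')
  case commitSend c p id hc hWS =>
    refine h.of_net hVV (fun _ _ _ _ => .inl)
      (forall_or_of_forall (State.proj_setCl ClientState.ust rfl)) (fun _ => .inl rfl)
      (fun _ => rfl) (fun _ => rfl) (fun _ => rfl) ?_
    intro m hm'
    rcases Multiset.mem_cons.1 hm' with rfl | hm'
    · exact .inr trivial
    · exact .inl hm'
  case prepare net p q id ust ht D t hlc ust' pt hm _ _ hust hpt =>
    obtain ⟨r, c, h', -, -, -, -, h5, -⟩ : MsgOK s g _ :=
      hctl.msg _ (hm ▸ Multiset.mem_cons_self _ _)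
    refine h.of_net hVV (fun _ _ _ _ => .inl) (fun _ => .inl rfl)
      (safe_srv_setSrv (hust ▸ (h.srv q).max (h.info _ _ _ _ h5)))
      (State.proj_setSrv ServerState.kVV rfl) (State.proj_setSrv ServerState.GSV rfl)
      (State.proj_setSrv ServerState.kGSV rfl) ?_
    intro m hm'
    rcases Multiset.mem_cons.1 hm' with rfl | hm'
    · exact .inr trivial
    · exact .inl (hrest hm m hm')
  case commit =>
    refine h.of_net hVV (fun _ _ _ _ => .inl) (fun _ => .inl rfl)
      (forall_or_of_forall (State.proj_setSrv ServerState.ust rfl))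
      (State.proj_setSrv ServerState.kVV rfl) (State.proj_setSrv ServerState.GSV rfl)
      (State.proj_setSrv ServerState.kGSV rfl) ?_
    intro m hm'
    rcases Multiset.mem_cons.1 hm' with rfl | hm'
    · exact .inr trivial
    rcases Multiset.mem_add.1 hm' with hm' | hm'
    · exact .inl hm'
    · obtain ⟨q, -, rfl⟩ := Multiset.mem_map.1 hm'
      exact .inr trivial

/-! ### Oldest active snapshots -/

section Oldest

variable {σ σ' : ServerState C}

theorem ServerState.oldest_le_of_TX {id : TxId} {st : ℕ} (h : σ.TX id = some st) :
    σ.oldest ≤ st := by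
  rw [ServerState.oldest, if_neg fun h' => by simp [h'] at h]
  exact Nat.sInf_le ⟨id, h⟩

theorem ServerState.oldest_le_ust (h : ∀ id st, σ.TX id = some st → st ≤ σ.ust) :
    σ.oldest ≤ σ.ust := by
  by_cases hn : ∀ id, σ.TX id = none
  · rw [ServerState.oldest, if_pos hn]
  · obtain ⟨id, hid⟩ := not_forall.1 hn
    obtain ⟨st, hst⟩ := Option.ne_none_iff_exists'.1 hid
    exact (ServerState.oldest_le_of_TX hst).trans (h _ _ hst)

/-- Ending a transaction can only raise the minimum. A new transaction gets a snapshot of at least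
the stable time, which is never below the oldest active snapshot. A server without active
transactions reports its stable time, which fits the same order. -/
theorem ServerState.oldest_mono (h : ∀ id st, σ.TX id = some st → st ≤ σ.ust)
    (hust : σ.ust ≤ σ'.ust)
    (hTX : ∀ id st, σ'.TX id = some st → σ.TX id = some st ∨ σ.ust ≤ st) :
    σ.oldest ≤ σ'.oldest := by
  by_cases hn : ∀ id, σ'.TX id = none
  · conv_rhs => rw [ServerState.oldest, if_pos hn]
    exact (ServerState.oldest_le_ust h).trans hust
  · conv_rhs => rw [ServerState.oldest, if_neg hn]
    obtain ⟨id, hid⟩ := not_forall.1 hn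
    obtain ⟨st, hst⟩ := Option.ne_none_iff_exists'.1 hid
    obtain ⟨id', hid'⟩ := Nat.sInf_mem (s := {t | ∃ id, σ'.TX id = some t}) ⟨st, id, hst⟩
    rcases hTX _ _ hid' with h1 | h1
    · exact ServerState.oldest_le_of_TX h1
    · exact (ServerState.oldest_le_ust h).trans h1

end Oldest

def OldMsg (s : State C) : Msg C → Prop
  | .gossipOld q _ t => t ≤ (s.srv q).oldest
  | _ => True

/-- Makes gossiped oldest snapshots remain lower bounds for the current ones. The bound `TX_le` is
what orders new snapshots after the old ones. -/
structure Old (s : State C) : Prop where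
  TX_le : ∀ p id st, (s.srv p).TX id = some st → st ≤ (s.srv p).ust
  kOld : ∀ p q, (s.srv p).kOld q ≤ (s.srv q).oldest
  msg : ∀ m ∈ s.net, OldMsg s m

theorem Step.ust_le (hs : Step s s') : ∀ p, (s.srv p).ust ≤ (s'.srv p).ust := by
  cases hs
  case startServe | sliceServe =>
    intro p'
    dsimp only [State.srv_withNet]
    rw [State.srv_setSrv]
    split_ifs with hp
    · subst hp; exact le_max_left _ _
    · exact le_rfl
  case prepare hust _ =>
    intro p'
    rw [State.srv_withNet, State.srv_setSrv]
    split_ifs with hp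
    · subst hp; subst hust; exact le_max_left _ _
    · exact le_rfl
  case computeUST =>
    intro p'
    rw [State.srv_setSrv]
    split_ifs with hp
    · subst hp; exact le_max_right _ _
    · exact le_rfl
  all_goals
    refine fun p => Eq.le (Eq.symm ?_)
    revert p
    first
    | exact fun _ => rfl
    | exact State.proj_setSrv ServerState.ust rfl

theorem TX_eq_some_of_eq (h : ∀ p, (s'.srv p).TX = (s.srv p).TX) :
    ∀ p id st, (s'.srv p).TX id = some st →
      (s.srv p).TX id = some st ∨ (s.srv p).ust ≤ st ∧ st ≤ (s'.srv p).ust :=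
  fun p id st h' => .inl (by rwa [h p] at h')

theorem Step.TX_eq_some (hs : Step s s') : ∀ p id st, (s'.srv p).TX id = some st →
    (s.srv p).TX id = some st ∨ (s.srv p).ust ≤ st ∧ st ≤ (s'.srv p).ust := by
  cases hs
  case startServe net c p ust id hm hid =>
    intro p' id' st
    dsimp only
    rw [State.srv_setSrv]
    split_ifs with hp
    · subst hp
      simp only [Function.update_apply]
      split_ifs with hid'
      · rintro ⟨rfl⟩
        exact .inr ⟨le_max_left _ _, le_rfl⟩
      · exact .inl
    · exact .inl
  case decide p id r pt ct hr hpt hct =>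
    intro p' id' st
    dsimp only
    rw [State.srv_setSrv]
    split_ifs with hp
    · subst hp
      simp only [Function.update_apply]
      split_ifs with hid'
      · simp
      · exact .inl
    · exact .inl
  all_goals
    refine TX_eq_some_of_eq ?_
    first
    | exact fun _ => rfl
    | exact State.proj_setSrv ServerState.TX rfl

theorem Old.oldest_le (h : Old s) (hs : Step s s') (p : Server C) :
    (s.srv p).oldest ≤ (s'.srv p).oldest :=
  ServerState.oldest_mono (h.TX_le p) (hs.ust_le p)
    fun id st h1 => (hs.TX_eq_some p id st h1).imp_right And.left

theorem Old.step (h : Old s) (hs : Step s s') : Old s' := by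
  have hle := h.oldest_le hs
  have htx : ∀ p id st, (s'.srv p).TX id = some st → st ≤ (s'.srv p).ust := fun p id st h1 =>
    (hs.TX_eq_some p id st h1).elim (fun h2 => (h.TX_le p id st h2).trans (hs.ust_le p)) And.right
  have key : (∀ p q, (s'.srv p).kOld q = (s.srv p).kOld q ∨ (s'.srv p).kOld q ≤ (s.srv q).oldest) →
      (∀ m ∈ s'.net, m ∈ s.net ∨ OldMsg s m) → Old s' := by
    intro h1 h2
    refine ⟨htx, fun p q => ?_, fun m hm => ?_⟩
    · exact ((h1 p q).elim (fun h3 => h3 ▸ h.kOld p q) id).trans (hle q)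
    · have h3 : OldMsg s m := (h2 m hm).elim (h.msg m) id
      cases m
      case gossipOld q p t => exact le_trans h3 (hle q)
      all_goals trivial
  have hrest : ∀ {m : Msg C} {net : Multiset (Msg C)}, s.net = m ::ₘ net → ∀ m' ∈ net, m' ∈ s.net :=
    fun hm m' hm' => by rw [hm]; exact Multiset.mem_cons_of_mem hm'
  clear hle htx
  cases hs
  case sendOld p =>
    refine key (fun _ _ => .inl rfl) ?_
    intro m hm
    rcases Multiset.mem_add.1 hm with hm | hm
    · exact .inl hm
    · obtain ⟨q, -, rfl⟩ := Multiset.mem_map.1 hm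
      exact .inr (le_refl (s.srv p).oldest)
  case recvOld net q p t hm =>
    have h1 : OldMsg s _ := h.msg _ (hm ▸ Multiset.mem_cons_self _ _)
    refine key ?_ (fun m hm' => .inl (hrest hm m hm'))
    intro p' q'
    rw [State.srv_withNet, State.srv_setSrv]
    split_ifs with hp
    · subst hp
      simp only [Function.update_apply]
      split_ifs with hq
      · subst hq; exact .inr h1
      · exact .inl rfl
    · exact .inl rfl
  all_goals
    refine key (apply_eq_or_of_eq ?_) ?_
    · first
      | exact fun _ => rfl
      | exact State.proj_setSrv ServerState.kOld rfl
    · intro m hm'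
      first
        | exact .inl hm'
        | exact .inl (hrest (by assumption) m hm')
        | (rcases Multiset.mem_cons.1 hm' with rfl | hm'
           · exact .inr trivial
           · first
               | exact .inl hm'
               | exact .inl (hrest (by assumption) m hm')
               | (rcases Multiset.mem_add.1 hm' with hm' | hm'
                  · exact .inl hm'
                  · obtain ⟨q, -, rfl⟩ := Multiset.mem_map.1 hm'
                    exact .inr trivial))
        | (rcases Multiset.mem_add.1 hm' with hm' | hm'
           · first | exact .inl hm' | exact .inl (hrest (by assumption) m hm')
           · obtain ⟨q, -, rfl⟩ := Multiset.mem_map.1 hm'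
             exact .inr trivial)

/-! ### Propagation of committed writes -/

/-- The server `p` stores `d`, or a fresher item that every active snapshot contains. -/
def Covered (s : State C) (p : Server C) (d : Item C) : Prop :=
  ∃ d' ∈ (s.srv p).store, d'.key = d.key ∧ d.rank ≤ d'.rank ∧
    (d' = d ∨ ∀ q, d'.ut ≤ (s.srv q).oldest)

theorem Covered.of_mem {p : Server C} {d : Item C} (h : d ∈ (s.srv p).store) : Covered s p d :=
  ⟨d, h, rfl, le_rfl, .inl rfl⟩

theorem Covered.mono {p : Server C} {d : Item C} (h : Covered s p d)
    (hst : (s.srv p).store ⊆ (s'.srv p).store)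
    (hold : ∀ q, (s.srv q).oldest ≤ (s'.srv q).oldest) : Covered s' p d := by
  obtain ⟨d', h1, h2, h3, h4⟩ := h
  exact ⟨d', hst h1, h2, h3, h4.imp_right fun h5 q => (h5 q).trans (hold q)⟩

/-- The entry `e` of the cohort `q` is committed there, or on its way to `p`, or has arrived. -/
def Stage (s : State C) (q : Server C) (e : Entry C) (p : Server C) : Prop :=
  e ∈ (s.srv q).committed ∨ (∃ T, .replicate T e.ts ∈ s.repl q p ∧ e ∈ T) ∨
    ∀ d ∈ itemsOf {e} q.dc, Covered s p d

/-- No write is lost. From its proposal on, the slice of a transaction at a cohort is prepared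
there; after the commit decision it may still be prepared or be followed separately to every replica
of the partition. Arrival is expressed by `Covered` rather than by membership in the store, since
garbage collection may remove items. -/
def Loc (s : State C) (g : Ghost C) : Prop :=
  ∀ id (q : Server C) pt W h, g.prop id q.part = some (q, pt) → g.fin id = some (W, h) →
    ⟨id, pt, W.slice q.part⟩ ∈ (s.srv q).prepared ∨
      ∃ t, g.ct id = some t ∧ ∀ p : Server C, p.part = q.part →
        Stage s q ⟨id, t, W.slice q.part⟩ p

/-- Each hypothesis describes one permitted advance along the path of a write: prepared to
committed, committed to the later stages, channel to covered. -/
theorem Loc.of_diff (h : Loc s g) (hctl : Ctl s g) (hle : g.Le g')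
    (hprop : ∀ id (q : Server C) pt, g'.prop id q.part = some (q, pt) →
      g.prop id q.part = some (q, pt) ∨
        ∀ W h, g'.fin id = some (W, h) → ⟨id, pt, W.slice q.part⟩ ∈ (s'.srv q).prepared)
    (hprep : ∀ q, ∀ e ∈ (s.srv q).prepared, e ∈ (s'.srv q).prepared ∨
      ∃ t, g'.ct e.id = some t ∧ ⟨e.id, t, e.D⟩ ∈ (s'.srv q).committed)
    (hcomm : ∀ q, ∀ e ∈ (s.srv q).committed, e ∈ (s'.srv q).committed ∨
      ∀ p : Server C, p.part = q.part → Stage s' q e p)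
    (hrepl : ∀ q p T t, p.part = q.part → .replicate T t ∈ s.repl q p →
      .replicate T t ∈ s'.repl q p ∨ ∀ e ∈ T, ∀ d ∈ itemsOf {e} q.dc, Covered s' p d)
    (hcov : ∀ p d, Covered s p d → Covered s' p d) : Loc s' g' := by
  intro id q pt W h' hp hf
  rcases hprop id q pt hp with h1 | h1
  · obtain ⟨-, W', h'', -, -, -, h2, -⟩ := hctl.prop _ _ _ _ h1
    obtain ⟨rfl, rfl⟩ : W' = W ∧ h'' = h' := by
      have := hle.fin _ _ h2
      rw [hf] at this
      cases this; exact ⟨rfl, rfl⟩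
    rcases h id q pt W' h'' h1 h2 with h3 | ⟨t, h3, h4⟩
    · rcases hprep q _ h3 with h4 | ⟨t, h4, h5⟩
      · exact .inl h4
      · exact .inr ⟨t, h4, fun p hpq => .inl h5⟩
    · refine .inr ⟨t, hle.ct _ _ h3, fun p hpq => ?_⟩
      rcases h4 p hpq with h5 | ⟨T, h5, h6⟩ | h5
      · rcases hcomm q _ h5 with h6 | h6
        · exact .inl h6
        · exact h6 p hpq
      · rcases hrepl q p T t hpq h5 with h7 | h7
        · exact .inr (.inl ⟨T, h7, h6⟩)
        · exact .inr (.inr (h7 _ h6))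
      · exact .inr (.inr fun d hd => hcov p d (h5 d hd))
  · exact .inl (h1 W h' hf)

theorem mem_itemsOf_of_mem {T : Set (Entry C)} {e : Entry C} (he : e ∈ T) {m : Fin C.M} {d : Item C}
    (hd : d ∈ itemsOf {e} m) : d ∈ itemsOf T m := by
  obtain ⟨h1, e', rfl, h2⟩ := hd
  exact ⟨h1, _, he, h2⟩

/-- If the covering item is dropped, there is a fresher stored item of the key with timestamp at
most `t`. One of maximal rank among those cannot be dropped, and it takes over: its timestamp is at
most `t`, hence below every active snapshot. -/
theorem Covered.collect {p : Server C} {t : ℕ} {d : Item C} (h : Covered s p d)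
    (hfin : ((fun d : Item C => d.tx) '' (s.srv p).store).Finite)
    (hst : (s'.srv p).store = PaRiS.collect (s.srv p).store t)
    (ht : ∀ q, t ≤ (s'.srv q).oldest)
    (hold : ∀ q, (s.srv q).oldest ≤ (s'.srv q).oldest) : Covered s' p d := by
  obtain ⟨d', h1, h2, h3, h4⟩ := h
  by_cases hk : d' ∈ PaRiS.collect (s.srv p).store t
  · exact ⟨d', hst ▸ hk, h2, h3, h4.imp_right fun h5 q => (h5 q).trans (hold q)⟩
  have hk' : ∃ d'' ∈ (s.srv p).store, d''.key = d'.key ∧ d''.ut ≤ t ∧ d'.rank < d''.rank := by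
    by_contra hne
    exact hk ⟨h1, hne⟩
  obtain ⟨d'', k1, k2, k3, k4⟩ := hk'
  let B : Set (Item C) := {x ∈ (s.srv p).store | x.key = d.key ∧ x.ut ≤ t}
  -- Stores are arbitrary sets, so existence of a maximum needs an argument: a rank consists of a
  -- timestamp up to `t`, one of finitely many stored transaction identifiers, and a data center.
  have hB : (Item.rank '' B).Finite := by
    have hfin' : (Set.image2 (fun a b => toLex (a, b)) (Set.Iic t)
        (Set.image2 (fun a b => toLex (a, b)) ((fun d : Item C => d.tx) '' (s.srv p).store)
          (Set.univ : Set (Fin C.M))) : Set (ℕ ×ₗ (ℕ ×ₗ Fin C.M))).Finite :=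
      (Set.finite_Iic t).image2 _ (hfin.image2 _ Set.finite_univ)
    refine hfin'.subset ?_
    rintro _ ⟨x, hx, rfl⟩
    exact ⟨x.ut, hx.2.2, _, ⟨x.tx, ⟨x, hx.1, rfl⟩, x.sr, trivial, rfl⟩, rfl⟩
  obtain ⟨_, ⟨x, hx, rfl⟩, hmax⟩ := Set.exists_max_image (Item.rank '' B) id hB
    ⟨_, d'', ⟨k1, k2.trans h2, k3⟩, rfl⟩
  refine ⟨x, ?_, hx.2.1, ?_, .inr fun q => hx.2.2.trans (ht q)⟩
  · rw [hst]
    refine ⟨hx.1, ?_⟩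
    rintro ⟨y, y1, y2, y3, y4⟩
    exact absurd (hmax _ ⟨y, ⟨y1, y2.trans hx.2.1, y3⟩, rfl⟩) (not_le_of_gt y4)
  · exact h3.trans (k4.le.trans (hmax _ ⟨d'', ⟨k1, k2.trans h2, k3⟩, rfl⟩))

theorem Loc.of_eq (h : Loc s g) (hctl : Ctl s g) (hle : g.Le g')
    (hold : ∀ q, (s.srv q).oldest ≤ (s'.srv q).oldest) (hprop : g'.prop = g.prop)
    (hp : ∀ q, (s'.srv q).prepared = (s.srv q).prepared)
    (hc : ∀ q, (s'.srv q).committed = (s.srv q).committed)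
    (hst : ∀ q, (s'.srv q).store = (s.srv q).store) (hr : s'.repl = s.repl) : Loc s' g' := by
  refine h.of_diff hctl hle ?_ ?_ ?_ ?_ ?_
  · exact fun _ _ _ h1 => .inl (hprop ▸ h1)
  · exact fun q e he => .inl (by rwa [hp])
  · exact fun q e he => .inl (by rwa [hc])
  · exact fun q p T t _ hm => .inl (by rwa [hr])
  · exact fun p d hd => hd.mono (hst p).ge hold

/-- Only finitely many identifiers have been generated; this supplies the maximum needed for garbage
collection. -/
theorem Ent.finite_store_tx (h : Ent s g) (hctl : Ctl s g) (p : Server C) :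
    ((fun d : Item C => d.tx) '' (s.srv p).store).Finite := by
  refine hctl.used_finite.subset ?_
  rintro _ ⟨d, hd, rfl⟩
  obtain ⟨-, -, W, h', h1, -⟩ := h.store p d hd
  exact (hctl.used _).2 (hctl.fin _ _ _ h1).1

theorem sOld_le (h : Old s) (p q : Server C) : (s.srv p).sOld p ≤ (s.srv q).oldest :=
  (Finset.inf'_le _ (Finset.mem_univ q)).trans (h.kOld p q)

theorem State.subset_proj_setSrv {α : Type*} (f : ServerState C → Set α) {p : Server C}
    {σ : ServerState C} (h : f (s.srv p) ⊆ f σ) (p' : Server C) :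
    f (s.srv p') ⊆ f ((s.setSrv p σ).srv p') := by
  rw [State.srv_setSrv]
  split_ifs with hp
  · rw [hp]; exact h
  · exact subset_rfl

theorem Loc.gstep (h : Loc s g) (hctl : Ctl s g) (hent : Ent s g) (hold : Old s)
    (hs : GStep s g s' g') (hstep : Step s s') : Loc s' g' := by
  have hle := hs.le hctl
  have hmono := hold.oldest_le hstep
  clear hstep
  cases hs
  case silent hs hq =>
    cases hs
    case prepare net p q id ust ht D t hlc ust' pt hm _ _ _ _ =>
      have h1 : _ ∈ Msg.prepareResp q p id pt ::ₘ net :=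
        hq.2.2.2 _ (hm ▸ Multiset.mem_cons_self _ _) ⟨id, q.part, rfl⟩
      exact absurd rfl (hctl.noTok_rest hm rfl _ (by simpa using h1))
    case cohortCommit net p q id ct t e hm hclk he hid =>
      obtain ⟨h1, -⟩ : MsgOK s g _ := hctl.msg _ (hm ▸ Multiset.mem_cons_self _ _)
      refine h.of_diff hctl hle (fun _ _ _ => .inl) ?_ ?_ (fun _ _ _ _ _ => .inl) ?_
      · intro q' e' he'
        rw [State.srv_withNet, State.srv_setSrv]
        split_ifs with hq
        · subst hq
          by_cases hee : e' = e
          · subst hee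
            exact .inr ⟨ct, hid ▸ h1, by rw [hid]; exact Set.mem_insert _ _⟩
          · exact .inl ⟨he', hee⟩
        · exact .inl he'
      · refine fun q' e' he' => .inl ?_
        revert he' e'
        revert q'
        exact State.subset_proj_setSrv ServerState.committed (Set.subset_insert _ _)
      · refine fun p d hd => hd.mono ?_ hmono
        clear hd
        revert p
        exact State.subset_proj_setSrv ServerState.store subset_rfl
    case apply p t ub cts hclk hub hne hsorted hcts =>
      have hst : ∀ p', (s.srv p').store ⊆ (((s.setSrv p { s.srv p with
            clk := t
            store := (s.srv p).store ∪ itemsOf {e ∈ (s.srv p).committed | e.ts ≤ ub} p.dc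
            committed := {e ∈ (s.srv p).committed | ub < e.ts}
            VV := Function.update (s.srv p).VV p.dc ub }).sendRepl p
          (cts.map (fun ct => .replicate {e ∈ (s.srv p).committed | e.ts = ct} ct))).srv
            p').store :=
        State.subset_proj_setSrv ServerState.store Set.subset_union_left
      refine h.of_diff hctl hle (fun _ _ _ => .inl) ?_ ?_ ?_ ?_
      · refine fun q' e' he' => .inl ?_
        revert he' e'
        revert q'
        exact State.subset_proj_setSrv ServerState.prepared subset_rfl
      · intro q' e' he'
        by_cases hq : q' = p
        swap
        · refine .inl ?_
          rw [State.srv_sendRepl, State.srv_setSrv_ne _ _ hq]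
          exact he'
        subst hq
        -- Above the bound the entry stays committed. Otherwise it enters the store of `q'` itself
        -- and is appended to the channels to the other replicas, in the message for its timestamp.
        by_cases hub' : ub < e'.ts
        · refine .inl ?_
          rw [State.srv_sendRepl, State.srv_setSrv_self]
          exact ⟨he', hub'⟩
        refine .inr fun p' hp' => .inr ?_
        by_cases hpp : p' = q'
        · subst hpp
          refine .inr fun d hd => .of_mem ?_
          rw [State.srv_sendRepl, State.srv_setSrv_self]
          exact .inr (mem_itemsOf_of_mem (T := {e ∈ (s.srv p').committed | e.ts ≤ ub})
            ⟨he', not_lt.1 hub'⟩ hd)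
        · refine .inl ⟨{e ∈ (s.srv q').committed | e.ts = e'.ts}, ?_, ⟨he', rfl⟩⟩
          rw [State.repl_sendRepl, if_pos ⟨rfl, hp', hpp⟩]
          exact List.mem_append_right _ (List.mem_map.2
            ⟨e'.ts, (hcts _).2 ⟨not_lt.1 hub', e', he', rfl⟩, rfl⟩)
      · intro q' p' T t' _ hm
        refine .inl ?_
        rw [State.repl_sendRepl]
        split_ifs
        · exact List.mem_append_left _ hm
        · exact hm
      · exact fun p d hd => hd.mono (hst p) hmono
    case heartbeat p t ub hclk hub hne =>
      refine h.of_diff hctl hle (fun _ _ _ => .inl) ?_ ?_ ?_ ?_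
      · refine fun q' e' he' => .inl ?_
        revert he' e'
        revert q'
        exact State.subset_proj_setSrv ServerState.prepared subset_rfl
      · refine fun q' e' he' => .inl ?_
        revert he' e'
        revert q'
        exact State.subset_proj_setSrv ServerState.committed subset_rfl
      · intro q' p' T t' _ hm
        refine .inl ?_
        rw [State.repl_sendRepl]
        split_ifs
        · exact List.mem_append_left _ hm
        · exact hm
      · refine fun p d hd => hd.mono ?_ hmono
        clear hd
        revert p
        exact State.subset_proj_setSrv ServerState.store subset_rfl
    case replRecv q p T ct l hm =>
      refine h.of_diff hctl hle (fun _ _ _ => .inl) ?_ ?_ ?_ ?_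
      · refine fun q' e' he' => .inl ?_
        revert he' e'
        revert q'
        exact State.subset_proj_setSrv ServerState.prepared subset_rfl
      · refine fun q' e' he' => .inl ?_
        revert he' e'
        revert q'
        exact State.subset_proj_setSrv ServerState.committed subset_rfl
      · intro q' p' T' t' _ hm'
        rw [State.repl_setRepl]
        split_ifs with hqp
        · obtain ⟨rfl, rfl⟩ := hqp
          rw [hm] at hm'
          rcases List.mem_cons.1 hm' with heq | hl
          · cases heq
            refine .inr fun e he d hd => .of_mem ?_
            rw [State.srv_setRepl, State.srv_setSrv_self]
            exact .inr (mem_itemsOf_of_mem he hd)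
          · exact .inl hl
        · exact .inl hm'
      · refine fun p d hd => hd.mono ?_ hmono
        clear hd
        revert p
        exact State.subset_proj_setSrv ServerState.store fun _ => Or.inl
    case heartbeatRecv q p t l hm =>
      refine h.of_diff hctl hle (fun _ _ _ => .inl) ?_ ?_ ?_ ?_
      · refine fun q' e' he' => .inl ?_
        revert he' e'
        revert q'
        exact State.subset_proj_setSrv ServerState.prepared subset_rfl
      · refine fun q' e' he' => .inl ?_
        revert he' e'
        revert q'
        exact State.subset_proj_setSrv ServerState.committed subset_rfl
      · intro q' p' T' t' _ hm'
        rw [State.repl_setRepl]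
        split_ifs with hqp
        · obtain ⟨rfl, rfl⟩ := hqp
          rw [hm] at hm'
          exact .inl (by simpa using hm')
        · exact .inl hm'
      · refine fun p d hd => hd.mono ?_ hmono
        clear hd
        revert p
        exact State.subset_proj_setSrv ServerState.store subset_rfl
    case garbageCollect p =>
      refine h.of_diff hctl hle (fun _ _ _ => .inl) ?_ ?_ (fun _ _ _ _ _ => .inl) ?_
      · refine fun q' e' he' => .inl ?_
        revert he' e'
        revert q'
        exact State.subset_proj_setSrv ServerState.prepared subset_rfl
      · refine fun q' e' he' => .inl ?_
        revert he' e'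
        revert q'
        exact State.subset_proj_setSrv ServerState.committed subset_rfl
      · intro p' d hd
        by_cases hp : p' = p
        · subst hp
          refine hd.collect (hent.finite_store_tx hctl p') (t := (s.srv p').sOld p') ?_
            (fun q => (sOld_le hold p' q).trans (hmono q)) hmono
          rw [State.srv_setSrv_self]
        · refine hd.mono ?_ hmono
          rw [State.srv_setSrv_ne _ _ hp]
    all_goals first
      | exact h.of_eq hctl hle hmono rfl (fun _ => rfl) (fun _ => rfl) (fun _ => rfl) rfl
      | exact h.of_eq hctl hle hmono rfl (State.proj_setSrv ServerState.prepared rfl)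
          (State.proj_setSrv ServerState.committed rfl) (State.proj_setSrv ServerState.store rfl) rfl
  case prepare net p q id ust ht D t hlc ust' pt hm h1 h2 h3 h4 =>
    obtain ⟨r, c, h', h1, h2, h3, h4, h5, h6, h7, -⟩ : MsgOK s g _ :=
      hctl.msg _ (hm ▸ Multiset.mem_cons_self _ _)
    refine h.of_diff hctl hle ?_ ?_ ?_ (fun _ _ _ _ _ => .inl) ?_
    · intro id' q' pt' hp
      by_cases hid : id' = id
      · subst hid
        by_cases hq : q'.part = q.part
        · rw [hq] at hp
          simp only [Function.update_self, Option.some.injEq, Prod.mk.injEq] at hp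
          obtain ⟨rfl, rfl⟩ := hp
          refine .inr fun W h'' hf => ?_
          rw [State.srv_withNet, State.srv_setSrv_self]
          obtain rfl : r.WS = W := by
            have : g.fin id' = some (W, h'') := hf
            rw [h6] at this
            cases this; rfl
          exact .inl (by rw [h7])
        · exact .inl (by simpa [hq] using hp)
      · exact .inl (by simpa [hid] using hp)
    · refine fun q' e' he' => .inl ?_
      revert he' e'
      revert q'
      exact State.subset_proj_setSrv ServerState.prepared (Set.subset_insert _ _)
    · refine fun q' e' he' => .inl ?_
      revert he' e'
      revert q'
      exact State.subset_proj_setSrv ServerState.committed subset_rfl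
    · refine fun p d hd => hd.mono ?_ hmono
      clear hd
      revert p
      exact State.subset_proj_setSrv ServerState.store subset_rfl
  case commitSend =>
    exact h.of_eq hctl hle hmono rfl (fun _ => rfl) (fun _ => rfl) (fun _ => rfl) rfl
  all_goals
    exact h.of_eq hctl hle hmono rfl (State.proj_setSrv ServerState.prepared rfl)
      (State.proj_setSrv ServerState.committed rfl) (State.proj_setSrv ServerState.store rfl) rfl

/-! ### Stable snapshots -/

/-- The final write set is a function, so a transaction gives each key one value. This is why
transaction identifiers suffice to break ties between versions of a key. -/
theorem Ctl.version_unique (h : Ctl s g) {X Y : Version C} (hX : X ∈ s.versions)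
    (hY : Y ∈ s.versions) (hkey : X.key = Y.key) (htx : X.tx = Y.tx) : X = Y := by
  obtain ⟨h1, W, h', h2, h3⟩ := (h.versions X).1 hX
  obtain ⟨h1', W', h'', h2', h3'⟩ := (h.versions Y).1 hY
  rw [htx, h1'] at h1
  rw [htx, h2'] at h2
  cases h2
  rw [hkey, h3'] at h3
  exact Version.ext hkey (Option.some.inj h3).symm (Option.some.inj h1).symm htx

theorem GStep.versions_subset (hs : GStep s g s' g') : s.versions ⊆ s'.versions := by
  cases hs
  case silent hs hq =>
    cases hs
    case decide => exact Set.subset_union_left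
    all_goals exact subset_rfl
  case commit => exact Set.subset_union_left
  all_goals exact subset_rfl

/-- Before the decision there is no commit timestamp, so by `Loc` the cohort for the key still has
the transaction prepared. Its own entry, which bounds every safe timestamp, is strictly below its
proposal, and the commit timestamp is at least that proposal. -/
theorem GStep.lt_of_new_version (hs : GStep s g s' g') (hctl : Ctl s g) (hclk : Clk s)
    (hloc : Loc s g) {X : Version C} (hX : X ∈ s'.versions) :
    X ∈ s.versions ∨ ∀ t, Safe s t → t < X.ut := by
  cases hs
  case silent hs hq =>
    cases hs
    case decide p id r pt ct hr hpt hct =>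
      have := hq.2.2.1 p id (by simp [hr])
      simp at this
    all_goals exact .inl hX
  case commit p id r pt ct hr hpt hct =>
    rcases hX with hX | ⟨hid, hut, hval⟩
    · exact .inl hX
    refine .inr fun t ht => ?_
    have hok := hctl.commits p id r hr
    obtain ⟨h, hfin⟩ := hok.fin
    have hi : C.part X.key ∈ r.parts := by
      rw [hok.parts, WSet.parts]
      simp only [Finset.mem_filter, Finset.mem_univ, true_and]
      exact ⟨X.key, rfl, by simp [hval]⟩
    obtain ⟨q, hq⟩ := hok.resp _ _ (hpt _ hi)
    obtain ⟨hqi, -⟩ := hctl.prop _ _ _ _ hq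
    rw [← hqi] at hq hi
    have hle : pt q.part ≤ ct := hct ▸ Finset.le_sup (f := pt) hi
    rcases hloc _ _ _ _ _ hq hfin with h1 | ⟨t', h1, -⟩
    · have h2 := hclk.VV_lt_prepared q _ h1
      have h3 := ht.own q
      have h4 : (s.srv q).VV q.dc < pt q.part := h2
      omega
    · rw [hok.ct] at h1
      cases h1
  all_goals exact .inl hX

/-- Safety of `st` excludes every stage before arrival. A prepared or unapplied entry would be
strictly above the cohort's own version vector entry, and one in the channel strictly above the
receiver's entry for the cohort; but both entries are at least `st`, and the version is not above
`st`. -/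
theorem covered_of_version (hctl : Ctl s g) (hclk : Clk s) (hloc : Loc s g)
    {X : Version C} {st : ℕ} (hX : X ∈ s.versions) (hst : Safe s st) (hut : X.ut ≤ st)
    {p : Server C} (hp : p.part = C.part X.key) : ∃ m, Covered s p ⟨X, m⟩ := by
  obtain ⟨h1, W, h, h2, h3⟩ := (hctl.versions X).1 hX
  obtain ⟨W', h', h2', h4⟩ := hctl.ct _ _ h1
  obtain rfl : W = W' := by rw [h2] at h2'; cases h2'; rfl
  obtain ⟨q, pt, hq, hpt⟩ := h4 (C.part X.key) (by
    rw [WSet.parts]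
    simp only [Finset.mem_filter, Finset.mem_univ, true_and]
    exact ⟨X.key, rfl, by simp [h3]⟩)
  obtain ⟨hqi, -⟩ := hctl.prop _ _ _ _ hq
  rw [← hqi] at hq
  have hpq : p.part = q.part := hp.trans hqi.symm
  have hown := hst.own q
  rcases hloc _ _ _ _ _ hq h2 with h5 | ⟨t, h5, h6⟩
  · have h6 : (s.srv q).VV q.dc < pt := hclk.VV_lt_prepared q _ h5
    omega
  obtain rfl : X.ut = t := by rw [h1] at h5; cases h5; rfl
  rcases h6 p hpq with h7 | ⟨T, h7, h8⟩ | h7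
  · have h6 : (s.srv q).VV q.dc < X.ut := hclk.VV_lt_committed q _ h7
    omega
  · have h9 := (hclk.chan q p hpq).lt_of_mem h7
    have h10 := hst p q.dc (hpq ▸ q.2)
    have h11 : (s.srv p).VV q.dc < X.ut := h9
    omega
  · exact ⟨q.dc, h7 _ ⟨rfl, _, rfl, rfl, rfl, WSet.slice_eq_some.2 ⟨hqi.symm, h3⟩⟩⟩

theorem Item.toVersion_rank_le {d d' : Item C} (h : d.rank ≤ d'.rank) :
    d.toVersion.rank ≤ d'.toVersion.rank := by
  rw [Item.rank, Item.rank, Prod.Lex.le_iff] at h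
  rw [Version.rank, Version.rank, Prod.Lex.le_iff]
  rcases h with h | ⟨h1, h2⟩
  · exact .inl h
  · refine .inr ⟨h1, ?_⟩
    rcases Prod.Lex.le_iff.1 h2 with h3 | ⟨h3, -⟩
    · exact h3.le
    · exact h3.le

/-- A replica shows the freshest stable versions. -/
theorem isFreshest_stablePart (hctl : Ctl s g) (hent : Ent s g) (hclk : Clk s) (hloc : Loc s g)
    {st : ℕ} (hst : Safe s st) {q : Server C} (hq : (s.srv q).oldest ≤ st) {p : Server C}
    {k : C.Key} (hp : p.part = C.part k) {o : Option (Item C)}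
    (ho : IsFreshest Item.rank {d ∈ (s.srv p).store | d.key = k ∧ d.ut ≤ st} o) :
    IsFreshest Version.rank {X ∈ stablePart s st | X.key = k} (o.map Item.toVersion) := by
  have key : ∀ X ∈ stablePart s st, X.key = k →
      ∃ d ∈ {d ∈ (s.srv p).store | d.key = k ∧ d.ut ≤ st}, X.rank ≤ d.toVersion.rank := by
    rintro X ⟨hX, hut⟩ hk
    obtain ⟨m, d, h1, h2, h3, h4⟩ := covered_of_version hctl hclk hloc hX hst hut (hk ▸ hp)
    refine ⟨d, ⟨h1, h2.trans hk, ?_⟩, Item.toVersion_rank_le h3⟩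
    -- A replacing item is below the oldest snapshot of every server, in particular of `q`, and thus
    -- inside the snapshot `st`.
    rcases h4 with rfl | h4
    · exact hut
    · exact (h4 q).trans hq
  cases o with
  | none =>
    refine Set.eq_empty_of_forall_notMem fun X hX => ?_
    obtain ⟨d, hd, -⟩ := key X hX.1 hX.2
    exact (Set.eq_empty_iff_forall_notMem.1 ho) d hd
  | some d =>
    obtain ⟨⟨h1, h2, h3⟩, h4⟩ := ho
    refine ⟨⟨⟨hctl.mem_versions (hent.store p d h1), h3⟩, h2⟩, fun X hX => ?_⟩
    obtain ⟨d', hd', hle⟩ := key X hX.1 hX.2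
    exact hle.trans (Item.toVersion_rank_le (h4 d' hd'))

/-- The freezing of stable snapshots: versions that appear later lie above every timestamp that is
already safe. -/
theorem GStep.stablePart_eq (hs : GStep s g s' g') (hctl : Ctl s g) (hclk : Clk s)
    (hloc : Loc s g) {st : ℕ} (hst : Safe s st) : stablePart s' st = stablePart s st := by
  ext X
  constructor
  · rintro ⟨h1, h2⟩
    rcases hs.lt_of_new_version hctl hclk hloc h1 with h3 | h3
    · exact ⟨h3, h2⟩
    · exact absurd h2 (not_le_of_gt (h3 st hst))
  · exact fun h => ⟨hs.versions_subset h.1, h.2⟩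

/-! ### Write sets and the history -/

theorem bufferedWrites_append (h : List (Op C)) (o : Op C) (id : TxId) :
    bufferedWrites (h ++ [o]) id = match o with
      | .write _ id' kvs => if id' = id then writeAll (bufferedWrites h id) kvs
        else bufferedWrites h id
      | _ => bufferedWrites h id := by
  cases o <;> exact List.foldl_append

theorem bufferedWrites_append_of_ne (h : List (Op C)) (o : Op C) {id : TxId} (ho : o.tx ≠ id) :
    bufferedWrites (h ++ [o]) id = bufferedWrites h id := by
  rw [bufferedWrites_append]
  cases o
  case write c id' kvs => exact if_neg ho
  all_goals rfl

theorem bufferedWrites_append_write (h : List (Op C)) (c : C.Client) (id : TxId)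
    (kvs : List (C.Key × C.Val)) : bufferedWrites (h ++ [.write c id kvs]) id =
      writeAll (bufferedWrites h id) kvs := by
  rw [bufferedWrites_append]
  exact if_pos rfl

theorem bufferedWrites_of_forall_ne {h : List (Op C)} {id : TxId} (hh : ∀ o ∈ h, o.tx ≠ id) :
    bufferedWrites h id = fun _ => none := by
  induction h using List.reverseRecOn with
  | nil => rfl
  | append_singleton l o ih =>
    rw [bufferedWrites_append_of_ne _ _ (hh o (by simp))]
    exact ih fun o' ho' => hh o' (by simp [ho'])

open Classical in
theorem writeAll_ne_none_of_ne_none {ws : WSet C} (kvs : List (C.Key × C.Val)) {k : C.Key}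
    (h : ws k ≠ none) : writeAll ws kvs k ≠ none := by
  induction kvs generalizing ws with
  | nil => exact h
  | cons kv kvs ih =>
    refine ih (ws := Function.update ws kv.1 (some kv.2)) ?_
    rw [Function.update_apply]
    split_ifs
    · simp
    · exact h

open Classical in
theorem writeAll_ne_none {ws : WSet C} {kvs : List (C.Key × C.Val)} {k : C.Key}
    (h : k ∈ kvs.map Prod.fst) : writeAll ws kvs k ≠ none := by
  induction kvs generalizing ws with
  | nil => simp at h
  | cons kv kvs ih =>
    rw [List.map_cons, List.mem_cons] at h
    rcases h with rfl | hl
    · exact writeAll_ne_none_of_ne_none kvs (ws := Function.update ws kv.1 (some kv.2)) (by simp)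
    · exact ih hl

theorem bufferedWrites_ne_none {h : List (Op C)} {c : C.Client} {id : TxId}
    {kvs : List (C.Key × C.Val)} {k : C.Key} (ho : .write c id kvs ∈ h)
    (hk : k ∈ kvs.map Prod.fst) : bufferedWrites h id k ≠ none := by
  induction h using List.reverseRecOn with
  | nil => simp at ho
  | append_singleton l o ih =>
    rcases List.mem_append.1 ho with hl | ho
    · by_cases hid : o.tx = id
      · cases o
        case write c' id' kvs' =>
          obtain rfl : id' = id := hid
          rw [bufferedWrites_append_write]
          exact writeAll_ne_none_of_ne_none _ (ih hl)
        all_goals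
          rw [bufferedWrites_append]
          exact ih hl
      · rw [bufferedWrites_append_of_ne _ _ hid]
        exact ih hl
    · obtain rfl := List.mem_singleton.1 ho
      rw [bufferedWrites_append_write]
      exact writeAll_ne_none hk

/-! ### Steps by their effect on clients and history -/

/-- Steps that record nothing in the history. -/
structure Quiet (s s' : State C) : Prop where
  hist : s'.hist = s.hist
  ust : ∀ c, (s'.cl c).ust = (s.cl c).ust
  hwt : ∀ c, (s'.cl c).hwt = (s.cl c).hwt
  WC : ∀ c, (s'.cl c).WC = (s.cl c).WC
  WS : ∀ c, (s'.cl c).WS = (s.cl c).WS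
  RS : ∀ c, (s'.cl c).RS = (s.cl c).RS
  cur : ∀ c x, (s'.cl c).phase.cur = some x → (s.cl c).phase.cur = some x
  ended : ∀ c x, (s.cl c).phase.cur = some x →
    (s'.cl c).phase.cur = some x ∨ ∀ k, (s.cl c).WS k = none
  reading : ∀ c p id χ D, (s'.cl c).phase = .reading p id χ D →
    (s.cl c).phase = .reading p id χ D ∨
      ∀ k, (k ∈ χ → D k = (s.cl c).lookup k) ∧ (k ∉ χ → D k = none)

/-- Steps by what they record in the history. -/
inductive LStep (s : State C) (g : Ghost C) : State C → Ghost C → Prop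
  | quiet (s' : State C) (g' : Ghost C) (h : Quiet s s') : LStep s g s' g'
  | startRecv (net : Multiset (Msg C)) (c : C.Client) (p : Server C) (id : TxId)
      (ust : ℕ) (hc : (s.cl c).phase = .starting p) (hm : s.net = .startResp c id ust ::ₘ net) :
      LStep s g (((s.setCl c { s.cl c with
            phase := .active p id
            ust := ust
            WC := fun k => ((s.cl c).WC k).filter (fun X => ust < X.ut)
            WS := fun _ => none
            RS := fun _ => none }).withNet net).log
          (.start c id ust (fun k => ((s.cl c).WC k).filter (fun X => ust < X.ut)))) g
  | readRecv (net : Multiset (Msg C)) (c : C.Client) (p : Server C) (id : TxId)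
      (χ : Finset C.Key) (D D' : C.Key → Option (Result C)) (I : C.Key → Option (Item C))
      (hc : (s.cl c).phase = .reading p id χ D) (hm : s.net = .readResp c I ::ₘ net)
      (hD' : ∀ k, D' k = (D k).or ((I k).map (fun d => .inr d.toVersion))) :
      LStep s g (((s.setCl c { s.cl c with
            phase := .active p id
            RS := fun k => (D' k).or ((s.cl c).RS k) }).withNet net).log (.read c id χ D')) g
  | write (c : C.Client) (p : Server C) (id : TxId) (kvs : List (C.Key × C.Val))
      (hc : (s.cl c).phase = .active p id) :
      LStep s g ((s.setCl c { s.cl c with WS := writeAll (s.cl c).WS kvs }).log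
        (.write c id kvs)) g
  | commitRecv (net : Multiset (Msg C)) (c : C.Client) (p : Server C) (id : TxId)
      (ct : ℕ) (hc : (s.cl c).phase = .committing p id) (hm : s.net = .commitResp c ct ::ₘ net) :
      LStep s g (((s.setCl c { s.cl c with
            phase := .idle
            hwt := ct
            WC := fun k => (((s.cl c).WS k).map (fun v => ⟨k, v, ct, id⟩)).or ((s.cl c).WC k)
            WS := fun _ => none }).withNet net).log (.commit c id ct)) g

theorem Quiet.of_cl (hh : s'.hist = s.hist) (hcl : s'.cl = s.cl) : Quiet s s' := by
  refine ⟨hh, ?_, ?_, ?_, ?_, ?_, ?_, ?_, ?_⟩ <;> rw [hcl]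
  iterate 5 exact fun _ => rfl
  · exact fun c x h => h
  · exact fun c x h => .inl h
  · exact fun c p id χ D h => .inl h

theorem Quiet.of_phase {c : C.Client} {φ : Phase C} (hh : s'.hist = s.hist)
    (hcl : s'.cl = (s.setCl c { s.cl c with phase := φ }).cl)
    (hcur : ∀ x, φ.cur = some x → (s.cl c).phase.cur = some x)
    (hended : ∀ x, (s.cl c).phase.cur = some x → φ.cur = some x ∨ ∀ k, (s.cl c).WS k = none)
    (hreading : ∀ p id χ D, φ = .reading p id χ D →
      ∀ k, (k ∈ χ → D k = (s.cl c).lookup k) ∧ (k ∉ χ → D k = none)) : Quiet s s' := by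
  refine ⟨hh, ?_, ?_, ?_, ?_, ?_, ?_, ?_, ?_⟩ <;> rw [hcl]
  · exact State.proj_setCl ClientState.ust rfl
  · exact State.proj_setCl ClientState.hwt rfl
  · exact State.proj_setCl ClientState.WC rfl
  · exact State.proj_setCl ClientState.WS rfl
  · exact State.proj_setCl ClientState.RS rfl
  all_goals
    intro c'
    rw [State.cl_setCl]
    split_ifs with hc
    · subst hc
      first
        | exact hcur
        | exact hended
        | exact fun p id χ D h => .inr (hreading p id χ D h)
    · first
        | exact fun _ h => h
        | exact fun _ h => .inl h
        | exact fun _ _ _ _ h => .inl h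

theorem GStep.lstep (hs : GStep s g s' g') : LStep s g s' g' := by
  cases hs
  case silent hs hq =>
    cases hs
    case startRecv net c p id ust hc hm => exact .startRecv net c p id ust hc hm
    case readRecv net c p id χ D D' I hc hm hD' => exact .readRecv net c p id χ D D' I hc hm hD'
    case write c p id kvs hc => exact .write c p id kvs hc
    case commitRecv net c p id ct hc hm => exact .commitRecv net c p id ct hc hm
    case commitSend c p id hc hWS =>
      have := hq.2.1 c p id (by simp)
      simp [hc] at this
    case startSend c p hc =>
      refine .quiet _ _ (.of_phase rfl rfl ?_ ?_ ?_) <;> simp [hc, Phase.cur]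
    case readSend c p id χ χ' D hc hD hχ =>
      refine .quiet _ _ (.of_phase rfl rfl ?_ ?_ ?_)
      · simp [hc, Phase.cur]
      · simp [hc, Phase.cur]
      · rintro _ _ _ _ ⟨rfl, rfl, rfl, rfl⟩
        exact hD
    case finish c p id hc hWS =>
      refine .quiet _ _ (.of_phase rfl rfl ?_ ?_ ?_)
      · simp [Phase.cur]
      · exact fun x _ => .inr hWS
      · simp
    all_goals exact .quiet _ _ (.of_cl rfl rfl)
  case commitSend c p id hc hWS =>
    refine .quiet _ _ (.of_phase rfl rfl ?_ ?_ ?_) <;> simp [hc, Phase.cur]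
  all_goals exact .quiet _ _ (.of_cl rfl rfl)

theorem GStep.fin_eq_some (hs : GStep s g s' g') {id : TxId} {W : WSet C} {h : ℕ}
    (hf : g'.fin id = some (W, h)) : g.fin id = some (W, h) ∨
      ∃ c p, (s.cl c).phase.cur = some (p, id) ∧ W = (s.cl c).WS ∧ h = (s.cl c).hwt := by
  cases hs
  case commitSend c p id' hc hWS =>
    by_cases hid : id = id'
    · subst hid
      simp only [Function.update_self, Option.some.injEq, Prod.mk.injEq] at hf
      exact .inr ⟨c, p, by simp [hc, Phase.cur], hf.1.symm, hf.2.symm⟩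
    · exact .inl (by simpa [hid] using hf)
  all_goals exact .inl hf

/-- Commit timestamps and final write sets are fixed once, so a transaction that has committed
cannot acquire further versions. -/
theorem Ctl.new_version (h : Ctl s g) (h' : Ctl s' g') (hle : g.Le g') {X : Version C}
    (hX : X ∈ s'.versions) : X ∈ s.versions ∨ g.ct X.tx = none := by
  rw [or_iff_not_imp_right]
  intro hne
  obtain ⟨t, ht⟩ := Option.ne_none_iff_exists'.1 hne
  obtain ⟨h1, W, h0, h2, h3⟩ := (h'.versions X).1 hX
  obtain ⟨W', h0', h4, -⟩ := h.ct _ _ ht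
  rw [hle.ct _ _ ht] at h1
  rw [hle.fin _ _ h4] at h2
  cases h1; cases h2
  exact (h.versions X).2 ⟨ht, _, _, h4, h3⟩

/-! ### The order of the operations in the history -/

theorem CommittedBefore.append {h : List (Op C)} {c : C.Client} {a b : TxId}
    (hab : CommittedBefore h c a b) (l : List (Op C)) : CommittedBefore (h ++ l) c a b := by
  obtain ⟨i, j, ct, st, cache, hij, hi, hj⟩ := hab
  refine ⟨i, j, ct, st, cache, hij, ?_, ?_⟩
  · rw [List.getElem?_append_left (List.getElem?_eq_some_iff.1 hi).1]; exact hi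
  · rw [List.getElem?_append_left (List.getElem?_eq_some_iff.1 hj).1]; exact hj

theorem CommittedBefore.commit_mem {h : List (Op C)} {c : C.Client} {a b : TxId}
    (hab : CommittedBefore h c a b) : ∃ t, .commit c a t ∈ h := by
  obtain ⟨i, j, ct, st, cache, hij, hi, hj⟩ := hab
  exact ⟨ct, List.mem_of_getElem? hi⟩

theorem CommittedBefore.start_mem {h : List (Op C)} {c : C.Client} {a b : TxId}
    (hab : CommittedBefore h c a b) : ∃ st cache, .start c b st cache ∈ h := by
  obtain ⟨i, j, ct, st, cache, hij, hi, hj⟩ := hab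
  exact ⟨st, cache, List.mem_of_getElem? hj⟩

theorem committedBefore_append_start {h : List (Op C)} {c : C.Client} {a b : TxId} {t st : ℕ}
    {cache : C.Key → Option (Version C)} (ha : .commit c a t ∈ h) :
    CommittedBefore (h ++ [.start c b st cache]) c a b := by
  obtain ⟨i, hi, ha⟩ := List.getElem_of_mem ha
  refine ⟨i, h.length, t, st, cache, hi, ?_, by simp⟩
  rw [List.getElem?_append_left hi, List.getElem?_eq_getElem hi, ha]

theorem CommittedBefore.of_append {h : List (Op C)} {o : Op C} {c : C.Client} {a b : TxId}
    (hab : CommittedBefore (h ++ [o]) c a b) : CommittedBefore h c a b ∨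
      (∃ st cache, o = .start c b st cache) ∧ ∃ t, .commit c a t ∈ h := by
  obtain ⟨i, j, ct, st, cache, hij, hi, hj⟩ := hab
  have hjl := (List.getElem?_eq_some_iff.1 hj).1
  rw [List.length_append, List.length_singleton] at hjl
  have hil : i < h.length := by omega
  rw [List.getElem?_append_left hil] at hi
  by_cases hjh : j < h.length
  · rw [List.getElem?_append_left hjh] at hj
    exact .inl ⟨i, j, ct, st, cache, hij, hi, hj⟩
  · obtain rfl : j = h.length := by omega
    simp only [List.getElem?_concat_length, Option.some.injEq] at hj
    exact .inr ⟨⟨st, cache, hj⟩, ct, List.mem_of_getElem? hi⟩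

/-- Consequences of a client running one transaction at a time. Snapshot timestamps increase weakly
along its operations (`mono`); a transaction that has written something commits before the client
moves on (`before`, `ended`); a start is the first and a commit the last operation of its
transaction (`order`); and the `hwt` sent with a commit dominates all earlier commit timestamps of
the client (`le_fin`). -/
structure Ord (s : State C) (g : Ghost C) : Prop where
  ws : ∀ c p id, (s.cl c).phase.cur = some (p, id) → (s.cl c).WS = bufferedWrites s.hist id
  fin : ∀ id W h, g.fin id = some (W, h) → W = bufferedWrites s.hist id
  start : ∀ c p id, (s.cl c).phase.cur = some (p, id) →
    .start c id (s.cl c).ust (s.cl c).WC ∈ s.hist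
  info : ∀ c id st cache, .start c id st cache ∈ s.hist → ∃ p, g.info id = some (c, p, st)
  commit : ∀ c id t, .commit c id t ∈ s.hist → g.ct id = some t ∧ t ≤ (s.cl c).hwt
  mono : s.hist.Pairwise fun o o' => o.client = o'.client → ∀ x x', g.info o.tx = some x →
    g.info o'.tx = some x' → x.2.2 ≤ x'.2.2
  le_ust : ∀ o ∈ s.hist, ∀ x, g.info o.tx = some x → x.2.2 ≤ (s.cl o.client).ust
  before_cur : ∀ c p id, (s.cl c).phase.cur = some (p, id) → ∀ x kvs, .write c x kvs ∈ s.hist →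
    kvs ≠ [] → x ≠ id → CommittedBefore s.hist c x id
  before : s.hist.Pairwise fun o o' => ∀ c x kvs, o = .write c x kvs → kvs ≠ [] → o'.client = c →
    x ≠ o'.tx → CommittedBefore s.hist c x o'.tx
  ended : ∀ c x kvs, .write c x kvs ∈ s.hist → kvs ≠ [] →
    (∃ p, (s.cl c).phase.cur = some (p, x)) ∨ ∃ t, .commit c x t ∈ s.hist
  le_fin : ∀ c a b W h, CommittedBefore s.hist c a b → g.fin b = some (W, h) →
    ∀ t, g.ct a = some t → t ≤ h
  order : s.hist.Pairwise fun o o' => (∀ c x t, o = .commit c x t → o'.tx ≠ x) ∧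
    ∀ c y st cache, o' = .start c y st cache → o.tx ≠ y
  not_committed : ∀ c p id, (s.cl c).phase.cur = some (p, id) → ∀ c' t, .commit c' id t ∉ s.hist

theorem Ghost.Le.info_eq (h : g.Le g') {id : TxId} {x y : C.Client × Server C × ℕ}
    (hx : g.info id = some x) (hy : g'.info id = some y) : y = x := by
  rw [h.info _ _ hx] at hy
  exact (Option.some.inj hy).symm

theorem Ord.quiet (h : Ord s g) (hctl : Ctl s g) (hle : g.Le g') (hq : Quiet s s')
    (hfin : ∀ id W h, g'.fin id = some (W, h) → g.fin id = some (W, h) ∨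
      ∃ c p, (s.cl c).phase.cur = some (p, id) ∧ W = (s.cl c).WS ∧ h = (s.cl c).hwt) :
    Ord s' g' := by
  have hx : ∀ o ∈ s.hist, ∀ x, g'.info o.tx = some x → g.info o.tx = some x := by
    intro o ho x hx
    obtain ⟨p, st, h1⟩ := hctl.hist o ho
    rw [h1, hle.info_eq h1 hx]
  constructor <;> rw [hq.hist]
  · intro c p id hc
    rw [hq.WS]
    exact h.ws c p id (hq.cur _ _ hc)
  · intro id W h' hf
    rcases hfin id W h' hf with h1 | ⟨c, p, h1, rfl, -⟩
    · exact h.fin id W h' h1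
    · exact h.ws c p id h1
  · intro c p id hc
    rw [hq.ust, hq.WC]
    exact h.start c p id (hq.cur _ _ hc)
  · intro c id st cache ho
    obtain ⟨p, hp⟩ := h.info c id st cache ho
    exact ⟨p, hle.info _ _ hp⟩
  · intro c id t ho
    rw [hq.hwt]
    exact ⟨hle.ct _ _ (h.commit c id t ho).1, (h.commit c id t ho).2⟩
  · refine h.mono.imp_of_mem ?_
    intro o o' ho ho' h1 h2 x x' h3 h4
    exact h1 h2 x x' (hx o ho x h3) (hx o' ho' x' h4)
  · intro o ho x h1
    rw [hq.ust]
    exact h.le_ust o ho x (hx o ho x h1)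
  · exact fun c p id hc => h.before_cur c p id (hq.cur _ _ hc)
  · exact h.before
  · intro c x kvs ho hne
    rcases h.ended c x kvs ho hne with ⟨p, h1⟩ | h1
    · rcases hq.ended c _ h1 with h2 | h2
      · exact .inl ⟨p, h2⟩
      -- A transaction leaves without a commit only with an empty write set, but a recorded nonempty
      -- write would be in it.
      · obtain ⟨kv, kvs', rfl⟩ := List.exists_cons_of_ne_nil hne
        refine absurd ?_ (bufferedWrites_ne_none ho (k := kv.1) (by simp))
        rw [← h.ws c p x h1]
        exact h2 _
    · exact .inr h1
  · intro c a b W h' hab hf t ht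
    obtain ⟨t', h1⟩ := hab.commit_mem
    obtain ⟨h2, h3⟩ := h.commit c a t' h1
    obtain rfl : t' = t := by
      rw [hle.ct _ _ h2] at ht
      exact Option.some.inj ht
    rcases hfin b W h' hf with h4 | ⟨c', p, h4, -, rfl⟩
    · exact h.le_fin c a b W h' hab h4 t' h2
    -- The final write set has just been fixed together with the client's current `hwt`, which
    -- bounds all its recorded commits.
    · obtain ⟨st, cache, h5⟩ := hab.start_mem
      obtain ⟨p', h6⟩ := h.info _ _ _ _ h5
      have h7 := hctl.cur _ _ _ h4
      rw [h6] at h7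
      obtain rfl : c = c' := by cases h7; rfl
      exact h3
  · exact h.order
  · exact fun c p id hc => h.not_committed c p id (hq.cur _ _ hc)

/-- Collects what must be known about a newly recorded operation. Other clients are untouched, and
`o.tx` cannot be a transaction of theirs, since the ghost state assigns it to the client of `o`. -/
theorem Ord.log {o : Op C} {p : Server C} (h : Ord s g) (hctl : Ctl s g)
    (hh : s'.hist = s.hist ++ [o]) (hcl : ∀ c, c ≠ o.client → s'.cl c = s.cl c)
    (hinfo : g.info o.tx = some (o.client, p, (s'.cl o.client).ust))
    (hust : (s.cl o.client).ust ≤ (s'.cl o.client).ust)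
    (hhwt : (s.cl o.client).hwt ≤ (s'.cl o.client).hwt)
    (hcur : ∀ p' id, (s'.cl o.client).phase.cur = some (p', id) → id = o.tx ∧
      (s'.cl o.client).WS = bufferedWrites s'.hist id ∧
      .start o.client id (s'.cl o.client).ust (s'.cl o.client).WC ∈ s'.hist ∧
      ∀ c t, o ≠ .commit c id t)
    (hopen : ∀ c t, .commit c o.tx t ∉ s.hist)
    (hfin : g.fin o.tx ≠ none → ∀ c id kvs, o ≠ .write c id kvs)
    (hstart : ∀ c id st cache, o = .start c id st cache → st = (s'.cl o.client).ust ∧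
      (∀ o' ∈ s.hist, o'.tx ≠ id) ∧ g.fin id = none)
    (hcommit : ∀ c id t, o = .commit c id t → g.ct id = some t ∧ t ≤ (s'.cl o.client).hwt)
    (hbefore : ∀ x kvs, .write o.client x kvs ∈ s.hist → kvs ≠ [] → x ≠ o.tx →
      CommittedBefore s'.hist o.client x o.tx)
    (hended : ∀ x kvs, .write o.client x kvs ∈ s'.hist → kvs ≠ [] →
      (∃ p, (s'.cl o.client).phase.cur = some (p, x)) ∨ ∃ t, .commit o.client x t ∈ s'.hist) :
    Ord s' g := by
  have hother : ∀ c p' id, c ≠ o.client → (s.cl c).phase.cur = some (p', id) → o.tx ≠ id := by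
    rintro c p' id hc h1 rfl
    have h2 := hctl.cur _ _ _ h1
    rw [hinfo] at h2
    exact hc (congrArg Prod.fst (Option.some.inj h2)).symm
  have hmem : ∀ o', o' ∈ s'.hist ↔ o' ∈ s.hist ∨ o' = o := by
    intro o'; rw [hh]; simp
  constructor
  · intro c p' id hc
    by_cases hco : c = o.client
    · subst hco; exact (hcur _ _ hc).2.1
    · rw [hcl c hco] at hc ⊢
      rw [hh, bufferedWrites_append_of_ne _ _ (hother c p' id hco hc)]
      exact h.ws c p' id hc
  · intro id W h' hf
    rw [hh, h.fin id W h' hf]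
    by_cases hid : o.tx = id
    · rw [bufferedWrites_append]
      cases o
      case write c' id' kvs' => exact absurd rfl (hfin (by rw [hid, hf]; simp) _ _ _)
      all_goals rfl
    · rw [bufferedWrites_append_of_ne _ _ hid]
  · intro c p' id hc
    by_cases hco : c = o.client
    · subst hco; exact (hcur _ _ hc).2.2.1
    · rw [hcl c hco] at hc ⊢
      exact (hmem _).2 (.inl (h.start c p' id hc))
  · intro c id st cache ho
    rcases (hmem _).1 ho with ho | rfl
    · exact h.info c id st cache ho
    · exact ⟨p, by rw [(hstart _ _ _ _ rfl).1]; exact hinfo⟩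
  · intro c id t ho
    rcases (hmem _).1 ho with ho | rfl
    · refine ⟨(h.commit c id t ho).1, (h.commit c id t ho).2.trans ?_⟩
      by_cases hco : c = o.client
      · subst hco; exact hhwt
      · rw [hcl c hco]
    · exact hcommit _ _ _ rfl
  · rw [hh, List.pairwise_append]
    refine ⟨h.mono, List.pairwise_singleton _ _, ?_⟩
    intro o' ho' o'' ho'' hc x x' hx hx'
    obtain rfl := List.mem_singleton.1 ho''
    rw [hinfo] at hx'
    obtain rfl := Option.some.inj hx'
    exact (h.le_ust o' ho' x hx).trans (hc ▸ hust)
  · intro o' ho' x hx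
    rcases (hmem _).1 ho' with ho' | rfl
    · refine (h.le_ust o' ho' x hx).trans ?_
      by_cases hco : o'.client = o.client
      · rw [hco]; exact hust
      · rw [hcl _ hco]
    · rw [hinfo] at hx
      obtain rfl := Option.some.inj hx
      exact le_rfl
  · intro c p' id hc x kvs ho hne hx
    by_cases hco : c = o.client
    · subst hco
      obtain ⟨rfl, -⟩ := hcur _ _ hc
      rcases (hmem _).1 ho with ho | ho
      · exact hbefore x kvs ho hne hx
      · exact absurd (ho ▸ rfl) hx
    · rw [hcl c hco] at hc
      rcases (hmem _).1 ho with ho | ho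
      · rw [hh]
        exact (h.before_cur c p' id hc x kvs ho hne hx).append _
      · exact absurd (ho ▸ rfl) hco
  · conv => enter [2]; rw [hh]
    rw [List.pairwise_append]
    refine ⟨h.before.imp ?_, List.pairwise_singleton _ _, ?_⟩
    · intro o1 o2 h1 c x kvs h2 h3 h4 h5
      rw [hh]
      exact (h1 c x kvs h2 h3 h4 h5).append _
    · rintro o' ho' o'' ho'' c x kvs rfl hne rfl hx
      obtain rfl := List.mem_singleton.1 ho''
      exact hbefore x kvs ho' hne hx
  · intro c x kvs ho hne
    by_cases hco : c = o.client
    · subst hco; exact hended x kvs ho hne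
    · rcases (hmem _).1 ho with ho | ho
      · rw [hcl c hco]
        exact (h.ended c x kvs ho hne).imp_right fun ⟨t, ht⟩ => ⟨t, (hmem _).2 (.inl ht)⟩
      · exact absurd (ho ▸ rfl) hco
  · intro c a b W h' hab hf
    rw [hh] at hab
    rcases hab.of_append with h1 | ⟨⟨st, cache, rfl⟩, -⟩
    · exact h.le_fin c a b W h' h1 hf
    · have := (hstart _ _ _ _ rfl).2.2
      rw [hf] at this
      cases this
  · rw [hh, List.pairwise_append]
    refine ⟨h.order, List.pairwise_singleton _ _, ?_⟩
    intro o' ho' o'' ho''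
    obtain rfl := List.mem_singleton.1 ho''
    constructor
    · rintro c x t rfl rfl
      exact hopen _ _ ho'
    · rintro c y st cache rfl
      exact (hstart _ _ _ _ rfl).2.1 o' ho'
  · intro c p' id hc c' t ho
    by_cases hco : c = o.client
    · subst hco
      obtain ⟨rfl, -, -, h1⟩ := hcur _ _ hc
      rcases (hmem _).1 ho with ho | ho
      · exact hopen _ _ ho
      · exact h1 _ _ ho.symm
    · rw [hcl c hco] at hc
      rcases (hmem _).1 ho with ho | ho
      · exact h.not_committed c p' id hc _ _ ho
      · exact hother c p' id hco hc (ho ▸ rfl)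

/-- A transaction that commits has written at least one key. The cohort of that key proposed a
timestamp above both the snapshot and `hwt`, and the commit timestamp is no smaller. With an empty
write set the supremum could be zero. -/
theorem Ctl.lt_ct (h : Ctl s g) {id : TxId} {t : ℕ} (ht : g.ct id = some t) {c : C.Client}
    {p : Server C} {st : ℕ} (hi : g.info id = some (c, p, st)) {W : WSet C} {hw : ℕ}
    (hf : g.fin id = some (W, hw)) : st < t ∧ hw < t := by
  obtain ⟨W', h', h1, h2⟩ := h.ct _ _ ht
  rw [hf] at h1
  cases h1
  obtain ⟨-, k, hk⟩ := h.fin _ _ _ hf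
  obtain ⟨q, pt, h3, h4⟩ := h2 (C.part k) (by
    rw [WSet.parts]
    simp only [Finset.mem_filter, Finset.mem_univ, true_and]
    exact ⟨k, rfl, hk⟩)
  obtain ⟨-, W', h', c', p', st', h5, h6, -, h7, h8⟩ := h.prop _ _ _ _ h3
  rw [hf] at h5
  rw [hi] at h6
  cases h5; cases h6
  omega

theorem Ord.gstep (h : Ord s g) (hctl : Ctl s g) (hs : GStep s g s' g') : Ord s' g' := by
  have hle := hs.le hctl
  have hfin := fun id W h => hs.fin_eq_some (id := id) (W := W) (h := h)
  have hs := hs.lstep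
  cases hs
  case quiet hq => exact h.quiet hctl hle hq hfin
  case startRecv net c p id ust hc hm =>
    obtain ⟨p', h1, h2, h3, h4, h5, h6⟩ : MsgOK s g _ :=
      hctl.msg _ (hm ▸ Multiset.mem_cons_self _ _)
    refine h.log hctl (o := .start c id ust _) (p := p') rfl ?_ ?_ ?_ ?_ ?_ ?_ ?_ ?_ ?_ ?_ ?_
    · exact fun c' hc' => State.cl_setCl_ne _ _ hc'
    · simpa [Op.tx, Op.client] using h2
    · simpa [Op.client] using h5
    · simp [Op.client]
    · intro p'' id' hcur
      simp only [Op.client, State.cl_log, State.cl_withNet, State.cl_setCl_self, Phase.cur,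
        Option.some.injEq, Prod.mk.injEq] at hcur
      obtain ⟨rfl, rfl⟩ := hcur
      refine ⟨rfl, ?_, ?_, ?_⟩
      · simp only [Op.client, State.cl_log, State.cl_withNet, State.cl_setCl_self, State.hist_log,
          State.hist_withNet, State.hist_setCl]
        rw [bufferedWrites_append, bufferedWrites_of_forall_ne h6]
      · simp [Op.client]
      · simp
    · exact fun c' t ho => h6 _ ho rfl
    · simp
    · rintro c' id' st cache ⟨rfl, rfl, rfl, rfl⟩
      refine ⟨?_, h6, h4⟩
      simp [Op.client]
    · simp
    · intro x kvs ho hne hx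
      -- The client is starting and has no open transaction, so whatever it has written is already
      -- committed.
      rcases h.ended c x kvs ho hne with ⟨p, h7⟩ | ⟨t, h7⟩
      · rw [hc] at h7; simp [Phase.cur] at h7
      · exact committedBefore_append_start h7
    · intro x kvs ho hne
      have ho' : .write c x kvs ∈ s.hist := by simpa [Op.client] using ho
      rcases h.ended c x kvs ho' hne with ⟨p, h7⟩ | ⟨t, h7⟩
      · rw [hc] at h7; simp [Phase.cur] at h7
      · exact .inr ⟨t, List.mem_append_left _ h7⟩
  case readRecv net c p id χ D D' I hc hm hD' =>
    have hcur : (s.cl c).phase.cur = some (p, id) := by rw [hc]; rfl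
    refine h.log hctl (o := .read c id χ D') (p := p) rfl ?_ ?_ ?_ ?_ ?_ ?_ ?_ ?_ ?_ ?_ ?_
    · exact fun c' hc' => State.cl_setCl_ne _ _ hc'
    · simpa [Op.tx, Op.client] using hctl.cur _ _ _ hcur
    · simp [Op.client]
    · simp [Op.client]
    · intro p'' id' hcur'
      simp only [Op.client, State.cl_log, State.cl_withNet, State.cl_setCl_self, Phase.cur,
        Option.some.injEq, Prod.mk.injEq] at hcur'
      obtain ⟨rfl, rfl⟩ := hcur'
      refine ⟨rfl, ?_, ?_, ?_⟩
      · simp only [Op.client, State.cl_log, State.cl_withNet, State.cl_setCl_self, State.hist_log,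
          State.hist_withNet, State.hist_setCl]
        rw [bufferedWrites_append]
        exact h.ws _ _ _ hcur
      · simpa [Op.client] using h.start _ _ _ hcur
      · simp
    · exact fun c' t => h.not_committed _ _ _ hcur c' t
    · simp
    · simp
    · simp
    · exact fun x kvs ho hne hx => (h.before_cur _ _ _ hcur x kvs ho hne hx).append _
    · intro x kvs ho hne
      have ho' : .write c x kvs ∈ s.hist := by simpa [Op.client] using ho
      rcases h.ended c x kvs ho' hne with ⟨p, h7⟩ | ⟨t, h7⟩
      · rw [hc] at h7
        exact .inl ⟨p, by simpa [Op.client, Phase.cur] using h7⟩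
      · exact .inr ⟨t, List.mem_append_left _ h7⟩
  case write c p id kvs hc =>
    have hcur : (s.cl c).phase.cur = some (p, id) := by rw [hc]; rfl
    refine h.log hctl (o := .write c id kvs) (p := p) rfl ?_ ?_ ?_ ?_ ?_ ?_ ?_ ?_ ?_ ?_ ?_
    · exact fun c' hc' => State.cl_setCl_ne _ _ hc'
    · simpa [Op.tx, Op.client] using hctl.cur _ _ _ hcur
    · simp [Op.client]
    · simp [Op.client]
    · intro p'' id' hcur'
      simp only [Op.client, State.cl_log, State.cl_setCl_self, hc, Phase.cur,
        Option.some.injEq, Prod.mk.injEq] at hcur'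
      obtain ⟨rfl, rfl⟩ := hcur'
      refine ⟨rfl, ?_, ?_, ?_⟩
      · simp only [Op.client, State.cl_log, State.cl_setCl_self, State.hist_log,
          State.hist_setCl]
        rw [bufferedWrites_append_write, h.ws _ _ _ hcur]
      · simpa [Op.client] using h.start _ _ _ hcur
      · simp
    · exact fun c' t => h.not_committed _ _ _ hcur c' t
    -- While a transaction can still write, its final write set is not fixed, so the new record
    -- contradicts no earlier one.
    · exact fun hne => absurd (hctl.run c p id (by rw [hc]; rfl)).2 hne
    · simp
    · simp
    · exact fun x kvs ho hne hx => (h.before_cur _ _ _ hcur x kvs ho hne hx).append _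
    · intro x kvs' ho hne
      rcases List.mem_append.1 ho with ho | ho
      · rcases h.ended c x kvs' ho hne with ⟨p, h7⟩ | ⟨t, h7⟩
        · exact .inl ⟨p, by simpa [Op.client, Phase.cur] using h7⟩
        · exact .inr ⟨t, List.mem_append_left _ h7⟩
      · simp only [List.mem_singleton, Op.write.injEq] at ho
        obtain ⟨-, rfl, -⟩ := ho
        exact .inl ⟨p, by simpa [Op.client] using hcur⟩
  case commitRecv net c p id ct hc hm =>
    have hcur : (s.cl c).phase.cur = some (p, id) := by rw [hc]; rfl
    obtain ⟨p', id', h1, h2⟩ : MsgOK s g _ := hctl.msg _ (hm ▸ Multiset.mem_cons_self _ _)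
    obtain ⟨rfl, rfl⟩ : p = p' ∧ id = id' := by
      rw [hc] at h1; cases h1; exact ⟨rfl, rfl⟩
    have h3 := hctl.lt_ct h2 (hctl.cur _ _ _ hcur) (hctl.committing _ _ _ hc)
    refine h.log hctl (o := .commit c id ct) (p := p) rfl ?_ ?_ ?_ ?_ ?_ ?_ ?_ ?_ ?_ ?_ ?_
    · exact fun c' hc' => State.cl_setCl_ne _ _ hc'
    · simpa [Op.tx, Op.client] using hctl.cur _ _ _ hcur
    · simp [Op.client]
    · simpa [Op.client] using h3.2.le
    · simp [Op.client, Phase.cur]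
    · exact fun c' t => h.not_committed _ _ _ hcur c' t
    · simp
    · simp
    · rintro c' id' t ⟨rfl, rfl, rfl⟩
      exact ⟨h2, by simp [Op.client]⟩
    · exact fun x kvs ho hne hx => (h.before_cur _ _ _ hcur x kvs ho hne hx).append _
    · intro x kvs ho hne
      have ho' : .write c x kvs ∈ s.hist := by simpa [Op.client] using ho
      rcases h.ended c x kvs ho' hne with ⟨p', h7⟩ | ⟨t, h7⟩
      · rw [hcur] at h7
        cases h7
        exact .inr ⟨ct, by simp [Op.client]⟩
      · exact .inr ⟨t, List.mem_append_left _ h7⟩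

/-! ### Caches -/

theorem GStep.hist_eq (hs : GStep s g s' g') (hctl : Ctl s g) : s'.hist = s.hist ∨
    ∃ o, s'.hist = s.hist ++ [o] ∧
      ∀ c id st cache, o = .start c id st cache → ∀ o' ∈ s.hist, o'.tx ≠ id := by
  have hs := hs.lstep
  cases hs
  case quiet hq => exact .inl hq.hist
  case startRecv net c p id ust hc hm =>
    obtain ⟨p', -, -, -, -, -, h6⟩ : MsgOK s g _ := hctl.msg _ (hm ▸ Multiset.mem_cons_self _ _)
    refine .inr ⟨_, rfl, ?_⟩
    rintro c' id' st cache ⟨rfl, rfl, rfl, rfl⟩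
    exact h6
  all_goals exact .inr ⟨_, rfl, nofun⟩

/-- Only another start record of `b` could add a predecessor, and a start is always the first record
of its transaction. -/
theorem GStep.committedBefore_iff (hs : GStep s g s' g') (hctl : Ctl s g) {c : C.Client}
    {a b : TxId} {st : ℕ} {cache : C.Key → Option (Version C)}
    (hb : .start c b st cache ∈ s.hist) :
    CommittedBefore s'.hist c a b ↔ CommittedBefore s.hist c a b := by
  rcases hs.hist_eq hctl with h1 | ⟨o, h1, h2⟩
  · rw [h1]
  · rw [h1]
    refine ⟨fun h => ?_, fun h => h.append _⟩
    rcases h.of_append with h3 | ⟨⟨st', cache', rfl⟩, -⟩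
    · exact h3
    · exact absurd rfl (h2 _ _ _ _ rfl _ hb)

/-- After the start both ingredients are fixed: the earlier transactions of the client, and their
versions, as they have committed. -/
theorem GStep.ownPart_eq (hs : GStep s g s' g') (hctl : Ctl s g) (hctl' : Ctl s' g')
    (hord : Ord s g) {c : C.Client} {id : TxId} {st st' : ℕ}
    {cache : C.Key → Option (Version C)} (hb : .start c id st cache ∈ s.hist) :
    ownPart s' c id st' = ownPart s c id st' := by
  ext X
  simp only [ownPart, Set.mem_ofPred_eq, hs.committedBefore_iff hctl hb]
  refine and_congr_left fun ⟨h1, h2⟩ => ⟨fun h3 => ?_, fun h3 => hs.versions_subset h3⟩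
  obtain ⟨t, ht⟩ := h2.commit_mem
  refine (hctl.new_version hctl' (hs.le hctl) h3).resolve_right ?_
  rw [(hord.commit _ _ _ ht).1]
  simp

/-- The rank compares timestamps first. If the freshest element fails the threshold then all
elements do, so pruning the single cached version is the same as pruning the whole set. -/
theorem IsFreshest.filter {A : Set (Version C)} {o : Option (Version C)}
    (h : IsFreshest Version.rank A o) (u : ℕ) :
    IsFreshest Version.rank {X ∈ A | u < X.ut} (o.filter fun X => u < X.ut) := by
  cases o with
  | none =>
    have hA : A = ∅ := h
    simp [IsFreshest, hA]
  | some X =>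
    by_cases hX : u < X.ut
    · rw [Option.filter_some_pos (by simpa using hX)]
      exact ⟨⟨h.1, hX⟩, fun Y hY => h.2 Y hY.1⟩
    · rw [Option.filter_some_neg (by simpa using hX)]
      refine Set.eq_empty_of_forall_notMem fun Y hY => hX (hY.2.trans_le ?_)
      have h1 := h.2 Y hY.1
      rw [Version.rank, Version.rank, Prod.Lex.le_iff] at h1
      exact h1.elim le_of_lt fun h2 => h2.1.le

theorem Version.rank_le_of_ut_lt {X Y : Version C} (h : X.ut < Y.ut) : X.rank ≤ Y.rank :=
  Prod.Lex.le_iff.2 (.inl h)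

/-- The versions that client `c` has committed and that are not in its last snapshot. -/
def recent (s : State C) (c : C.Client) (u : ℕ) : Set (Version C) :=
  {X ∈ s.versions | u < X.ut ∧ ∃ t, .commit c X.tx t ∈ s.hist}

/-- Between starts the cache is described by `recent`, which grows with commits. At a start `recent`
agrees with the own part of the new transaction, and from then on the recorded cache is compared
with that frozen set. -/
structure Cache (s : State C) : Prop where
  cache : ∀ c k, IsFreshest Version.rank {X ∈ recent s c (s.cl c).ust | X.key = k} ((s.cl c).WC k)
  start : ∀ c id st cache, .start c id st cache ∈ s.hist → ∀ k,
    IsFreshest Version.rank {X ∈ ownPart s c id st | X.key = k} (cache k)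

theorem GStep.recent_eq (hs : GStep s g s' g') (hctl : Ctl s g) (hctl' : Ctl s' g')
    (hord : Ord s g) {c : C.Client} {u : ℕ}
    (hh : ∀ id t, .commit c id t ∈ s'.hist ↔ .commit c id t ∈ s.hist) :
    recent s' c u = recent s c u := by
  ext X
  simp only [recent, Set.mem_ofPred_eq, hh]
  refine and_congr_left fun ⟨h1, t, ht⟩ => ⟨fun h3 => ?_, fun h3 => hs.versions_subset h3⟩
  refine (hctl.new_version hctl' (hs.le hctl) h3).resolve_right ?_
  rw [(hord.commit _ _ _ ht).1]
  simp

theorem recent_append_start {c : C.Client} {id : TxId} {u st : ℕ}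
    {cache : C.Key → Option (Version C)} (hv : s'.versions = s.versions)
    (hh : s'.hist = s.hist ++ [.start c id st cache]) (hid : ∀ o ∈ s.hist, o.tx ≠ id) :
    ownPart s' c id u = recent s c u := by
  ext X
  simp only [ownPart, recent, Set.mem_ofPred_eq, hv]
  refine and_congr_right fun _ => and_congr_right fun _ => ⟨fun h => ?_, fun ⟨t, h⟩ => ?_⟩
  · rw [hh] at h
    rcases h.of_append with h1 | ⟨-, h1⟩
    · obtain ⟨st, cache, h2⟩ := h1.start_mem
      exact absurd rfl (hid _ h2)
    · exact h1
  · rw [hh]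
    exact committedBefore_append_start h

theorem recent_mono_ust {c : C.Client} {u u' : ℕ} (hu : u ≤ u') (k : C.Key) :
    {X ∈ {X ∈ recent s c u | X.key = k} | u' < X.ut} = {X ∈ recent s c u' | X.key = k} := by
  ext X
  simp only [recent, Set.mem_ofPred_eq]
  constructor
  · rintro ⟨⟨⟨h1, h2, h3⟩, h4⟩, h5⟩
    exact ⟨⟨h1, h5, h3⟩, h4⟩
  · rintro ⟨⟨h1, h5, h3⟩, h4⟩
    exact ⟨⟨⟨h1, hu.trans_lt h5, h3⟩, h4⟩, h5⟩

theorem Cache.gstep (h : Cache s) (hctl : Ctl s g) (hctl' : Ctl s' g') (hord : Ord s g)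
    (hs : GStep s g s' g') : Cache s' := by
  have hstart : ∀ c id st cache, .start c id st cache ∈ s.hist → ∀ k,
      IsFreshest Version.rank {X ∈ ownPart s' c id st | X.key = k} (cache k) := by
    intro c id st cache ho k
    rw [hs.ownPart_eq hctl hctl' hord ho]
    exact h.start c id st cache ho k
  have hrecent := fun c u => hs.recent_eq hctl hctl' hord (c := c) (u := u)
  have hs := hs.lstep
  cases hs
  case quiet hq =>
    constructor
    · intro c k
      rw [hq.ust, hq.WC, hrecent c _ (fun id t => by rw [hq.hist])]
      exact h.cache c k
    · rw [hq.hist]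
      exact hstart
  case startRecv net c p id ust hc hm =>
    obtain ⟨p', h1, h2, h3, h4, h5, h6⟩ : MsgOK s g _ :=
      hctl.msg _ (hm ▸ Multiset.mem_cons_self _ _)
    have key : ∀ k, IsFreshest Version.rank {X ∈ recent s c ust | X.key = k}
        (((s.cl c).WC k).filter fun X => ust < X.ut) := by
      intro k
      rw [← recent_mono_ust h5]
      exact (h.cache c k).filter ust
    constructor
    · intro c' k
      rw [hrecent c' _ (fun id t => by simp)]
      by_cases hcc : c' = c
      · subst hcc
        simpa using key k
      · simp only [State.cl_log, State.cl_withNet, State.cl_setCl_ne _ _ hcc]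
        exact h.cache c' k
    · intro c' id' st cache ho k
      rcases List.mem_append.1 ho with ho | ho
      · exact hstart c' id' st cache ho k
      · obtain ⟨rfl, rfl, rfl, rfl⟩ := Op.start.injEq .. ▸ List.mem_singleton.1 ho
        rw [recent_append_start (s := s)]
        · exact key k
        · rfl
        · rfl
        · exact h6
  case commitRecv net c p id ct hc hm =>
    have hcur : (s.cl c).phase.cur = some (p, id) := by rw [hc]; rfl
    obtain ⟨p', id', h1, h2⟩ : MsgOK s g _ := hctl.msg _ (hm ▸ Multiset.mem_cons_self _ _)
    obtain ⟨rfl, rfl⟩ : p = p' ∧ id = id' := by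
      rw [hc] at h1; cases h1; exact ⟨rfl, rfl⟩
    have hfin := hctl.committing _ _ _ hc
    have h3 := hctl.lt_ct h2 (hctl.cur _ _ _ hcur) hfin
    constructor
    · intro c' k
      by_cases hcc : c' = c
      swap
      · rw [hrecent c' _ (fun id t => by simp [hcc])]
        simp only [State.cl_log, State.cl_withNet, State.cl_setCl_ne _ _ hcc]
        exact h.cache c' k
      subst hcc
      simp only [State.cl_log, State.cl_withNet, State.cl_setCl_self]
      set s₁ := ((s.setCl c' { s.cl c' with
            phase := .idle
            hwt := ct
            WC := fun k => (((s.cl c').WS k).map (fun v => ⟨k, v, ct, id⟩)).or ((s.cl c').WC k)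
            WS := fun _ => none }).withNet net).log (.commit c' id ct)
      have hmem : ∀ X, X ∈ recent s₁ c' (s.cl c').ust ↔ X ∈ recent s c' (s.cl c').ust ∨
          X ∈ s.versions ∧ X.tx = id := by
        intro X
        have hv : s₁.versions = s.versions := rfl
        have hh : s₁.hist = s.hist ++ [.commit c' id ct] := rfl
        simp only [recent, Set.mem_ofPred_eq, hv, hh, List.mem_append, List.mem_singleton,
          Op.commit.injEq, true_and]
        constructor
        · rintro ⟨h4, h5, t, h6 | ⟨h6, -⟩⟩
          · exact .inl ⟨h4, h5, t, h6⟩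
          · exact .inr ⟨h4, h6⟩
        · rintro (⟨h4, h5, t, h6⟩ | ⟨h4, h5⟩)
          · exact ⟨h4, h5, t, .inl h6⟩
          · refine ⟨h4, ?_, ct, .inr ⟨h5, rfl⟩⟩
            have h6 := ((hctl.versions X).1 h4).1
            rw [h5, h2] at h6
            rw [← Option.some.inj h6]
            exact h3.1
      cases hW : (s.cl c').WS k with
      | none =>
        have : {X ∈ recent s₁ c' (s.cl c').ust | X.key = k} =
            {X ∈ recent s c' (s.cl c').ust | X.key = k} := by
          ext X
          simp only [Set.mem_ofPred_eq, hmem]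
          refine and_congr_left fun hk => ⟨?_, .inl⟩
          rintro (h4 | ⟨h4, h5⟩)
          · exact h4
          · obtain ⟨-, W, hw, h6, h7⟩ := (hctl.versions X).1 h4
            rw [h5, hfin] at h6
            cases h6
            rw [hk, hW] at h7
            cases h7
        rw [this]
        exact h.cache c' k
      | some x =>
        refine ⟨⟨(hmem _).2 (.inr ⟨?_, rfl⟩), rfl⟩, ?_⟩
        · exact (hctl.versions _).2 ⟨h2, _, _, hfin, hW⟩
        · rintro X ⟨h4, h5⟩
          rcases (hmem X).1 h4 with ⟨h6, h7, t, h8⟩ | ⟨h6, h7⟩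
          -- An earlier commit of the client has timestamp at most `hwt`, and the new one is
          -- strictly above `hwt`; overwriting the cache entry is therefore correct.
          · refine Version.rank_le_of_ut_lt ?_
            have h9 := hord.commit _ _ _ h8
            have h10 := ((hctl.versions X).1 h6).1
            rw [h9.1] at h10
            obtain rfl := Option.some.inj h10
            exact h9.2.trans_lt h3.2
          · refine le_of_eq (congrArg Version.rank (hctl.version_unique h6 ?_ h5 h7))
            exact (hctl.versions _).2 ⟨h2, _, _, hfin, hW⟩
    · intro c' id' st cache ho k
      exact hstart c' id' st cache (by simpa using ho) k
  all_goals
    constructor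
    · intro c' k
      rw [hrecent c' _ (fun id t => by simp)]
      rw [State.cl_log]
      try rw [State.cl_withNet]
      rw [State.cl_setCl]
      split_ifs with hcc
      · subst hcc
        exact h.cache c' k
      · exact h.cache c' k
    · intro c' id' st cache ho k
      exact hstart c' id' st cache (by simpa using ho) k

/-! ### Reads in progress -/

/-- The client waits for the answer about the key `k`. -/
def ClientState.Needs (κ : ClientState C) (k : C.Key) : Prop :=
  ∃ p id χ D, κ.phase = .reading p id χ D ∧ k ∈ χ ∧ D k = none

def ClientState.Reading (κ : ClientState C) : Prop :=
  ∃ p id χ D, κ.phase = .reading p id χ D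

/-- `D` answers the read of the client `c` for the partitions in `P`. -/
def Answer (s : State C) (c : C.Client) (st : ℕ) (P : Fin C.N → Prop)
    (D : C.Key → Option (Item C)) : Prop :=
  ∀ k, ((s.cl c).Needs k → P (C.part k) →
      IsFreshest Version.rank {X ∈ stablePart s st | X.key = k} ((D k).map Item.toVersion)) ∧
    (¬ ((s.cl c).Needs k ∧ P (C.part k)) → D k = none)

/-- The client and the snapshot are taken from the ghost state, because slice messages name only the
transaction. Requests carry exactly the keys missing locally, so that answers have no entries for
other keys. -/
def ReadMsg (s : State C) (g : Ghost C) : Msg C → Prop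
  | .sliceReq _ q id χ _ => ∀ x, g.info id = some x →
      ∀ k, k ∈ χ ↔ (s.cl x.1).Needs k ∧ C.part k = q.part
  | .sliceResp q _ id D => ∀ x, g.info id = some x → Answer s x.1 x.2.2 (· = q.part) D
  | .readResp c D => Answer s c (s.cl c).ust (fun _ => True) D
  | _ => True

structure Reads (s : State C) (g : Ghost C) : Prop where
  msg : ∀ m ∈ s.net, ReadMsg s g m
  ctx : ∀ p id r, (s.srv p).reads id = some r →
    Answer s r.client (s.cl r.client).ust (· ∉ r.wait) r.got

theorem Answer.congr {c : C.Client} {st : ℕ} {P : Fin C.N → Prop} {D : C.Key → Option (Item C)}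
    (h : Answer s c st P D) (hphase : (s'.cl c).phase = (s.cl c).phase)
    (hst : stablePart s' st = stablePart s st) : Answer s' c st P D := by
  intro k
  rw [hst]
  simp only [ClientState.Needs, hphase]
  exact h k

theorem Ctl.reading_of_reads (h : Ctl s g) {p : Server C} {id : TxId} {r : ReadCtx C}
    (hr : (s.srv p).reads id = some r) :
    (s.cl r.client).Reading ∧ g.info id = some (r.client, p, (s.cl r.client).ust) ∧
      (s.srv p).TX id = some (s.cl r.client).ust := by
  obtain ⟨⟨χ, D, h1⟩, -⟩ := h.reads p id r hr
  refine ⟨⟨p, id, χ, D, h1⟩, h.cur _ _ _ ?_, (h.run _ _ _ ?_).1⟩ <;> rw [h1] <;> rfl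

/-- An old message or context survives only if its client is reading before and after the step.
Client steps only begin or end a read, so the phase, and with it the set of awaited keys, is the
same; the stable part is frozen. -/
theorem Reads.of_diff (h : Reads s g) (hctl : Ctl s g) (hctl' : Ctl s' g') (hstab : Stab s g)
    (hle : g.Le g') (hst : ∀ st, Safe s st → stablePart s' st = stablePart s st)
    (hcl : ∀ c, ((s'.cl c).phase = (s.cl c).phase ∧ (s'.cl c).ust = (s.cl c).ust) ∨
      ¬ (s.cl c).Reading ∨ ¬ (s'.cl c).Reading)
    (hmsg : ∀ m ∈ s'.net, m ∈ s.net ∨ ReadMsg s' g' m)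
    (hctx : ∀ p id r, (s'.srv p).reads id = some r → (s.srv p).reads id = some r ∨
      Answer s' r.client (s'.cl r.client).ust (· ∉ r.wait) r.got) : Reads s' g' := by
  have hcl' : ∀ c, (s.cl c).Reading → (s'.cl c).Reading →
      (s'.cl c).phase = (s.cl c).phase ∧ (s'.cl c).ust = (s.cl c).ust :=
    fun c h1 h2 => (hcl c).resolve_right fun h3 => h3.elim (absurd h1) (absurd h2)
  have hslice : ∀ p p' id r r' x, (s.srv p).reads id = some r → (s'.srv p').reads id = some r' →
      g'.info id = some x → g.info id = some x ∧ (s'.cl x.1).phase = (s.cl x.1).phase := by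
    intro p p' id r r' x h1 h2 h3
    obtain ⟨h4, h5, -⟩ := hctl.reading_of_reads h1
    obtain ⟨h6, h7, -⟩ := hctl'.reading_of_reads h2
    obtain rfl := hle.info_eq h5 h3
    rw [h3] at h7
    have h8 : r.client = r'.client := congrArg Prod.fst (Option.some.inj h7)
    exact ⟨h5, (hcl' _ h4 (h8 ▸ h6)).1⟩
  constructor
  · intro m hm
    refine (hmsg m hm).elim (fun hm' => ?_) id
    have hr := h.msg m hm'
    have hok := hctl.msg m hm'
    have hok' := hctl'.msg m hm
    cases m
    case sliceReq p q id χ st =>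
      intro x hx
      obtain ⟨⟨r, h1, -⟩, -⟩ := hok
      obtain ⟨⟨r', h2, -⟩, -⟩ := hok'
      obtain ⟨h3, h4⟩ := hslice _ _ _ _ _ _ h1 h2 hx
      simp only [ClientState.Needs, h4]
      exact hr x h3
    case sliceResp q p id D =>
      intro x hx
      obtain ⟨r, h1, -⟩ := hok
      obtain ⟨r', h2, -⟩ := hok'
      obtain ⟨h3, h4⟩ := hslice _ _ _ _ _ _ h1 h2 hx
      exact (hr x h3).congr h4 (hst _ (hstab.info _ x.1 x.2.1 x.2.2 h3))
    case readResp c D =>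
      obtain ⟨h1, h2⟩ := hcl' c hok hok'
      have h3 : Answer s' c (s.cl c).ust (fun _ => True) D :=
        Answer.congr hr h1 (hst _ (hstab.cl c))
      rw [← h2] at h3
      exact h3
    all_goals trivial
  · intro p id r hr
    refine (hctx p id r hr).elim (fun hr' => ?_) _root_.id
    obtain ⟨h1, h2⟩ := hcl' _ (hctl.reading_of_reads hr').1 (hctl'.reading_of_reads hr).1
    have h3 := (h.ctx p id r hr').congr h1 (hst _ (hstab.cl _))
    rw [← h2] at h3
    exact h3

theorem Reads.of_srv (h : Reads s g) (hctl : Ctl s g) (hctl' : Ctl s' g') (hstab : Stab s g)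
    (hle : g.Le g') (hst : ∀ st, Safe s st → stablePart s' st = stablePart s st)
    (hcl : s'.cl = s.cl) (hmsg : ∀ m ∈ s'.net, m ∈ s.net ∨ ReadMsg s' g' m)
    (hctx : ∀ p id r, (s'.srv p).reads id = some r → (s.srv p).reads id = some r ∨
      Answer s' r.client (s'.cl r.client).ust (· ∉ r.wait) r.got) : Reads s' g' :=
  h.of_diff hctl hctl' hstab hle hst (fun _ => .inl (by simp [hcl])) hmsg hctx

theorem reads_eq_some_or {P : Server C → TxId → ReadCtx C → Prop}
    (h : ∀ p, (s'.srv p).reads = (s.srv p).reads) :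
    ∀ p id r, (s'.srv p).reads id = some r → (s.srv p).reads id = some r ∨ P p id r :=
  fun p id r hr => .inl (by rwa [h p] at hr)

theorem reads_setSrv_eq_some {p p' : Server C} {σ : ServerState C} {id id' : TxId}
    {x : Option (ReadCtx C)} {r : ReadCtx C}
    (h : σ.reads = Function.update (s.srv p).reads id x)
    (hr : ((s.setSrv p σ).srv p').reads id' = some r) :
    (s.srv p').reads id' = some r ∨ p' = p ∧ id' = id ∧ x = some r := by
  rw [State.proj_setSrv_update ServerState.reads h] at hr
  split_ifs at hr with hp
  · exact .inr ⟨hp.1, hp.2, hr⟩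
  · exact .inl hr

theorem Reads.gstep (h : Reads s g) (hctl : Ctl s g) (hctl' : Ctl s' g') (hent : Ent s g)
    (hclk : Clk s) (hstab : Stab s g) (hloc : Loc s g) (hs : GStep s g s' g') :
    Reads s' g' := by
  have hle := hs.le hctl
  have hst := fun st => hs.stablePart_eq hctl hclk hloc (st := st)
  have hrest : ∀ {m : Msg C} {net : Multiset (Msg C)}, s.net = m ::ₘ net → ∀ m' ∈ net, m' ∈ s.net :=
    fun hm m' hm' => by rw [hm]; exact Multiset.mem_cons_of_mem hm'
  have hset : ∀ {c : C.Client} {κ : ClientState C}, (¬ (s.cl c).Reading ∨ ¬ κ.Reading) → ∀ c',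
      (((s.setCl c κ).cl c').phase = (s.cl c').phase ∧
        ((s.setCl c κ).cl c').ust = (s.cl c').ust) ∨
      ¬ (s.cl c').Reading ∨ ¬ ((s.setCl c κ).cl c').Reading := by
    intro c κ h1 c'
    rw [State.cl_setCl]
    split_ifs with hcc
    · subst hcc; exact .inr h1
    · exact .inl ⟨rfl, rfl⟩
  cases hs
  case silent hs hq =>
    cases hs
    case startSend c p hc =>
      refine h.of_diff hctl hctl' hstab hle hst
        (hset (.inl (by simp [ClientState.Reading, hc]))) ?_ (reads_eq_some_or fun _ => rfl)
      intro m hm'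
      rcases Multiset.mem_cons.1 hm' with rfl | hm'
      · exact .inr trivial
      · exact .inl hm'
    case startRecv net c p id ust hc hm =>
      exact h.of_diff hctl hctl' hstab hle hst
        (hset (.inl (by simp [ClientState.Reading, hc])))
        (fun m hm' => .inl (hrest hm m hm')) (reads_eq_some_or fun _ => rfl)
    case readSend c p id χ χ' D hc hD hχ =>
      refine h.of_diff hctl hctl' hstab hle hst
        (hset (.inl (by simp [ClientState.Reading, hc]))) ?_ (reads_eq_some_or fun _ => rfl)
      intro m hm'
      rcases Multiset.mem_cons.1 hm' with rfl | hm'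
      · exact .inr trivial
      · exact .inl hm'
    case readRecv net c p id χ D D' I hc hm hD' =>
      exact h.of_diff hctl hctl' hstab hle hst
        (hset (.inr (by simp [ClientState.Reading])))
        (fun m hm' => .inl (hrest hm m hm')) (reads_eq_some_or fun _ => rfl)
    case write c p id kvs hc =>
      exact h.of_diff hctl hctl' hstab hle hst
        (hset (.inl (by simp [ClientState.Reading, hc])))
        (fun m hm' => .inl hm') (reads_eq_some_or fun _ => rfl)
    case finish c p id hc hWS =>
      exact h.of_diff hctl hctl' hstab hle hst
        (hset (.inl (by simp [ClientState.Reading, hc])))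
        (fun m hm' => .inl hm') (reads_eq_some_or fun _ => rfl)
    case commitSend c p id hc hWS =>
      refine h.of_diff hctl hctl' hstab hle hst
        (hset (.inl (by simp [ClientState.Reading, hc]))) ?_ (reads_eq_some_or fun _ => rfl)
      intro m hm'
      rcases Multiset.mem_cons.1 hm' with rfl | hm'
      · exact .inr trivial
      · exact .inl hm'
    case commitRecv net c p id ct hc hm =>
      exact h.of_diff hctl hctl' hstab hle hst
        (hset (.inl (by simp [ClientState.Reading, hc])))
        (fun m hm' => .inl (hrest hm m hm')) (reads_eq_some_or fun _ => rfl)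
    case readServe net c p id χ st parts slice tgt hm hTX hparts hslice htgt =>
      obtain ⟨χ₀, D₀, h1, h2⟩ : MsgOK s g _ := hctl.msg _ (hm ▸ Multiset.mem_cons_self _ _)
      have hinfo := hctl.cur c p id (by rw [h1]; rfl)
      have hneeds : ∀ k, (s.cl c).Needs k ↔ k ∈ χ := by
        intro k
        rw [h2]
        constructor
        · rintro ⟨p', id', χ', D', h3, h4⟩
          rw [h1] at h3
          cases h3
          exact h4
        · exact fun h3 => ⟨_, _, _, _, h1, h3⟩
      refine h.of_srv hctl hctl' hstab hle hst rfl ?_ ?_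
      · intro m hm'
        rcases Multiset.mem_add.1 hm' with hm' | hm'
        · exact .inl (hrest hm m hm')
        · obtain ⟨i, hi, rfl⟩ := Multiset.mem_map.1 hm'
          refine .inr fun x hx k => ?_
          rw [hinfo] at hx
          obtain rfl := Option.some.inj hx
          rw [htgt i hi, hslice, ← hneeds]
          rfl
      · intro p' id' r hr
        rcases reads_setSrv_eq_some rfl hr with h3 | ⟨rfl, rfl, h3⟩
        · exact .inl h3
        · cases h3
          refine .inr fun k => ⟨fun h4 h5 => absurd ?_ h5, fun _ => rfl⟩
          exact (hparts _).2 ⟨k, (hneeds k).1 h4, rfl⟩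
    case sliceServe net p q id χ ust D hm hD =>
      have hmem : _ ∈ s.net := hm ▸ Multiset.mem_cons_self _ _
      obtain ⟨⟨r, h1, h2⟩, c, h3⟩ : MsgOK s g _ := hctl.msg _ hmem
      have hread : ReadMsg s g _ := h.msg _ hmem
      obtain ⟨h4, h5, h6⟩ := hctl.reading_of_reads h1
      rw [h3] at h5
      obtain ⟨rfl, rfl⟩ : c = r.client ∧ ust = (s.cl r.client).ust := by
        have := Option.some.inj h5
        exact ⟨congrArg Prod.fst this, congrArg (fun x => x.2.2) this⟩
      refine h.of_srv hctl hctl' hstab hle hst rfl ?_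
        (reads_eq_some_or (State.proj_setSrv ServerState.reads rfl))
      intro m hm'
      rcases Multiset.mem_cons.1 hm' with rfl | hm'
      swap
      · exact .inl (hrest hm m hm')
      refine .inr fun x hx k => ?_
      rw [h3] at hx
      obtain rfl := Option.some.inj hx
      have hχ := hread _ h3 k
      constructor
      -- The coordinator still lists the transaction as active, so its oldest snapshot is at most
      -- `st`. This protects the items needed here from garbage collection, whichever replica
      -- answers.
      · intro h7 h8
        exact isFreshest_stablePart hctl hent hclk hloc (hstab.cl _)
          (ServerState.oldest_le_of_TX h6) (p := q) h8.symm ((hD k).1 (hχ.2 ⟨h7, h8⟩))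
      · exact fun h7 => (hD k).2 fun h8 => h7 (hχ.1 h8)
    case sliceRecv net q p id D r hm hr =>
      have hmem : _ ∈ s.net := hm ▸ Multiset.mem_cons_self _ _
      obtain ⟨r', h1, h2⟩ : MsgOK s g _ := hctl.msg _ hmem
      obtain rfl : r = r' := by rw [hr] at h1; exact Option.some.inj h1
      obtain ⟨-, h5, -⟩ := hctl.reading_of_reads hr
      have hread : Answer s r.client (s.cl r.client).ust (· = q.part) D := h.msg _ hmem _ h5
      have hctx := h.ctx p id r hr
      refine h.of_srv hctl hctl' hstab hle hst rfl (fun m hm' => .inl (hrest hm m hm')) ?_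
      intro p' id' r' hr'
      rcases reads_setSrv_eq_some rfl hr' with h3 | ⟨rfl, rfl, h3⟩
      · exact .inl h3
      obtain rfl := Option.some.inj h3
      refine .inr fun k => ?_
      -- Answers are empty outside the partitions they come from, so merging them by `or` never has
      -- to choose between two results.
      have hgot : C.part k = q.part → r.got k = none :=
        fun h6 => (hctx k).2 fun h7 => h7.2 (h6 ▸ h2)
      have hD : C.part k ≠ q.part → D k = none := fun h6 => (hread k).2 fun h7 => h6 h7.2
      constructor
      · intro h6 h7
        by_cases h8 : C.part k = q.part
        · have := (hread k).1 h6 h8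
          dsimp only
          rw [hgot h8, Option.or_none]
          exact this
        · have h9 : C.part k ∉ r.wait := fun h9 => h7 (Finset.mem_erase.2 ⟨h8, h9⟩)
          dsimp only
          rw [hD h8, Option.none_or]
          exact (hctx k).1 h6 h9
      · intro h6
        have h6' : ¬ ((s.cl r.client).Needs k ∧ C.part k ∉ r.wait.erase q.part) := h6
        have h7 : D k = none := (hread k).2 fun h8 => h6' ⟨h8.1, by simp [h8.2]⟩
        have h9 : r.got k = none := (hctx k).2 fun h8 =>
          h6' ⟨h8.1, fun h10 => h8.2 (Finset.mem_of_mem_erase h10)⟩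
        simp [h7, h9]
    case readDone p id r hr hw =>
      have hctx := h.ctx p id r hr
      refine h.of_srv hctl hctl' hstab hle hst rfl ?_ ?_
      · intro m hm'
        rcases Multiset.mem_cons.1 hm' with rfl | hm'
        · refine .inr fun k => ?_
          have := hctx k
          simp only [hw, Finset.notMem_empty, not_false_eq_true] at this
          exact this
        · exact .inl hm'
      · intro p' id' r' hr'
        rcases reads_setSrv_eq_some rfl hr' with h3 | ⟨rfl, rfl, h3⟩
        · exact .inl h3
        · cases h3
    all_goals
      refine h.of_srv hctl hctl' hstab hle hst rfl ?_ (reads_eq_some_or ?_)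
      · intro m hm'
        first
          | exact .inl hm'
          | exact .inl (hrest (by assumption) m hm')
          | (rcases Multiset.mem_cons.1 hm' with rfl | hm'
             · exact .inr trivial
             · first
                 | exact .inl hm'
                 | exact .inl (hrest (by assumption) m hm')
                 | (rcases Multiset.mem_add.1 hm' with hm' | hm'
                    · exact .inl hm'
                    · obtain ⟨q, -, rfl⟩ := Multiset.mem_map.1 hm'
                      exact .inr trivial))
          | (rcases Multiset.mem_add.1 hm' with hm' | hm'
             · first | exact .inl hm' | exact .inl (hrest (by assumption) m hm')
             · obtain ⟨q, -, rfl⟩ := Multiset.mem_map.1 hm'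
               exact .inr trivial)
      · first
          | exact fun _ => rfl
          | exact State.proj_setSrv ServerState.reads rfl
  case commitSend c p id hc hWS =>
    refine h.of_diff hctl hctl' hstab hle hst
      (hset (.inl (by simp [ClientState.Reading, hc]))) ?_ (reads_eq_some_or fun _ => rfl)
    intro m hm'
    rcases Multiset.mem_cons.1 hm' with rfl | hm'
    · exact .inr trivial
    · exact .inl hm'
  case startServe net c p ust id hm hid =>
    refine h.of_srv hctl hctl' hstab hle hst rfl ?_
      (reads_eq_some_or (State.proj_setSrv ServerState.reads rfl))
    intro m hm'
    rcases Multiset.mem_cons.1 hm' with rfl | hm'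
    · exact .inr trivial
    · exact .inl (hrest hm m hm')
  case prepare net p q id ust ht D t hlc ust' pt hm _ _ _ _ =>
    refine h.of_srv hctl hctl' hstab hle hst rfl ?_
      (reads_eq_some_or (State.proj_setSrv ServerState.reads rfl))
    intro m hm'
    rcases Multiset.mem_cons.1 hm' with rfl | hm'
    · exact .inr trivial
    · exact .inl (hrest hm m hm')
  case commit p id r pt ct hr hpt hct =>
    refine h.of_srv hctl hctl' hstab hle hst rfl ?_
      (reads_eq_some_or (State.proj_setSrv ServerState.reads rfl))
    intro m hm'
    rcases Multiset.mem_cons.1 hm' with rfl | hm'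
    · exact .inr trivial
    rcases Multiset.mem_add.1 hm' with hm' | hm'
    · exact .inl hm'
    · obtain ⟨q, -, rfl⟩ := Multiset.mem_map.1 hm'
      exact .inr trivial

/-! ### Results of reads -/

/-- The field `lookup` says that the results found locally remain current while a read waits. The
read set holds an own write only for keys still in the write set (`own`), and otherwise freshest
versions of the snapshot (`version`), so that repeated reads are correct. -/
structure Res (s : State C) : Prop where
  lookup : ∀ c p id χ D, (s.cl c).phase = .reading p id χ D →
    ∀ k, (k ∈ χ → D k = (s.cl c).lookup k) ∧ (k ∉ χ → D k = none)
  own : ∀ c p id, (s.cl c).phase.cur = some (p, id) → ∀ k x, (s.cl c).RS k = some (.inl x) →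
    (s.cl c).WS k ≠ none
  version : ∀ c p id, (s.cl c).phase.cur = some (p, id) → ∀ k X, (s.cl c).RS k = some (.inr X) →
    IsFreshest Version.rank {X ∈ snapshot s c id (s.cl c).ust | X.key = k} (some X)
  started : ∀ i c id χ D, s.hist[i]? = some (.read c id χ D) →
    ∃ st cache, .start c id st cache ∈ s.hist.take i
  correct : ∀ i c id χ D st cache, s.hist[i]? = some (.read c id χ D) →
    .start c id st cache ∈ s.hist → ∀ k ∈ χ,
      ReadsCorrectly (bufferedWrites (s.hist.take i) id) (snapshot s c id st) k (D k)

theorem readsCorrectly_of_read {c : C.Client} {p : Server C} {id : TxId} {χ : Finset C.Key}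
    {D D' : C.Key → Option (Result C)} {I : C.Key → Option (Item C)} (h : Res s) (hord : Ord s g)
    (hcache : Cache s) (hc : (s.cl c).phase = .reading p id χ D)
    (hI : Answer s c (s.cl c).ust (fun _ => True) I)
    (hD' : ∀ k, D' k = (D k).or ((I k).map (fun d => .inr d.toVersion))) {k : C.Key} (hk : k ∈ χ) :
    ReadsCorrectly (s.cl c).WS (snapshot s c id (s.cl c).ust) k (D' k) := by
  have hcur : (s.cl c).phase.cur = some (p, id) := by rw [hc]; rfl
  have hD := (h.lookup c p id χ D hc k).1 hk
  have hown := hcache.start c id _ _ (hord.start c p id hcur) k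
  rw [ReadsCorrectly]
  rw [ClientState.lookup] at hD
  cases hW : (s.cl c).WS k with
  | some x => simp [hD', hD, hW]
  | none =>
  cases hR : (s.cl c).RS k with
  | some r =>
    cases r with
    -- The read set may hold an outdated own write, but the write set still has the key and takes
    -- precedence.
    | inl x => exact absurd hW (h.own c p id hcur k x hR)
    | inr X => exact ⟨some X, by simp [hD', hD, hW, hR], h.version c p id hcur k X hR⟩
  | none =>
  cases hC : (s.cl c).WC k with
  | some X =>
    refine ⟨some X, by simp [hD', hD, hW, hR, hC], ?_⟩
    rw [hC] at hown
    refine ⟨⟨.inr hown.1.1, hown.1.2⟩, ?_⟩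
    rintro Y ⟨hY | hY, hYk⟩
    -- Cached versions are above `st`, hence fresher than the whole stable part.
    · exact Version.rank_le_of_ut_lt (hY.2.trans_lt hown.1.1.2.1)
    · exact hown.2 Y ⟨hY, hYk⟩
  | none =>
    have hDn : D k = none := by simp [hD, hW, hR, hC]
    refine ⟨(I k).map Item.toVersion, ?_, ?_⟩
    · simp [hD', hDn, Function.comp_def]
    · rw [hC] at hown
      -- An empty cache entry means that the own part has no version of the key, so the answer of
      -- the server for the stable part is the answer for the snapshot.
      have : {X ∈ snapshot s c id (s.cl c).ust | X.key = k} =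
          {X ∈ stablePart s (s.cl c).ust | X.key = k} := by
        ext X
        refine and_congr_left fun hX => ⟨fun h1 => h1.resolve_right fun h2 => ?_, .inl⟩
        exact (Set.eq_empty_iff_forall_notMem.1 hown) X ⟨h2, hX⟩
      rw [this]
      exact (hI k).1 ⟨p, id, χ, D, hc, hk, hDn⟩ trivial

theorem Res.log {o : Op C} (h : Res s) (hh : s'.hist = s.hist ++ [o])
    (hcl : ∀ c, c ≠ o.client → s'.cl c = s.cl c)
    (hsnap : ∀ c id st cache, .start c id st cache ∈ s.hist →
      snapshot s' c id st = snapshot s c id st)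
    (hord : Ord s g) (hord' : Ord s' g')
    (hphase : ¬ (s'.cl o.client).Reading)
    (hown : ∀ p id, (s'.cl o.client).phase.cur = some (p, id) → ∀ k x,
      (s'.cl o.client).RS k = some (.inl x) → (s'.cl o.client).WS k ≠ none)
    (hversion : ∀ p id, (s'.cl o.client).phase.cur = some (p, id) → ∀ k X,
      (s'.cl o.client).RS k = some (.inr X) →
        IsFreshest Version.rank
          {X ∈ snapshot s' o.client id (s'.cl o.client).ust | X.key = k} (some X))
    (hread : ∀ c id χ D, o = .read c id χ D → ∃ st cache, .start c id st cache ∈ s.hist ∧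
      ∀ k ∈ χ, ReadsCorrectly (bufferedWrites s.hist id) (snapshot s c id st) k (D k)) :
    Res s' := by
  have hget : ∀ i o', s'.hist[i]? = some o' →
      i < s.hist.length ∧ s.hist[i]? = some o' ∧ s'.hist.take i = s.hist.take i ∨
        o' = o ∧ s'.hist.take i = s.hist := by
    intro i o' hi
    rw [hh] at hi ⊢
    have hil := (List.getElem?_eq_some_iff.1 hi).1
    rw [List.length_append, List.length_singleton] at hil
    by_cases hlt : i < s.hist.length
    · rw [List.getElem?_append_left hlt] at hi
      exact .inl ⟨hlt, hi, List.take_append_of_le_length hlt.le⟩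
    · obtain rfl : i = s.hist.length := by omega
      simp only [List.getElem?_concat_length, Option.some.injEq] at hi
      exact .inr ⟨hi.symm, by simp⟩
  have hstart : ∀ c id st st' cache cache', .start c id st cache ∈ s.hist →
      .start c id st' cache' ∈ s'.hist → st' = st := by
    intro c id st st' cache cache' h1 h2
    obtain ⟨p', h3⟩ := hord'.info _ _ _ _ h2
    obtain ⟨p, h4⟩ := hord'.info _ _ _ _ (by rw [hh]; exact List.mem_append_left _ h1)
    rw [h3] at h4
    exact congrArg (fun x => x.2.2) (Option.some.inj h4)
  constructor
  · intro c p id χ D hc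
    by_cases hco : c = o.client
    · subst hco; exact absurd ⟨p, id, χ, D, hc⟩ hphase
    · rw [hcl c hco] at hc ⊢
      exact h.lookup c p id χ D hc
  · intro c p id hc
    by_cases hco : c = o.client
    · subst hco; exact hown p id hc
    · rw [hcl c hco] at hc ⊢
      exact h.own c p id hc
  · intro c p id hc
    by_cases hco : c = o.client
    · subst hco; exact hversion p id hc
    · rw [hcl c hco] at hc ⊢
      rw [hsnap c id _ _ (hord.start c p id hc)]
      exact h.version c p id hc
  · intro i c id χ D hi
    rcases hget i _ hi with ⟨-, h1, h2⟩ | ⟨h1, h2⟩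
    · rw [h2]; exact h.started i c id χ D h1
    · rw [h2]
      obtain ⟨st, cache, h3, -⟩ := hread _ _ _ _ h1.symm
      exact ⟨st, cache, h3⟩
  · intro i c id χ D st cache hi ho k hk
    rcases hget i _ hi with ⟨-, h1, h2⟩ | ⟨h1, h2⟩
    · obtain ⟨st', cache', h3⟩ := h.started i c id χ D h1
      have h3 := List.mem_of_mem_take h3
      obtain rfl := hstart _ _ _ _ _ _ h3 ho
      rw [h2, hsnap _ _ _ _ h3]
      exact h.correct i c id χ D st cache' h1 h3 k hk
    · obtain ⟨st', cache', h3, h4⟩ := hread _ _ _ _ h1.symm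
      obtain rfl := hstart _ _ _ _ _ _ h3 ho
      rw [h2, hsnap _ _ _ _ h3]
      exact h4 k hk

/-- Lets correctness of a read, once established, hold in all later states. -/
theorem GStep.snapshot_eq (hs : GStep s g s' g') (hctl : Ctl s g) (hctl' : Ctl s' g')
    (hclk : Clk s) (hloc : Loc s g) (hstab : Stab s g) (hord : Ord s g) (c : C.Client) (id : TxId)
    (st : ℕ) (cache : C.Key → Option (Version C)) (hb : .start c id st cache ∈ s.hist) :
    snapshot s' c id st = snapshot s c id st := by
  obtain ⟨p, hp⟩ := hord.info _ _ _ _ hb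
  rw [snapshot, snapshot, hs.stablePart_eq hctl hclk hloc (hstab.info _ _ _ _ hp),
    hs.ownPart_eq hctl hctl' hord hb]

theorem Res.gstep (h : Res s) (hctl : Ctl s g) (hctl' : Ctl s' g') (hclk : Clk s)
    (hloc : Loc s g) (hstab : Stab s g) (hord : Ord s g) (hord' : Ord s' g') (hcache : Cache s)
    (hreads : Reads s g) (hs : GStep s g s' g') : Res s' := by
  have hsnap := hs.snapshot_eq hctl hctl' hclk hloc hstab hord
  have hs := hs.lstep
  cases hs
  case quiet hq =>
    constructor
    · intro c p id χ D hc k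
      have hl : (s'.cl c).lookup k = (s.cl c).lookup k := by
        simp only [ClientState.lookup, hq.WS, hq.WC, hq.RS]
      rw [hl]
      rcases hq.reading c p id χ D hc with h1 | h1
      · exact h.lookup c p id χ D h1 k
      · exact h1 k
    · intro c p id hc
      rw [hq.WS, hq.RS]
      exact h.own c p id (hq.cur _ _ hc)
    · intro c p id hc
      have hc' := hq.cur _ _ hc
      rw [hq.ust, hq.RS, hsnap c id _ _ (hord.start c p id hc')]
      exact h.version c p id hc'
    · rw [hq.hist]
      exact h.started
    · rw [hq.hist]
      intro i c id χ D st cache hi ho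
      rw [hsnap c id _ _ ho]
      exact h.correct i c id χ D st cache hi ho
  case startRecv net c p id ust hc hm =>
    refine h.log (o := .start c id ust _) rfl ?_ hsnap hord hord' ?_ ?_ ?_ nofun
    · exact fun c' hc' => State.cl_setCl_ne _ _ hc'
    · simp [Op.client, ClientState.Reading]
    · simp [Op.client]
    · simp [Op.client]
  case readRecv net c p id χ D D' I hc hm hD' =>
    have hcur : (s.cl c).phase.cur = some (p, id) := by rw [hc]; rfl
    have hI : Answer s c (s.cl c).ust (fun _ => True) I :=
      hreads.msg (.readResp c I) (hm ▸ Multiset.mem_cons_self _ _)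
    have hcorrect := fun k hk => readsCorrectly_of_read h hord hcache hc hI hD' (k := k) hk
    have hstart := hord.start c p id hcur
    -- Keys that were not asked for get no result, so they keep their old entries in the read set.
    have hnot : ∀ k, k ∉ χ → D' k = none := by
      intro k hk
      have h1 : I k = none := (hI k).2 fun ⟨⟨p', id', χ', D₀, h2, h3, _⟩, _⟩ => by
        rw [hc] at h2
        cases h2
        exact hk h3
      rw [hD', ((h.lookup c p id χ D hc) k).2 hk, h1]
      rfl
    refine h.log (o := .read c id χ D') rfl ?_ hsnap hord hord' ?_ ?_ ?_ ?_
    · exact fun c' hc' => State.cl_setCl_ne _ _ hc'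
    · simp [Op.client, ClientState.Reading]
    · simp only [Op.client, State.cl_log, State.cl_withNet, State.cl_setCl_self]
      intro p' id' _ k x hx
      by_cases hk : k ∈ χ
      · cases hD : D' k with
        | none =>
          rw [hD, Option.none_or] at hx
          exact h.own c p id hcur k x hx
        | some r =>
          intro hW
          have h1 := hcorrect k hk
          rw [ReadsCorrectly, hW, hD] at h1
          obtain ⟨oX, h1, -⟩ := h1
          rw [hD, Option.some_or] at hx
          rw [hx] at h1
          cases oX <;> cases h1
      · rw [hnot k hk, Option.none_or] at hx
        exact h.own c p id hcur k x hx
    · simp only [Op.client, State.cl_log, State.cl_withNet, State.cl_setCl_self]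
      intro p' id' hid k X hX
      obtain ⟨rfl, rfl⟩ : p = p' ∧ id = id' := by
        cases hid; exact ⟨rfl, rfl⟩
      rw [hsnap c id _ _ hstart]
      by_cases hk : k ∈ χ
      · cases hD : D' k with
        | none =>
          rw [hD, Option.none_or] at hX
          exact h.version c p id hcur k X hX
        | some r =>
          have h1 := hcorrect k hk
          rw [hD, Option.some_or] at hX
          rw [ReadsCorrectly, hD, hX] at h1
          cases hW : (s.cl c).WS k with
          | some x => rw [hW] at h1; cases h1
          | none =>
            rw [hW] at h1
            obtain ⟨oX, h1, h2⟩ := h1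
            cases oX <;> cases h1
            exact h2
      · rw [hnot k hk, Option.none_or] at hX
        exact h.version c p id hcur k X hX
    · rintro c' id' χ' D₀ ⟨rfl, rfl, rfl, rfl⟩
      refine ⟨_, _, hstart, fun k hk => ?_⟩
      rw [← hord.ws c p id hcur]
      exact hcorrect k hk
  case write c p id kvs hc =>
    have hcur : (s.cl c).phase.cur = some (p, id) := by rw [hc]; rfl
    refine h.log (o := .write c id kvs) rfl ?_ hsnap hord hord' ?_ ?_ ?_ nofun
    · exact fun c' hc' => State.cl_setCl_ne _ _ hc'
    · simp [Op.client, ClientState.Reading, hc]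
    · simp only [Op.client, State.cl_log, State.cl_setCl_self]
      intro p' id' _ k x hx
      exact writeAll_ne_none_of_ne_none _ (h.own c p id hcur k x hx)
    · simp only [Op.client, State.cl_log, State.cl_setCl_self]
      intro p' id' hid k X hX
      rw [hsnap c id' _ _ (hord.start c p' id' hid)]
      exact h.version c p' id' hid k X hX
  case commitRecv net c p id ct hc hm =>
    refine h.log (o := .commit c id ct) rfl ?_ hsnap hord hord' ?_ ?_ ?_ nofun
    · exact fun c' hc' => State.cl_setCl_ne _ _ hc'
    · simp [Op.client, ClientState.Reading]
    · simp [Op.client, Phase.cur]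
    · simp [Op.client, Phase.cur]

/-! ### Causality -/

theorem pairwise_getElem? {α : Type*} {R : α → α → Prop} {l : List α} (h : l.Pairwise R) {i j : ℕ}
    {a b : α} (hij : i < j) (hi : l[i]? = some a) (hj : l[j]? = some b) : R a b := by
  obtain ⟨hi', rfl⟩ := List.getElem?_eq_some_iff.1 hi
  obtain ⟨hj', rfl⟩ := List.getElem?_eq_some_iff.1 hj
  exact List.pairwise_iff_getElem.1 h i j hi' hj' hij

theorem Ord.exists_version (hord : Ord s g) (hctl : Ctl s g) {c : C.Client} {id : TxId}
    {kvs : List (C.Key × C.Val)} {k : C.Key} {t : ℕ} (ho : .write c id kvs ∈ s.hist)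
    (hk : k ∈ kvs.map Prod.fst) (ht : g.ct id = some t) :
    ∃ X ∈ s.versions, X.key = k ∧ X.tx = id ∧ X.ut = t := by
  obtain ⟨W, h, hf, -⟩ := hctl.ct _ _ ht
  have hW := bufferedWrites_ne_none ho hk
  rw [← hord.fin _ _ _ hf] at hW
  obtain ⟨x, hx⟩ := Option.ne_none_iff_exists'.1 hW
  exact ⟨⟨k, x, t, id⟩, (hctl.versions _).2 ⟨ht, W, h, hf, hx⟩, rfl, rfl, rfl⟩

theorem Ctl.version_info (hctl : Ctl s g) {X : Version C} (hX : X ∈ s.versions) :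
    ∃ x W h, g.ct X.tx = some X.ut ∧ g.info X.tx = some x ∧ g.fin X.tx = some (W, h) ∧
      x.2.2 < X.ut ∧ h < X.ut := by
  obtain ⟨h1, W, h, h2, -⟩ := (hctl.versions X).1 hX
  obtain ⟨⟨c, p, st⟩, hx⟩ := Option.ne_none_iff_exists'.1 (hctl.fin _ _ _ h2).1
  exact ⟨_, W, h, h1, hx, h2, hctl.lt_ct h1 hx h2⟩

theorem Ctl.client_eq (hctl : Ctl s g) {o o' : Op C} (ho : o ∈ s.hist) (ho' : o' ∈ s.hist)
    (h : o.tx = o'.tx) : o.client = o'.client := by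
  obtain ⟨p, st, h1⟩ := hctl.hist o ho
  obtain ⟨p', st', h2⟩ := hctl.hist o' ho'
  rw [h, h2] at h1
  exact congrArg Prod.fst (Option.some.inj h1).symm

theorem Ord.committedBefore_of_lt (hord : Ord s g) {i j : ℕ} {c : C.Client} {id : TxId}
    {kvs : List (C.Key × C.Val)} {k : C.Key} {o : Op C} (hij : i < j)
    (hi : s.hist[i]? = some (.write c id kvs)) (hk : k ∈ kvs.map Prod.fst)
    (hj : s.hist[j]? = some o) (hc : o.client = c) (hid : id ≠ o.tx) :
    CommittedBefore s.hist c id o.tx := by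
  refine pairwise_getElem? hord.before hij hi hj c id kvs rfl ?_ hc hid
  rintro rfl
  simp at hk

/-- The `hwt` of the later transaction is at least the earlier commit timestamp, and the later
commit timestamp is strictly above it. -/
theorem Ord.exists_older_version (hord : Ord s g) (hctl : Ctl s g) {c : C.Client} {id : TxId}
    {kvs : List (C.Key × C.Val)} {k : C.Key} {Y : Version C} (ho : .write c id kvs ∈ s.hist)
    (hk : k ∈ kvs.map Prod.fst) (hY : Y ∈ s.versions) (hb : CommittedBefore s.hist c id Y.tx) :
    ∃ X ∈ s.versions, X.key = k ∧ X.tx = id ∧ X.ut < Y.ut := by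
  obtain ⟨t, ht⟩ := hb.commit_mem
  have hct := (hord.commit _ _ _ ht).1
  obtain ⟨X, h1, h2, h3, h4⟩ := hord.exists_version hctl ho hk hct
  obtain ⟨x, W, h, -, -, h5, -, h6⟩ := hctl.version_info hY
  have h7 := hord.le_fin _ _ _ _ _ hb h5 _ hct
  exact ⟨X, h1, h2, h3, by omega⟩

/-- The first transaction has no operation after its commit, and the second none before its start.
-/
theorem Ord.lt_of_committedBefore (hord : Ord s g) {i j : ℕ} {c : C.Client} {o o' : Op C}
    (hb : CommittedBefore s.hist c o.tx o'.tx) (hi : s.hist[i]? = some o)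
    (hj : s.hist[j]? = some o') : i < j := by
  obtain ⟨m, n, ct, st, cache, hmn, hm, hn⟩ := hb
  have him : i ≤ m := by
    by_contra hlt
    exact (pairwise_getElem? hord.order (not_le.1 hlt) hm hi).1 _ _ _ rfl rfl
  have hnj : n ≤ j := by
    by_contra hlt
    exact (pairwise_getElem? hord.order (not_le.1 hlt) hj hn).2 _ _ _ _ rfl rfl
  omega

theorem Ord.committedBefore_trans (hord : Ord s g) {c : C.Client} {x y z : TxId}
    (h : CommittedBefore s.hist c x y) (h' : CommittedBefore s.hist c y z) :
    CommittedBefore s.hist c x z := by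
  obtain ⟨m, n, ct, st, cache, hmn, hm, hn⟩ := h
  obtain ⟨m', n', ct', st', cache', hmn', hm', hn'⟩ := h'
  refine ⟨m, n', ct, st', cache', ?_, hm, hn'⟩
  have : n ≤ m' := by
    by_contra hlt
    exact (pairwise_getElem? hord.order (not_le.1 hlt) hm' hn).2 _ _ _ _ rfl rfl
  omega

theorem Ord.st_le_of_committedBefore (hord : Ord s g) {c : C.Client} {x y : TxId}
    {a b : C.Client × Server C × ℕ} (h : CommittedBefore s.hist c x y) (ha : g.info x = some a)
    (hb : g.info y = some b) : a.2.2 ≤ b.2.2 := by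
  obtain ⟨m, n, ct, st, cache, hmn, hm, hn⟩ := h
  exact pairwise_getElem? hord.mono hmn hm hn rfl a b ha hb

/-- The operation at position `b` comes after position `i` at the client `c`, or its snapshot contains
the version of `k` written by `id`. -/
def Knows (s : State C) (g : Ghost C) (i : ℕ) (c : C.Client) (k : C.Key) (id : TxId) (b : ℕ) :
    Prop :=
  ∃ o, s.hist[b]? = some o ∧ (o.client = c ∧ i < b ∨
    ∃ X ∈ s.versions, X.key = k ∧ X.tx = id ∧ ∃ x, g.info o.tx = some x ∧ X.ut ≤ x.2.2)

/-- Induction along the causal chain. Client order preserves knowledge because snapshot timestamps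
of a client do not decrease. For a read of `Y`, membership of `Y` in the reader's snapshot gives two
cases: from the stable part, the timestamp of `Y` bounds that of the original version; from the own
part, writer and reader are the same client and the step is one in client order. -/
theorem knows_of_causes (hctl : Ctl s g) (hord : Ord s g) (hres : Res s) {i : ℕ} {c : C.Client}
    {k : C.Key} {id : TxId} {kvs : List (C.Key × C.Val)}
    (hi : s.hist[i]? = some (.write c id kvs)) (hk : k ∈ kvs.map Prod.fst) {a b : ℕ}
    (hab : Causes s.hist a b) : a = i ∨ Knows s g i c k id a → Knows s g i c k id b := by
  have hmem : .write c id kvs ∈ s.hist := List.mem_of_getElem? hi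
  induction hab with
  | trans _ _ ih1 ih2 => exact fun h => ih2 (.inr (ih1 h))
  | @thread a b o o' ha hb hlt hoo =>
    rintro (rfl | ⟨o₁, h1, h2⟩)
    · rw [ha] at hi
      obtain rfl := Option.some.inj hi
      exact ⟨o', hb, .inl ⟨hoo.symm, hlt⟩⟩
    · rw [ha] at h1
      obtain rfl := Option.some.inj h1
      refine ⟨o', hb, ?_⟩
      rcases h2 with ⟨h2, h3⟩ | ⟨X, h2, h3, h4, x, h5, h6⟩
      · exact .inl ⟨hoo ▸ h2, h3.trans hlt⟩
      · obtain ⟨p, st, h7⟩ := hctl.hist o' (List.mem_of_getElem? hb)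
        exact .inr ⟨X, h2, h3, h4, _, h7,
          h6.trans (pairwise_getElem? hord.mono hlt ha hb hoo x _ h5 h7)⟩
  | @readsFrom a b k' id' ha hb =>
    obtain ⟨c₁, kvs₁, ha, hk₁⟩ := ha
    obtain ⟨c₂, id₂, χ, D, Y, hb, hχ, hD, hYk, hYid⟩ := hb
    have ha_mem : Op.write c₁ id' kvs₁ ∈ s.hist := List.mem_of_getElem? ha
    have hb_mem : Op.read c₂ id₂ χ D ∈ s.hist := List.mem_of_getElem? hb
    obtain ⟨st, cache, hstart⟩ := hres.started _ _ _ _ _ hb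
    have hstart := List.mem_of_mem_take hstart
    obtain ⟨p₂, hinfo₂⟩ := hord.info _ _ _ _ hstart
    have hY : Y ∈ snapshot s c₂ id₂ st := by
      have h1 := hres.correct _ _ _ _ _ _ _ hb hstart k' hχ
      rw [ReadsCorrectly, hD] at h1
      cases hW : bufferedWrites (s.hist.take b) id₂ k' with
      | some x => rw [hW] at h1; cases h1
      | none =>
        rw [hW] at h1
        obtain ⟨oX, h1, h2⟩ := h1
        cases oX <;> cases h1
        exact h2.1.1
    have hYv : Y ∈ s.versions := hY.elim And.left And.left
    obtain ⟨x₁, W₁, hw₁, hct₁, hinfo₁, hfin₁, hst₁, -⟩ := hctl.version_info hYv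
    intro h
    refine ⟨_, hb, ?_⟩
    rcases hY with ⟨-, hut⟩ | ⟨-, hut, hbef⟩
    · refine .inr ?_
      -- The original version and `Y` may come from one transaction, from an earlier and a later one
      -- of client `c`, or the snapshot of the writer of `Y` may already contain the original
      -- version. In each case the timestamp is at most that of `Y`, which is at most `st`.
      suffices ∃ X ∈ s.versions, X.key = k ∧ X.tx = id ∧ X.ut ≤ Y.ut by
        obtain ⟨X, h1, h2, h3, h4⟩ := this
        exact ⟨X, h1, h2, h3, _, hinfo₂, h4.trans hut⟩
      have hsame : id = id' → ∃ X ∈ s.versions, X.key = k ∧ X.tx = id ∧ X.ut ≤ Y.ut := by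
        rintro rfl
        obtain ⟨X, h1, h2, h3, h4⟩ := hord.exists_version hctl hmem hk (hYid ▸ hct₁)
        exact ⟨X, h1, h2, h3, h4.le⟩
      rcases h with rfl | ⟨o, h1, ⟨h2, h3⟩ | ⟨X, h2, h3, h4, x, h5, h6⟩⟩
      · rw [ha] at hi
        cases hi
        exact hsame rfl
      · rw [ha] at h1
        cases h1
        by_cases hid : id = id'
        · exact hsame hid
        · have h4 := hord.committedBefore_of_lt h3 hi hk ha h2 hid
          obtain ⟨X, h5, h6, h7, h8⟩ := hord.exists_older_version hctl hmem hk hYv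
            (show CommittedBefore s.hist c id Y.tx from hYid ▸ h4)
          exact ⟨X, h5, h6, h7, h8.le⟩
      · rw [ha] at h1
        cases h1
        rw [hYid] at hinfo₁
        have h7 : g.info id' = some x := h5
        rw [hinfo₁] at h7
        obtain rfl := Option.some.inj h7
        exact ⟨X, h2, h3, h4, h6.trans hst₁.le⟩
    · rw [hYid] at hbef
      have hlt : a < b := hord.lt_of_committedBefore hbef ha hb
      have hc₁ : c₁ = c₂ := by
        obtain ⟨t, ht⟩ := hbef.commit_mem
        exact hctl.client_eq ha_mem ht rfl
      rcases h with rfl | ⟨o, h1, ⟨h2, h3⟩ | ⟨X, h2, h3, h4, x, h5, h6⟩⟩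
      · rw [ha] at hi
        cases hi
        exact .inl ⟨hc₁.symm, hlt⟩
      · rw [ha] at h1
        cases h1
        exact .inl ⟨hc₁ ▸ h2, h3.trans hlt⟩
      · rw [ha] at h1
        cases h1
        exact .inr ⟨X, h2, h3, h4, _, hinfo₂,
          h6.trans (hord.st_le_of_committedBefore hbef h5 hinfo₂)⟩

/-- Records not only that timestamps respect dependency, but also where the dependency came from.
The origin is needed when the dependent version is in the own part, where timestamps alone do not
decide membership. -/
theorem exists_version_of_dependsOn (hctl : Ctl s g) (hord : Ord s g) (hres : Res s)
    {Y : Version C} (hY : Y ∈ s.versions) {k : C.Key} {id : TxId}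
    (hd : DependsOn s.hist Y.key Y.tx k id) :
    ∃ X ∈ s.versions, X.key = k ∧ X.tx = id ∧ (id = Y.tx ∧ X.ut = Y.ut ∨
      X.ut < Y.ut ∧ ((∃ c, CommittedBefore s.hist c id Y.tx) ∨
        ∃ x, g.info Y.tx = some x ∧ X.ut ≤ x.2.2)) := by
  obtain ⟨i, j, ⟨c, kvs, hi, hk⟩, ⟨c', kvs', hj, hk'⟩, hij⟩ := hd
  obtain ⟨x₁, W₁, hw₁, hct₁, hinfo₁, hfin₁, hst₁, -⟩ := hctl.version_info hY
  have hmem : .write c id kvs ∈ s.hist := List.mem_of_getElem? hi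
  obtain ⟨o, h1, ⟨h2, h3⟩ | ⟨X, h2, h3, h4, x, h5, h6⟩⟩ :=
    knows_of_causes hctl hord hres hi hk hij (.inl rfl)
  · by_cases hid : id = Y.tx
    · subst hid
      obtain ⟨X, h4, h5, h6, h7⟩ := hord.exists_version hctl hmem hk hct₁
      exact ⟨X, h4, h5, h6, .inl ⟨rfl, h7⟩⟩
    · rw [hj] at h1
      cases h1
      have h4 := hord.committedBefore_of_lt h3 hi hk hj h2 hid
      obtain ⟨X, h5, h6, h7, h8⟩ := hord.exists_older_version hctl hmem hk hY h4
      exact ⟨X, h5, h6, h7, .inr ⟨h8, .inl ⟨_, h4⟩⟩⟩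
  · rw [hj] at h1
    cases h1
    have h7 : g.info Y.tx = some x := h5
    rw [hinfo₁] at h7
    obtain rfl := Option.some.inj h7
    exact ⟨X, h2, h3, h4, .inr ⟨h6.trans_lt hst₁, .inr ⟨_, hinfo₁, h6⟩⟩⟩

theorem CommittedBefore.client_eq (hctl : Ctl s g) {c c' : C.Client} {x y z : TxId}
    (h : CommittedBefore s.hist c x y) (h' : CommittedBefore s.hist c' y z) : c = c' := by
  obtain ⟨st, cache, h1⟩ := h.start_mem
  obtain ⟨t, h2⟩ := h'.commit_mem
  exact hctl.client_eq h1 h2 rfl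

theorem isCausalSnapshot (hctl : Ctl s g) (hord : Ord s g) (hres : Res s) {c : C.Client} {id : TxId}
    {st : ℕ} {cache : C.Key → Option (Version C)} (hstart : .start c id st cache ∈ s.hist) :
    IsCausalSnapshot s (snapshot s c id st) := by
  obtain ⟨p, hinfo⟩ := hord.info _ _ _ _ hstart
  have hsub : snapshot s c id st ⊆ s.versions := fun X hX => hX.elim And.left And.left
  have hclosed : ∀ Y ∈ snapshot s c id st, ∀ k id', DependsOn s.hist Y.key Y.tx k id' →
      ∃ X ∈ snapshot s c id st, X.key = k ∧ X.tx = id' := by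
    intro Y hY k id' hd
    obtain ⟨X, h1, h2, h3, h4⟩ := exists_version_of_dependsOn hctl hord hres (hsub hY) hd
    refine ⟨X, ?_, h2, h3⟩
    by_cases hX : X.ut ≤ st
    -- If the dependency is above `st`, so is `Y`, which must then be in the own part. The
    -- dependency cannot come from the snapshot of the transaction of `Y`, as that timestamp is at
    -- most `st`; so it comes from the same or an earlier transaction of `c`.
    · exact .inl ⟨h1, hX⟩
    refine .inr ⟨h1, not_le.1 hX, ?_⟩
    rw [h3]
    rcases hY with hY | hY
    · have := hY.2
      rcases h4 with ⟨-, h4⟩ | ⟨h4, -⟩ <;> omega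
    · rcases h4 with ⟨rfl, -⟩ | ⟨-, ⟨c', h4⟩ | ⟨x, h4, h5⟩⟩
      · exact hY.2.2
      · obtain rfl := h4.client_eq hctl hY.2.2
        exact hord.committedBefore_trans h4 hY.2.2
      · exact absurd (h5.trans (hord.st_le_of_committedBefore hY.2.2 h4 hinfo)) hX
  refine ⟨hsub, hclosed, ?_⟩
  rintro X Y ⟨⟨hX, -⟩, hmax⟩ hY ⟨X', hX', hkey, hne, hd, hd'⟩
  -- The intermediate version is itself in the snapshot by closure, so its rank is at most that of
  -- `X`. But it depends on `X`: it is either `X` itself or has a strictly larger timestamp.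
  obtain ⟨Z, h1, h2, h3⟩ := hclosed Y hY _ _ hd'
  obtain rfl := hctl.version_unique (hsub h1) hX' h2 h3
  have h4 := hmax Z ⟨h1, hkey⟩
  obtain ⟨Z', h5, h6, h7, h8⟩ := exists_version_of_dependsOn hctl hord hres hX' hd
  obtain rfl := hctl.version_unique h5 (hsub hX) h6 h7
  rcases h8 with ⟨h8, -⟩ | ⟨h8, -⟩
  · exact hne (hctl.version_unique hX' h5 hkey h8.symm)
  · rw [Version.rank, Version.rank, Prod.Lex.le_iff] at h4
    rcases h4 with h4 | ⟨h4, -⟩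
    · exact absurd h8 (not_lt.2 h4.le)
    · exact absurd h4 (ne_of_gt h8)

/-! ### The invariant -/

/-- The parts are kept separate because each is preserved using only some of the others. Several
preservation proofs also use the new state's `Ctl` or `Ord`, which are therefore established first.
-/
structure Inv (s : State C) (g : Ghost C) : Prop where
  ctl : Ctl s g
  ent : Ent s g
  clk : Clk s
  stab : Stab s g
  old : Old s
  loc : Loc s g
  ord : Ord s g
  cache : Cache s
  reads : Reads s g
  res : Res s

theorem GStep.step (hs : GStep s g s' g') : Step s s' := by
  cases hs
  case silent h _ => exact h
  case startServe net c p ust id hm hid => exact .startServe _ net c p ust id hm hid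
  case commitSend c p id hc hWS => exact .commitSend _ c p id hc hWS
  case prepare net p q id ust ht D t hlc ust' pt hm h1 h2 h3 h4 =>
    exact .prepare _ net p q id ust ht D t hlc ust' pt hm h1 h2 h3 h4
  case commit p id r pt ct h1 h2 h3 => exact .decide _ p id r pt ct h1 h2 h3

theorem Inv.gstep (h : Inv s g) (hs : GStep s g s' g') : Inv s' g' := by
  have hctl := h.ctl.gstep hs
  have hord := h.ord.gstep h.ctl hs
  exact
    { ctl := hctl
      ent := h.ent.gstep h.ctl hs
      clk := h.clk.gstep h.ctl h.ent h.stab hs.step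
      stab := h.stab.gstep h.ctl h.ent h.clk hs hs.step
      old := h.old.step hs.step
      loc := h.loc.gstep h.ctl h.ent h.old hs hs.step
      ord := hord
      cache := h.cache.gstep h.ctl hctl h.ord hs
      reads := h.reads.gstep h.ctl hctl h.ent h.clk h.stab h.loc hs
      res := h.res.gstep h.ctl hctl h.clk h.loc h.stab h.ord hord h.cache h.reads hs }

theorem Inv.initial (C : Config.{u, v, w}) : Inv (State.initial C) (Ghost.initial C) where
  ctl := by constructor <;> simp [State.initial, Ghost.initial, Phase.cur, Phase.run]
  ent := by constructor <;> simp [State.initial]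
  clk := by constructor <;> simp [State.initial, Chan]
  stab := by constructor <;> simp [State.initial, Ghost.initial, Safe]
  old := by constructor <;> simp [State.initial]
  loc := by simp [Loc, Ghost.initial]
  ord := by constructor <;> simp [State.initial, Ghost.initial, Phase.cur]
  cache := by constructor <;> simp [State.initial, IsFreshest, recent]
  reads := by constructor <;> simp [State.initial]
  res := by constructor <;> simp [State.initial, Phase.cur]

theorem Reachable.exists_inv (hs : Reachable s) : ∃ g, Inv s g := by
  induction hs with
  | refl => exact ⟨_, .initial C⟩
  | tail _ hstep ih =>
    obtain ⟨g, hg⟩ := ih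
    obtain ⟨g', hg'⟩ := hstep.exists_gstep g
    exact ⟨g', hg.gstep hg'⟩

end PaRiS

theorem proposition3 (C : PaRiS.Config) (s : PaRiS.State C) (hs : PaRiS.Reachable s) :
    -- every read belongs to a transaction that has been started and so has a snapshot
    (∀ (i : ℕ) (c : C.Client) (id : PaRiS.TxId) (χ : Finset C.Key)
        (D : C.Key → Option (PaRiS.Result C)),
      s.hist[i]? = some (PaRiS.Op.read c id χ D) →
        ∃ st cache, PaRiS.Op.start c id st cache ∈ s.hist.take i) ∧
    ∀ (c : C.Client) (id : PaRiS.TxId) (st : ℕ) (cache : C.Key → Option (PaRiS.Version C)),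
      PaRiS.Op.start c id st cache ∈ s.hist →
      -- the snapshot is causally consistent
      PaRiS.IsCausalSnapshot s (PaRiS.snapshot s c id st) ∧
      -- the client's cache shows, for every key, the client's own part of the snapshot
      (∀ k, PaRiS.IsFreshest PaRiS.Version.rank
        {X ∈ PaRiS.ownPart s c id st | X.key = k} (cache k)) ∧
      -- all reads of the transaction are from the snapshot, up to the transaction's own writes
      (∀ (i : ℕ) (χ : Finset C.Key) (D : C.Key → Option (PaRiS.Result C)),
        s.hist[i]? = some (PaRiS.Op.read c id χ D) → ∀ k ∈ χ,
          PaRiS.ReadsCorrectly (PaRiS.bufferedWrites (s.hist.take i) id)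
            (PaRiS.snapshot s c id st) k (D k)) := by
  obtain ⟨g, hg⟩ := hs.exists_inv
  refine ⟨hg.res.started, fun c id st cache hstart => ⟨?_, ?_, ?_⟩⟩
  · exact PaRiS.isCausalSnapshot hg.ctl hg.ord hg.res hstart
  · exact hg.cache.start c id st cache hstart
  · exact fun i χ D hi => hg.res.correct i c id χ D st cache hi hstart
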